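/- Let $\mathbb T^2=(\mathbb R/2\pi\mathbb Z)^2$ with Lebesgue measure, $H=L^2(\mathbb T^2;\mathbb R)$, ${\bf e}_k(x)=\frac1{2\pi}e^{\sqrt{-1}\,k\cdot x}$ $(k\in\mathbb Z^2)$, and for $s\in\mathbb R$ let $H^s(\mathbb T^2)$ be the real Hilbert space of distributions $u$ on $\mathbb T^2$ with $\hat u(-k)=\overline{\hat u(k)}$ and $\|u\|_{H^s}^2=\sum_{k\in\mathbb Z^2}(1+|k|^2)^s|\hat u(k)|^2<\infty$, where $\hat u(k)=\langle u,{\bf e}_k\rangle$. Fix $\delta>0$, put $E=H^{-\delta}(\mathbb T^2)$ and $A=(1-\Delta)^{-1}$, and let $\mu_0=N(0,A^{1+\delta})$ be the massive Gaussian free field, i.e. the unique centred Gaussian probability measure on $E$ with $\int_E (l_1,z)_E(l_2,z)_E\,\mu_0(dz)=(A^{1+\delta}l_1,l_2)_E$ for $l_1,l_2\in E$. Call $\Lambda\subset\mathbb R^2$ admissible if it is compact, $\Lambda=-\Lambda$, and $0$ is an interior point of $\Lambda$. For such $\Lambda$ and $z\in E$, $x\in\mathbb T^2$, $n\ge 0$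 put $$(\Pi_\Lambda z)(x)=\sum_{k\in\Lambda\cap\mathbb Z^2}\hat z(k){\bf e}_k(x),\qquad \rho_\Lambda=\frac1{2\pi}\Big\{\sum_{k\in\Lambda\cap\mathbb Z^2}\frac1{1+|k|^2}\Big\}^{1/2},\qquad \Phi_{n,\Lambda}(z)_x=\sqrt{n!}\,\rho_\Lambda^n\,\mathbb H_n\big(\rho_\Lambda^{-1}(\Pi_\Lambda z)(x)\big),$$ with $\mathbb H_n(\xi)=\frac{(-1)^n}{\sqrt{n!}}e^{\xi^2/2}\frac{d^n}{d\xi^n}e^{-\xi^2/2}$; the function $x\mapsto\Phi_{n,\Lambda}(z)_x$ is regarded as an element of $H^{-\alpha}(\mathbb T^2)$, $\alpha>0$, and $(\Phi_{n,\Lambda}(z),g)_H=\int_{\mathbb T^2}\Phi_{n,\Lambda}(z)_x\,g(x)\,dx$ for $g\in H$. Let $p\ge2$ and $a\in\mathbb R$. (1) Let $0<\alpha\le1$. For every $n\ge0$ there is a Wick power $\Phi_n:E\to H^{-\alpha}(\mathbb T^2)$, that is, a ($\mu_0$-a.e. unique) map such that for all admissible $\Lambda$ and all $q\ge1$, $\Phi_{n,N\Lambda}\to\Phi_n$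 in $L^q(\mu_0;H^{-\alpha}(\mathbb T^2))$ as $N\to\infty$. If $|a|<\sqrt{\frac{4\pi\alpha}{p-1}}$, then the series $\sum_{n=0}^\infty\frac{a^n}{n!}\Phi_n$ converges in $L^p(\mu_0;H^{-\alpha}(\mathbb T^2))$. (2) Let $g\in H$. For every $n\ge0$ there is a ($\mu_0$-a.e. unique) function $\Phi_n(\cdot)(g):E\to\mathbb R$ such that for all admissible $\Lambda$ and all $q\ge1$, $(\Phi_{n,N\Lambda}(\cdot),g)_H\to\Phi_n(\cdot)(g)$ in $L^q(\mu_0)$ as $N\to\infty$. If $|a|<\sqrt{\frac{4\pi}{p-1}}$, then the series $\sum_{n=0}^\infty\frac{a^n}{n!}\Phi_n(\cdot)(g)$ converges in $L^p(\mu_0)$. -/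

import Mathlib

noncomputable section

namespace TorusField

open MeasureTheory ProbabilityTheory Filter Topology
open scoped ENNReal NNReal ContDiff Pointwise RealInnerProductSpace

instance instFactTwoPiPos : Fact (0 < 2 * Real.pi) := ⟨Real.two_pi_pos⟩

/-- The torus `(ℝ / 2πℤ)²`; its `volume` is Lebesgue measure, of total mass `4π²`. -/
abbrev Torus : Type := AddCircle (2 * Real.pi) × AddCircle (2 * Real.pi)

/-- The character `e_k(x) = (2π)⁻¹ exp(i k·x)`. -/
def expo (k : ℤ × ℤ) (x : Torus) : ℂ :=
  (2 * Real.pi : ℂ)⁻¹ * (fourier k.1 x.1 * fourier k.2 x.2)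

/-- `λ_k = 1 + |k|²`, with the Euclidean norm of `k`. -/
def lam (k : ℤ × ℤ) : ℝ := 1 + ((k.1 : ℝ) ^ 2 + (k.2 : ℝ) ^ 2)

/-! ### Test functions and distributions -/

/-- A function on the torus, read as a doubly periodic function on the plane. -/
def lift (φ : Torus → ℂ) (x : ℝ × ℝ) : ℂ := φ (x.1, x.2)

/-- The space `C^∞(𝕋²; ℂ)`. -/
def TestFunction : Submodule ℂ (Torus → ℂ) where
  carrier := {φ | ContDiff ℝ ∞ (lift φ)}
  add_mem' {φ ψ} (h₁ : ContDiff ℝ ∞ (lift φ)) (h₂ : ContDiff ℝ ∞ (lift ψ)) := h₁.add h₂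
  zero_mem' := (contDiff_const : ContDiff ℝ ∞ fun _ : ℝ × ℝ => (0 : ℂ))
  smul_mem' c φ (h : ContDiff ℝ ∞ (lift φ)) :=
    (contDiff_const : ContDiff ℝ ∞ fun _ : ℝ × ℝ => c).smul h

/-- The partial derivative `∂/∂x₁`. -/
def partial₁ (φ : Torus → ℂ) (x : Torus) : ℂ := deriv (fun s : ℝ => φ (x.1 + s, x.2)) 0

/-- The partial derivative `∂/∂x₂`. -/
def partial₂ (φ : Torus → ℂ) (x : Torus) : ℂ := deriv (fun s : ℝ => φ (x.1, x.2 + s)) 0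

/-- The distributions on the torus: linear functionals `u` on `C^∞(𝕋²; ℂ)` such that
`|u(φ)| ≤ C max_{i + j ≤ N} max_x |∂₁^i ∂₂^j φ(x)|` for some `N` and `C`. The maximum is
expressed through its upper bounds `B`. -/
def Distribution : Submodule ℂ (TestFunction →ₗ[ℂ] ℂ) where
  carrier := {u | ∃ (N : ℕ) (C : ℝ), ∀ (φ : TestFunction) (B : ℝ),
    (∀ i j : ℕ, i + j ≤ N → ∀ x, ‖(partial₁^[i] (partial₂^[j] φ.1)) x‖ ≤ B) → ‖u φ‖ ≤ C * B}
  add_mem' := by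
    rintro u v ⟨N, C, h⟩ ⟨N', C', h'⟩
    refine ⟨max N N', C + C', fun φ B hB => ?_⟩
    have h1 := h φ B fun i j hij => hB i j (hij.trans (le_max_left _ _))
    have h2 := h' φ B fun i j hij => hB i j (hij.trans (le_max_right _ _))
    calc ‖(u + v) φ‖ ≤ ‖u φ‖ + ‖v φ‖ := norm_add_le _ _
      _ ≤ (C + C') * B := by linarith
  zero_mem' := ⟨0, 0, fun φ B _ => by simp⟩
  smul_mem' := by
    rintro c u ⟨N, C, h⟩
    refine ⟨N, ‖c‖ * C, fun φ B hB => ?_⟩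
    have := h φ B hB
    simp only [LinearMap.smul_apply, smul_eq_mul, norm_mul, mul_assoc]
    gcongr

lemma smooth {φ : Torus → ℂ} (h : φ ∈ TestFunction) : ContDiff ℝ ∞ (lift φ) := h

lemma continuous_of_lift {φ : Torus → ℂ} (h : Continuous (lift φ)) : Continuous φ := by
  have hq : IsQuotientMap (Prod.map (fun x : ℝ => (x : AddCircle (2 * Real.pi)))
      (fun x : ℝ => (x : AddCircle (2 * Real.pi)))) :=
    (((QuotientAddGroup.isOpenMap_coe).prodMap (QuotientAddGroup.isOpenMap_coe)).isQuotientMap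
      (by fun_prop) (Prod.map_surjective.2 ⟨QuotientAddGroup.mk_surjective, QuotientAddGroup.mk_surjective⟩))
  exact hq.continuous_iff.2 h

lemma continuous_test (φ : TestFunction) : Continuous φ.1 :=
  continuous_of_lift (smooth φ.2).continuous

lemma lift_partial₁ (φ : Torus → ℂ) (h : ContDiff ℝ ∞ (lift φ)) (x : ℝ × ℝ) :
    lift (partial₁ φ) x = fderiv ℝ (lift φ) x (1, 0) := by
  have hd : HasFDerivAt (lift φ) (fderiv ℝ (lift φ) x) (x + (0 : ℝ) • ((1 : ℝ), (0 : ℝ))) := by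
    simpa using (h.differentiable (by simp) x).hasFDerivAt
  have hl : HasDerivAt (fun s : ℝ => x + s • ((1 : ℝ), (0 : ℝ))) (1, 0) 0 := by
    simpa using ((hasDerivAt_id (0 : ℝ)).smul_const ((1 : ℝ), (0 : ℝ))).const_add x
  have := hd.comp_hasDerivAt (0 : ℝ) hl
  rw [← this.deriv]
  simp [lift, partial₁, Function.comp_def]

lemma lift_partial₂ (φ : Torus → ℂ) (h : ContDiff ℝ ∞ (lift φ)) (x : ℝ × ℝ) :
    lift (partial₂ φ) x = fderiv ℝ (lift φ) x (0, 1) := by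
  have hd : HasFDerivAt (lift φ) (fderiv ℝ (lift φ) x) (x + (0 : ℝ) • ((0 : ℝ), (1 : ℝ))) := by
    simpa using (h.differentiable (by simp) x).hasFDerivAt
  have hl : HasDerivAt (fun s : ℝ => x + s • ((0 : ℝ), (1 : ℝ))) (0, 1) 0 := by
    simpa using ((hasDerivAt_id (0 : ℝ)).smul_const ((0 : ℝ), (1 : ℝ))).const_add x
  have := hd.comp_hasDerivAt (0 : ℝ) hl
  rw [← this.deriv]
  simp [lift, partial₂, Function.comp_def]

lemma contDiff_partial₁ {φ : Torus → ℂ} (h : φ ∈ TestFunction) : partial₁ φ ∈ TestFunction := by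
  have : lift (partial₁ φ) = fun x => fderiv ℝ (lift φ) x (1, 0) := funext (lift_partial₁ φ h)
  change ContDiff ℝ ∞ (lift (partial₁ φ))
  rw [this]
  exact ((smooth h).fderiv_right (m := ∞) (by simp)).clm_apply contDiff_const

lemma contDiff_partial₂ {φ : Torus → ℂ} (h : φ ∈ TestFunction) : partial₂ φ ∈ TestFunction := by
  have : lift (partial₂ φ) = fun x => fderiv ℝ (lift φ) x (0, 1) := funext (lift_partial₂ φ h)
  change ContDiff ℝ ∞ (lift (partial₂ φ))
  rw [this]
  exact ((smooth h).fderiv_right (m := ∞) (by simp)).clm_apply contDiff_const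

lemma hasDerivAt_slice₁ {φ : Torus → ℂ} (h : φ ∈ TestFunction) (s : ℝ) (y : AddCircle (2 * Real.pi)) :
    HasDerivAt (fun s : ℝ => φ (s, y)) (partial₁ φ (s, y)) s := by
  obtain ⟨t, rfl⟩ := QuotientAddGroup.mk_surjective y
  have h1 : HasFDerivAt (lift φ) (fderiv ℝ (lift φ) (s, t)) (s, t) :=
    ((smooth h).differentiable (by simp) (s, t)).hasFDerivAt
  have h2 : HasDerivAt (fun s : ℝ => (s, t)) ((1 : ℝ), (0 : ℝ)) s :=
    (hasDerivAt_id s).prodMk (hasDerivAt_const s t)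
  have := h1.comp_hasDerivAt s h2
  rw [← lift_partial₁ φ h] at this
  exact this

lemma hasDerivAt_slice₂ {φ : Torus → ℂ} (h : φ ∈ TestFunction) (y : AddCircle (2 * Real.pi)) (t : ℝ) :
    HasDerivAt (fun t : ℝ => φ (y, t)) (partial₂ φ (y, t)) t := by
  obtain ⟨s, rfl⟩ := QuotientAddGroup.mk_surjective y
  have h1 : HasFDerivAt (lift φ) (fderiv ℝ (lift φ) (s, t)) (s, t) :=
    ((smooth h).differentiable (by simp) (s, t)).hasFDerivAt
  have h2 : HasDerivAt (fun t : ℝ => (s, t)) ((0 : ℝ), (1 : ℝ)) t :=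
    (hasDerivAt_const t s).prodMk (hasDerivAt_id t)
  have := h1.comp_hasDerivAt t h2
  rw [← lift_partial₂ φ h] at this
  exact this

lemma integrable_of_continuous {φ : Torus → ℂ} (h : Continuous φ) : Integrable φ :=
  h.integrable_of_hasCompactSupport (HasCompactSupport.of_compactSpace φ)

lemma integral_circle_deriv {f g : AddCircle (2 * Real.pi) → ℂ} (hg : Continuous g)
    (h : ∀ s : ℝ, HasDerivAt (fun s : ℝ => f s) (g s) s) : ∫ x, g x = 0 := by
  rw [← AddCircle.intervalIntegral_preimage (2 * Real.pi) 0]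
  rw [intervalIntegral.integral_eq_sub_of_hasDerivAt (f := fun s : ℝ => f s)
    (fun s _ => h s) (by apply Continuous.intervalIntegrable; fun_prop)]
  simp only [zero_add, sub_eq_zero]
  congr 1
  simp

lemma integral_partial₁ {φ : Torus → ℂ} (h : φ ∈ TestFunction) : ∫ x, partial₁ φ x = 0 := by
  have hc : Continuous (partial₁ φ) := continuous_test ⟨_, contDiff_partial₁ h⟩
  have hi : Integrable (partial₁ φ) (volume.prod volume) := integrable_of_continuous hc
  change ∫ x, partial₁ φ x ∂(volume.prod volume) = 0
  rw [integral_prod_symm _ hi]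
  have : ∀ y, ∫ x, partial₁ φ (x, y) = 0 := fun y =>
    integral_circle_deriv (f := fun x => φ (x, y)) (by fun_prop)
      fun s => hasDerivAt_slice₁ h s y
  simp [this]

lemma integral_partial₂ {φ : Torus → ℂ} (h : φ ∈ TestFunction) : ∫ x, partial₂ φ x = 0 := by
  have hc : Continuous (partial₂ φ) := continuous_test ⟨_, contDiff_partial₂ h⟩
  have hi : Integrable (partial₂ φ) (volume.prod volume) := integrable_of_continuous hc
  change ∫ x, partial₂ φ x ∂(volume.prod volume) = 0
  rw [integral_prod _ hi]
  have : ∀ y, ∫ x, partial₂ φ (y, x) = 0 := fun y =>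
    integral_circle_deriv (f := fun x => φ (y, x)) (by fun_prop)
      fun s => hasDerivAt_slice₂ h y s
  simp [this]

lemma lift_expo (k : ℤ × ℤ) (x : ℝ × ℝ) :
    lift (expo k) x = (2 * Real.pi : ℂ)⁻¹ * Complex.exp (Complex.I * (k.1 * x.1 + k.2 * x.2)) := by
  simp only [lift, expo, fourier_coe_apply]
  rw [← Complex.exp_add]
  congr 2
  have : (Real.pi : ℂ) ≠ 0 := by exact_mod_cast Real.pi_ne_zero
  push_cast
  field_simp

lemma expo_mem (k : ℤ × ℤ) : expo k ∈ TestFunction := by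
  change ContDiff ℝ ∞ (lift (expo k))
  rw [funext (lift_expo k)]
  have h1 : ContDiff ℝ ∞ (fun x : ℝ × ℝ => (x.1 : ℂ)) := Complex.ofRealCLM.contDiff.comp contDiff_fst
  have h2 : ContDiff ℝ ∞ (fun x : ℝ × ℝ => (x.2 : ℂ)) := Complex.ofRealCLM.contDiff.comp contDiff_snd
  exact contDiff_const.mul (contDiff_const.mul
    ((contDiff_const.mul h1).add (contDiff_const.mul h2))).cexp

/-- `e_k` as a test function. -/
def expoTest (k : ℤ × ℤ) : TestFunction := ⟨expo k, expo_mem k⟩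

/-- The Fourier coefficient `û(k) = ⟨u, e_k⟩`, where `⟨·,·⟩` extends the `L²` product that is
conjugate-linear in the second place; so `û(k)` is the value of `u` at `conj e_k = e_{-k}`. -/
def fcoeff (u : Distribution) (k : ℤ × ℤ) : ℂ := u.1 (expoTest (-k))

lemma partial₁_expo (k : ℤ × ℤ) : partial₁ (expo k) = (Complex.I * k.1) • expo k := by
  funext x
  obtain ⟨s, hs⟩ := QuotientAddGroup.mk_surjective x.1
  obtain ⟨t, ht⟩ := QuotientAddGroup.mk_surjective x.2
  obtain rfl : x = ((s : AddCircle (2 * Real.pi)), (t : AddCircle (2 * Real.pi))) :=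
    Prod.ext hs.symm ht.symm
  have h := (hasDerivAt_slice₁ (expo_mem k) s t).deriv
  rw [← h]
  have : (fun s : ℝ => expo k (s, t)) = fun s : ℝ => (2 * Real.pi : ℂ)⁻¹ *
      Complex.exp (Complex.I * (k.1 * s + k.2 * t)) := funext fun s => lift_expo k (s, t)
  rw [this, Pi.smul_apply, smul_eq_mul, show expo k (s, t) = _ from lift_expo k (s, t)]
  have h1 : HasDerivAt (fun s : ℝ => (s : ℂ)) 1 s := Complex.ofRealCLM.hasDerivAt
  have h2 := ((((h1.const_mul (k.1 : ℂ)).add_const (k.2 * t : ℂ)).const_mul Complex.I).cexp).const_mul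
    (2 * Real.pi : ℂ)⁻¹
  rw [h2.deriv]
  ring

lemma partial₂_expo (k : ℤ × ℤ) : partial₂ (expo k) = (Complex.I * k.2) • expo k := by
  funext x
  obtain ⟨s, hs⟩ := QuotientAddGroup.mk_surjective x.1
  obtain ⟨t, ht⟩ := QuotientAddGroup.mk_surjective x.2
  obtain rfl : x = ((s : AddCircle (2 * Real.pi)), (t : AddCircle (2 * Real.pi))) :=
    Prod.ext hs.symm ht.symm
  have h := (hasDerivAt_slice₂ (expo_mem k) s t).deriv
  rw [← h]
  have : (fun t : ℝ => expo k (s, t)) = fun t : ℝ => (2 * Real.pi : ℂ)⁻¹ *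
      Complex.exp (Complex.I * (k.1 * s + k.2 * t)) := funext fun t => lift_expo k (s, t)
  rw [this, Pi.smul_apply, smul_eq_mul, show expo k (s, t) = _ from lift_expo k (s, t)]
  have h1 : HasDerivAt (fun s : ℝ => (s : ℂ)) 1 t := Complex.ofRealCLM.hasDerivAt
  have h2 := ((((h1.const_mul (k.2 : ℂ)).const_add (k.1 * s : ℂ)).const_mul Complex.I).cexp).const_mul
    (2 * Real.pi : ℂ)⁻¹
  rw [h2.deriv]
  ring

lemma continuous_expo (k : ℤ × ℤ) : Continuous (expo k) := continuous_test (expoTest k)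

lemma norm_expo (k : ℤ × ℤ) (x : Torus) : ‖expo k x‖ = (2 * Real.pi)⁻¹ := by
  rw [expo, norm_mul, norm_mul, fourier_apply, fourier_apply, Circle.norm_coe, Circle.norm_coe]
  simp [abs_of_pos Real.pi_pos]

lemma expo_mul_mem (k : ℤ × ℤ) {φ : Torus → ℂ} (h : φ ∈ TestFunction) :
    expo k * φ ∈ TestFunction := (smooth (expo_mem k)).mul (smooth h)

lemma slice_deriv₁ {φ : Torus → ℂ} (h : φ ∈ TestFunction) (x : Torus) :
    HasDerivAt (fun s : ℝ => φ (x.1 + s, x.2)) (partial₁ φ x) 0 := by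
  obtain ⟨s, hs⟩ := QuotientAddGroup.mk_surjective x.1
  have := hasDerivAt_slice₁ h (s + 0) x.2
  have h2 := this.comp_const_add s 0
  simp only [AddCircle.coe_add] at h2
  have hs' : (s : AddCircle (2 * Real.pi)) = x.1 := hs
  simpa [hs'] using h2

lemma slice_deriv₂ {φ : Torus → ℂ} (h : φ ∈ TestFunction) (x : Torus) :
    HasDerivAt (fun s : ℝ => φ (x.1, x.2 + s)) (partial₂ φ x) 0 := by
  obtain ⟨s, hs⟩ := QuotientAddGroup.mk_surjective x.2
  have := hasDerivAt_slice₂ h x.1 (s + 0)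
  have h2 := this.comp_const_add s 0
  simp only [AddCircle.coe_add] at h2
  have hs' : (s : AddCircle (2 * Real.pi)) = x.2 := hs
  simpa [hs'] using h2

/-- `∫ e_k φ dx`. -/
def pairing (k : ℤ × ℤ) (φ : Torus → ℂ) : ℂ := ∫ x, expo k x * φ x

lemma pairing_partial₁ (k : ℤ × ℤ) {φ : Torus → ℂ} (h : φ ∈ TestFunction) :
    pairing k (partial₁ φ) = -(Complex.I * k.1) * pairing k φ := by
  have h0 := integral_partial₁ (expo_mul_mem k h)
  have : partial₁ (expo k * φ) = fun x => (Complex.I * k.1) * (expo k x * φ x)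
      + expo k x * partial₁ φ x := by
    funext x
    have := ((slice_deriv₁ (expo_mem k) x).mul (slice_deriv₁ h x)).deriv
    refine Eq.trans this ?_
    simp [partial₁_expo]
    ring
  have c1 := continuous_expo k
  have c2 := continuous_test ⟨φ, h⟩
  have c3 := continuous_test ⟨_, contDiff_partial₁ h⟩
  simp only at c2 c3
  rw [this, integral_add (integrable_of_continuous (by fun_prop))
    (integrable_of_continuous (by fun_prop)), integral_const_mul] at h0
  simp only [pairing]
  linear_combination h0

lemma pairing_partial₂ (k : ℤ × ℤ) {φ : Torus → ℂ} (h : φ ∈ TestFunction) :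
    pairing k (partial₂ φ) = -(Complex.I * k.2) * pairing k φ := by
  have h0 := integral_partial₂ (expo_mul_mem k h)
  have : partial₂ (expo k * φ) = fun x => (Complex.I * k.2) * (expo k x * φ x)
      + expo k x * partial₂ φ x := by
    funext x
    have := ((slice_deriv₂ (expo_mem k) x).mul (slice_deriv₂ h x)).deriv
    refine Eq.trans this ?_
    simp [partial₂_expo]
    ring
  have c1 := continuous_expo k
  have c2 := continuous_test ⟨φ, h⟩
  have c3 := continuous_test ⟨_, contDiff_partial₂ h⟩
  simp only at c2 c3
  rw [this, integral_add (integrable_of_continuous (by fun_prop))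
    (integrable_of_continuous (by fun_prop)), integral_const_mul] at h0
  simp only [pairing]
  linear_combination h0

lemma partial₁_iter_mem {φ : Torus → ℂ} (h : φ ∈ TestFunction) (i : ℕ) :
    partial₁^[i] φ ∈ TestFunction := by
  induction i with
  | zero => exact h
  | succ n ih => rw [Function.iterate_succ_apply']; exact contDiff_partial₁ ih

lemma partial₂_iter_mem {φ : Torus → ℂ} (h : φ ∈ TestFunction) (i : ℕ) :
    partial₂^[i] φ ∈ TestFunction := by
  induction i with
  | zero => exact h
  | succ n ih => rw [Function.iterate_succ_apply']; exact contDiff_partial₂ ih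

lemma pairing_iter (k : ℤ × ℤ) {φ : Torus → ℂ} (h : φ ∈ TestFunction) (i j : ℕ) :
    pairing k (partial₁^[i] (partial₂^[j] φ)) =
      (-(Complex.I * k.1)) ^ i * ((-(Complex.I * k.2)) ^ j * pairing k φ) := by
  have h2 : ∀ j, pairing k (partial₂^[j] φ) = (-(Complex.I * k.2)) ^ j * pairing k φ := by
    intro j
    induction j with
    | zero => simp
    | succ n ih =>
      rw [Function.iterate_succ_apply', pairing_partial₂ k (partial₂_iter_mem h n), ih]; ring
  induction i with
  | zero => simp [h2]
  | succ n ih =>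
    rw [Function.iterate_succ_apply', pairing_partial₁ k (partial₁_iter_mem (partial₂_iter_mem h j) n),
      ih]; ring

lemma volume_torus : (volume : Measure Torus).real Set.univ = (2 * Real.pi) ^ 2 := by
  have : (volume : Measure Torus) = (volume : Measure (AddCircle (2 * Real.pi))).prod volume := rfl
  rw [this, ← Set.univ_prod_univ, measureReal_prod_prod]
  simp [Measure.real, AddCircle.measure_univ, Real.pi_pos.le, sq]

lemma norm_pairing_le (k : ℤ × ℤ) {φ : Torus → ℂ} {B : ℝ} (h : ∀ x, ‖φ x‖ ≤ B) :
    ‖pairing k φ‖ ≤ (2 * Real.pi) * B := by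
  have : ∀ x, ‖expo k x * φ x‖ ≤ (2 * Real.pi)⁻¹ * B := fun x => by
    rw [norm_mul, norm_expo]; have := Real.pi_pos; gcongr; exact h x
  refine (norm_integral_le_of_norm_le_const (μ := volume) (Eventually.of_forall this)).trans_eq ?_
  rw [volume_torus]
  have := Real.pi_pos
  field_simp

lemma lam_pos (k : ℤ × ℤ) : 0 < lam k := by unfold lam; positivity

lemma one_le_lam (k : ℤ × ℤ) : 1 ≤ lam k := by
  unfold lam; linarith [sq_nonneg (k.1 : ℝ), sq_nonneg (k.2 : ℝ)]

lemma lam_neg (k : ℤ × ℤ) : lam (-k) = lam k := by simp [lam]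

/-- Rapid decay of the Fourier coefficients of a test function. -/
lemma lam_pow_mul_norm_pairing_le (m : ℕ) (k : ℤ × ℤ) (φ : TestFunction) {B : ℝ}
    (h : ∀ i j : ℕ, i + j ≤ 4 * m → ∀ x, ‖(partial₁^[i] (partial₂^[j] φ.1)) x‖ ≤ B) :
    lam k ^ m * ‖pairing k φ.1‖ ≤ 4 ^ m * ((2 * Real.pi) * B) := by
  have key : ∀ i j : ℕ, i + j ≤ 4 * m →
      (k.1 ^ i : ℝ) * k.2 ^ j * ‖pairing k φ.1‖ ≤ (2 * Real.pi) * B := by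
    intro i j hij
    have h1 := norm_pairing_le k (h i j hij)
    rw [pairing_iter k φ.2] at h1
    simp only [norm_mul, norm_pow, norm_neg, Complex.norm_I, one_mul, Complex.norm_intCast] at h1
    refine le_trans ?_ h1
    rw [← mul_assoc]
    refine mul_le_mul_of_nonneg_right ?_ (norm_nonneg _)
    rw [← abs_pow, ← abs_pow, ← abs_mul]
    exact le_abs_self _
  have h1 : ∀ n : ℤ, (1 + (n : ℝ) ^ 2) ^ m ≤ 2 ^ m * 1 ∨ (1 + (n : ℝ) ^ 2) ^ m ≤ 2 ^ m * (n : ℝ) ^ (2 * m) := by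
    intro n
    rcases le_total ((n : ℝ) ^ 2) 1 with h | h
    · left; rw [mul_one]; gcongr; linarith
    · right; rw [pow_mul, ← mul_pow]; gcongr; linarith
  have h2 : lam k ^ m ≤ (1 + (k.1 : ℝ) ^ 2) ^ m * (1 + (k.2 : ℝ) ^ 2) ^ m := by
    rw [← mul_pow]; unfold lam; gcongr
    nlinarith [mul_nonneg (sq_nonneg (k.1 : ℝ)) (sq_nonneg (k.2 : ℝ))]
  have h4 : (4 : ℝ) ^ m = 2 ^ m * 2 ^ m := by rw [← mul_pow]; norm_num
  have fin : ∀ a b : ℝ, 0 ≤ a → 0 ≤ b → a * b * ‖pairing k φ.1‖ ≤ (2 * Real.pi) * B →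
      (1 + (k.1 : ℝ) ^ 2) ^ m ≤ 2 ^ m * a → (1 + (k.2 : ℝ) ^ 2) ^ m ≤ 2 ^ m * b →
      lam k ^ m * ‖pairing k φ.1‖ ≤ 4 ^ m * ((2 * Real.pi) * B) := by
    intro a b ha hb hab h5 h6
    calc lam k ^ m * ‖pairing k φ.1‖ ≤ ((2 ^ m * a) * (2 ^ m * b)) * ‖pairing k φ.1‖ := by
          refine mul_le_mul_of_nonneg_right (h2.trans ?_) (norm_nonneg _)
          gcongr
      _ = 4 ^ m * (a * b * ‖pairing k φ.1‖) := by rw [h4]; ring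
      _ ≤ _ := by gcongr
  rcases h1 k.1 with h5 | h5 <;> rcases h1 k.2 with h6 | h6
  · exact fin _ _ (by norm_num) (by norm_num) (by simpa using key 0 0 (by omega)) h5 h6
  · exact fin _ _ (by norm_num) (by rw [pow_mul]; positivity)
      (by simpa using key 0 (2 * m) (by omega)) h5 h6
  · exact fin _ _ (by rw [pow_mul]; positivity) (by norm_num)
      (by simpa using key (2 * m) 0 (by omega)) h5 h6
  · exact fin _ _ (by rw [pow_mul]; positivity) (by rw [pow_mul]; positivity)
      (key (2 * m) (2 * m) (by omega)) h5 h6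

lemma exists_bound (φ : TestFunction) (N : ℕ) : ∃ B : ℝ, 0 ≤ B ∧ ∀ i j : ℕ, i + j ≤ N →
    ∀ x, ‖(partial₁^[i] (partial₂^[j] φ.1)) x‖ ≤ B := by
  have : ∀ p : ℕ × ℕ, ∃ B : ℝ, 0 ≤ B ∧ ∀ x, ‖(partial₁^[p.1] (partial₂^[p.2] φ.1)) x‖ ≤ B := by
    intro p
    have hc : Continuous (partial₁^[p.1] (partial₂^[p.2] φ.1)) :=
      continuous_test ⟨_, partial₁_iter_mem (partial₂_iter_mem φ.2 _) _⟩
    obtain ⟨B, hB⟩ := isCompact_univ.exists_bound_of_continuousOn hc.continuousOn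
    exact ⟨B, (norm_nonneg _).trans (hB 0 trivial), fun x => hB x trivial⟩
  choose B hB0 hB using this
  refine ⟨∑ p ∈ Finset.range (N + 1) ×ˢ Finset.range (N + 1), B p,
    Finset.sum_nonneg fun p _ => hB0 p, fun i j hij x => (hB (i, j) x).trans ?_⟩
  exact Finset.single_le_sum (f := B) (fun p _ => hB0 p)
    (Finset.mem_product.2 ⟨Finset.mem_range.2 (by simp; omega), Finset.mem_range.2 (by simp; omega)⟩)

lemma summable_lam_rpow {b : ℝ} (hb : 1 < b) : Summable fun k : ℤ × ℤ => lam k ^ (-b) := by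
  have h1 : Summable fun n : ℤ => (1 + (n : ℝ) ^ 2) ^ (-(b / 2)) := by
    have h0 := (Real.summable_abs_int_rpow hb).add
      (summable_of_ne_finset_zero (f := fun n : ℤ => if n = 0 then (1 : ℝ) else 0) (s := {0})
        (by intro n hn; simpa using hn))
    refine Summable.of_nonneg_of_le (fun n => by positivity) (fun n => ?_) h0
    by_cases hn : n = 0
    · subst hn; simp [Real.zero_rpow (show -b ≠ 0 by linarith)]
    · simp only [hn, if_false, add_zero]
      have : |(n : ℝ)| ^ (-b) = ((n : ℝ) ^ 2) ^ (-(b / 2)) := by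
        rw [← sq_abs, ← Real.rpow_natCast, ← Real.rpow_mul (abs_nonneg _)]
        congr 1; push_cast; ring
      rw [this]
      refine Real.rpow_le_rpow_of_nonpos (by positivity) (by linarith) (by linarith)
  have h2 := h1.mul_of_nonneg h1 (fun n => by positivity) (fun n => by positivity)
  refine Summable.of_nonneg_of_le (fun k => (Real.rpow_nonneg (lam_pos k).le _)) (fun k => ?_) h2
  have h3 : (lam k) ^ (-b) = (lam k ^ 2) ^ (-(b / 2)) := by
    rw [← Real.rpow_natCast, ← Real.rpow_mul (lam_pos k).le]
    congr 1; push_cast; ring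
  rw [h3, ← Real.mul_rpow (by positivity) (by positivity)]
  refine Real.rpow_le_rpow_of_nonpos (by positivity) ?_ (by linarith)
  unfold lam
  nlinarith [mul_nonneg (sq_nonneg (k.1 : ℝ)) (sq_nonneg (k.2 : ℝ)), sq_nonneg ((k.1 : ℝ) ^ 2 + (k.2 : ℝ) ^ 2),
    sq_nonneg ((k.1 : ℝ) ^ 2), sq_nonneg ((k.2 : ℝ) ^ 2), sq_nonneg (k.1 : ℝ), sq_nonneg (k.2 : ℝ)]

lemma summable_lam_pow_mul_pairing (φ : TestFunction) (m : ℕ) :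
    Summable fun k => lam k ^ m * ‖pairing k φ.1‖ := by
  obtain ⟨B, -, hB⟩ := exists_bound φ (4 * (m + 2))
  refine Summable.of_nonneg_of_le (fun k => mul_nonneg (pow_nonneg (lam_pos k).le _) (norm_nonneg _))
    (fun k => ?_) ((summable_lam_rpow (b := 2) (by norm_num)).mul_left (4 ^ (m + 2) * ((2 * Real.pi) * B)))
  have := lam_pow_mul_norm_pairing_le (m + 2) k φ hB
  rw [Real.rpow_neg (lam_pos k).le, ← div_eq_mul_inv, le_div_iff₀ (Real.rpow_pos_of_pos (lam_pos k) _)]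
  refine le_trans (le_of_eq ?_) this
  rw [show (2 : ℝ) = ((2 : ℕ) : ℝ) by norm_num, Real.rpow_natCast]
  ring

lemma circle_norm_le_tsum {f : AddCircle (2 * Real.pi) → ℂ} (hf : Continuous f)
    (h : Summable fun n => ‖fourierCoeff f n‖) (x : AddCircle (2 * Real.pi)) :
    ‖f x‖ ≤ ∑' n, ‖fourierCoeff f n‖ := by
  have hs : Summable (fourierCoeff (⟨f, hf⟩ : C(AddCircle (2 * Real.pi), ℂ))) := h.of_norm
  have h1 := has_pointwise_sum_fourier_series_of_summable hs x
  have h2 : ∀ n, ‖fourierCoeff f n • fourier n x‖ = ‖fourierCoeff f n‖ := fun n => by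
    rw [norm_smul, fourier_apply, Circle.norm_coe, mul_one]
  have h3 := norm_tsum_le_tsum_norm (f := fun n => fourierCoeff f n • fourier n x)
    (by simpa only [h2] using h)
  simp only [h2] at h3
  exact (congrArg norm h1.tsum_eq).symm.le.trans h3

lemma fourierCoeff_slice (φ : TestFunction) (m n : ℤ) :
    fourierCoeff (fun s => fourierCoeff (fun t => φ.1 (s, t)) n) m =
      (2 * Real.pi : ℂ)⁻¹ * pairing (-m, -n) φ.1 := by
  have hφ := continuous_test φ
  have hc : Continuous fun x : Torus => expo (-m, -n) x * φ.1 x := by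
    have := continuous_expo (-m, -n); fun_prop
  have hi : Integrable (fun x : Torus => expo (-m, -n) x * φ.1 x) (volume.prod volume) :=
    integrable_of_continuous hc
  have h2 : pairing (-m, -n) φ.1 = ∫ s, ∫ t, expo (-m, -n) (s, t) * φ.1 (s, t) :=
    integral_prod _ hi
  rw [h2]
  simp only [fourierCoeff, AddCircle.integral_haarAddCircle, expo, smul_eq_mul, Complex.real_smul]
  rw [← integral_const_mul, ← integral_const_mul]
  congr 1
  funext s
  rw [← integral_const_mul, ← integral_const_mul, ← integral_const_mul, ← integral_const_mul]
  congr 1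
  funext t
  push_cast
  ring

lemma continuous_slice_coeff (φ : TestFunction) (n : ℤ) :
    Continuous fun s => fourierCoeff (fun t => φ.1 (s, t)) n := by
  have hφ := continuous_test φ
  have := continuous_parametric_integral_of_continuous (μ := AddCircle.haarAddCircle)
    (f := fun (s t : AddCircle (2 * Real.pi)) => fourier (-n) t • φ.1 (s, t))
    (by unfold Function.uncurry; fun_prop) isCompact_univ
  simp only [setIntegral_univ] at this
  exact this

lemma summable_pairing (φ : TestFunction) : Summable fun k => ‖pairing k φ.1‖ := by
  simpa using summable_lam_pow_mul_pairing φ 0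

/-- A test function is bounded by the sum of its Fourier coefficients. -/
lemma norm_le_tsum_pairing (φ : TestFunction) (x : Torus) :
    ‖φ.1 x‖ ≤ (2 * Real.pi)⁻¹ * ∑' k, ‖pairing k φ.1‖ := by
  have hπ := Real.pi_pos
  have hφ := continuous_test φ
  have hs : Summable fun p : ℤ × ℤ => (2 * Real.pi)⁻¹ * ‖pairing (-p.2, -p.1) φ.1‖ := by
    have := (summable_pairing φ).mul_left (2 * Real.pi)⁻¹
    exact ((Equiv.prodComm ℤ ℤ).trans (Equiv.neg (ℤ × ℤ))).summable_iff.2 this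
  have hcoef : ∀ n m, ‖fourierCoeff (fun s => fourierCoeff (fun t => φ.1 (s, t)) n) m‖ =
      (2 * Real.pi)⁻¹ * ‖pairing (-m, -n) φ.1‖ := fun n m => by
    rw [fourierCoeff_slice, norm_mul]; simp [abs_of_pos hπ]
  have h1 : ∀ n, ‖fourierCoeff (fun t => φ.1 (x.1, t)) n‖ ≤
      ∑' m, (2 * Real.pi)⁻¹ * ‖pairing (-m, -n) φ.1‖ := fun n => by
    have := circle_norm_le_tsum (continuous_slice_coeff φ n)
      (by simpa only [hcoef] using hs.prod_factor n) x.1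
    simpa only [hcoef] using this
  have hsum := hs.prod
  have h2 : Summable fun n => ‖fourierCoeff (fun t => φ.1 (x.1, t)) n‖ :=
    Summable.of_nonneg_of_le (fun _ => norm_nonneg _) h1 hsum
  have h3 := circle_norm_le_tsum (f := fun t => φ.1 (x.1, t)) (by fun_prop) h2 x.2
  refine h3.trans ((h2.tsum_le_tsum h1 hsum).trans ?_)
  rw [← hs.tsum_prod, ← tsum_mul_left]
  exact (((Equiv.prodComm ℤ ℤ).trans (Equiv.neg (ℤ × ℤ))).tsum_eq
    (fun k => (2 * Real.pi)⁻¹ * ‖pairing k φ.1‖)).le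

lemma pairing_expo (k l : ℤ × ℤ) : pairing k (expo (-l)) = if k = l then 1 else 0 := by
  split_ifs with h
  · subst h
    have : ∀ x, expo k x * expo (-k) x = ((2 * Real.pi)⁻¹ ^ 2 : ℝ) := fun x => by
      simp only [expo, Prod.fst_neg, Prod.snd_neg, fourier_neg]
      have e1 : ∀ (n : ℤ) (y : AddCircle (2 * Real.pi)),
          (fourier n y : ℂ) * (starRingEnd ℂ) (fourier n y) = 1 := fun n y => by
        rw [Complex.mul_conj, fourier_apply, Circle.normSq_coe]; simp
      push_cast
      linear_combination ((2 * Real.pi : ℂ)⁻¹) ^ 2 * (e1 k.1 x.1) * (fourier k.2 x.2 *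
        (starRingEnd ℂ) (fourier k.2 x.2)) + ((2 * Real.pi : ℂ)⁻¹) ^ 2 * (e1 k.2 x.2)
    simp only [pairing, this]
    rw [integral_const, volume_torus]
    have hπ : (Real.pi : ℂ) ≠ 0 := by exact_mod_cast Real.pi_ne_zero
    rw [Complex.real_smul]
    push_cast
    field_simp
  · have lin : ∀ (c : ℂ) (ψ : Torus → ℂ), pairing k (c • ψ) = c * pairing k ψ := fun c ψ => by
      simp only [pairing, Pi.smul_apply, smul_eq_mul]
      rw [← integral_const_mul]; congr 1; funext x; ring
    have h1 := pairing_partial₁ k (expo_mem (-l))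
    have h2 := pairing_partial₂ k (expo_mem (-l))
    rw [partial₁_expo, lin] at h1
    rw [partial₂_expo, lin] at h2
    by_contra h0
    apply h
    have e1 : (Complex.I * ((k.1 - l.1 : ℤ) : ℂ)) * pairing k (expo (-l)) = 0 := by
      push_cast; simp only [Prod.fst_neg, Int.cast_neg] at h1; linear_combination h1
    have e2 : (Complex.I * ((k.2 - l.2 : ℤ) : ℂ)) * pairing k (expo (-l)) = 0 := by
      push_cast; simp only [Prod.snd_neg, Int.cast_neg] at h2; linear_combination h2
    simp only [mul_eq_zero, Complex.I_ne_zero, h0, or_false, false_or, Int.cast_eq_zero] at e1 e2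
    exact Prod.ext (by omega) (by omega)

/-- `∫ e_k φ dx`, as a linear functional of the test function. -/
def pairingL (k : ℤ × ℤ) : TestFunction →ₗ[ℂ] ℂ where
  toFun φ := pairing k φ.1
  map_add' φ ψ := by
    have h1 := continuous_test φ
    have h2 := continuous_test ψ
    have h3 := continuous_expo k
    simp only [pairing]
    rw [← integral_add (integrable_of_continuous (by fun_prop))
      (integrable_of_continuous (by fun_prop))]
    congr 1; funext x; simp [mul_add]
  map_smul' c φ := by
    simp only [pairing, RingHom.id_apply, smul_eq_mul]
    rw [← integral_const_mul]; congr 1; funext x; simp; ring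

/-- A distribution is determined by its Fourier coefficients. -/
theorem fcoeff_injective {u : Distribution} (hu : ∀ k, fcoeff u k = 0) : u = 0 := by
  obtain ⟨N, C, hC⟩ := u.2
  have hu' : ∀ k, u.1 (expoTest k) = 0 := fun k => by simpa [fcoeff] using hu (-k)
  apply Subtype.ext
  apply LinearMap.ext
  intro φ
  classical
  let ψ : Finset (ℤ × ℤ) → TestFunction := fun F =>
    φ - ∑ l ∈ F, pairing l φ.1 • expoTest (-l)
  have hψu : ∀ F, u.1 (ψ F) = u.1 φ := fun F => by simp [ψ, hu']
  have hψp : ∀ F k, pairing k (ψ F).1 = if k ∈ F then 0 else pairing k φ.1 := fun F k => by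
    have : pairing k (ψ F).1 = pairingL k (ψ F) := rfl
    rw [this]
    simp only [ψ, map_sub, map_sum, map_smul]
    have e : ∀ l, pairingL k (expoTest (-l)) = if k = l then 1 else 0 := fun l => pairing_expo k l
    simp only [e, smul_eq_mul, mul_ite, mul_one, mul_zero, Finset.sum_ite_eq]
    split_ifs
    · simp [pairingL]
    · simp [pairingL]
  have hsum := summable_lam_pow_mul_pairing φ N
  have hbound : ∀ F : Finset (ℤ × ℤ), ‖u.1 φ‖ ≤ C * ((2 * Real.pi)⁻¹ *
      ∑' k : {k : ℤ × ℤ // k ∉ F}, lam k.1 ^ N * ‖pairing k.1 φ.1‖) := by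
    intro F
    rw [← hψu F]
    refine hC (ψ F) _ fun i j hij x => ?_
    obtain ⟨χ, hχ⟩ : ∃ χ : TestFunction, χ.1 = partial₁^[i] (partial₂^[j] (ψ F).1) :=
      ⟨⟨_, partial₁_iter_mem (partial₂_iter_mem (ψ F).2 j) i⟩, rfl⟩
    rw [← hχ]
    have h1 := norm_le_tsum_pairing χ x
    refine h1.trans ?_
    have hπ := Real.pi_pos
    refine mul_le_mul_of_nonneg_left ?_ (by positivity)
    have h2 : ∀ k, ‖pairing k χ.1‖ ≤
        ({k | k ∉ F} : Set (ℤ × ℤ)).indicator (fun k => lam k ^ N * ‖pairing k φ.1‖) k := by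
      intro k
      rw [hχ, pairing_iter k (ψ F).2, hψp]
      by_cases hk : k ∈ F
      · simp [hk]
      · simp only [hk, if_false, norm_mul, norm_pow, norm_neg, Complex.norm_I, one_mul,
          Complex.norm_intCast, Set.indicator, Set.mem_ofPred_eq, not_false_eq_true, if_true]
        rw [← mul_assoc]
        refine mul_le_mul_of_nonneg_right ?_ (norm_nonneg _)
        have a1 : |(k.1 : ℝ)| ≤ lam k := by
          unfold lam; nlinarith [sq_abs (k.1 : ℝ), sq_nonneg (|(k.1 : ℝ)| - 1), sq_nonneg (k.2 : ℝ),
            abs_nonneg (k.1 : ℝ)]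
        have a2 : |(k.2 : ℝ)| ≤ lam k := by
          unfold lam; nlinarith [sq_abs (k.2 : ℝ), sq_nonneg (|(k.2 : ℝ)| - 1), sq_nonneg (k.1 : ℝ),
            abs_nonneg (k.2 : ℝ)]
        calc |(k.1 : ℝ)| ^ i * |(k.2 : ℝ)| ^ j ≤ lam k ^ i * lam k ^ j := by
              gcongr; exact pow_nonneg (lam_pos k).le _
          _ = lam k ^ (i + j) := (pow_add _ _ _).symm
          _ ≤ lam k ^ N := pow_le_pow_right₀ (one_le_lam k) hij
    have h3 : Summable (({k | k ∉ F} : Set (ℤ × ℤ)).indicator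
        (fun k => lam k ^ N * ‖pairing k φ.1‖)) := hsum.indicator _
    refine ((summable_pairing χ).tsum_le_tsum h2 h3).trans (le_of_eq ?_)
    exact (tsum_subtype {k | k ∉ F} (fun k => lam k ^ N * ‖pairing k φ.1‖)).symm
  have hlim := tendsto_tsum_compl_atTop_zero (fun k => lam k ^ N * ‖pairing k φ.1‖)
  have hlim2 := (hlim.const_mul (2 * Real.pi)⁻¹).const_mul C
  simp only [mul_zero] at hlim2
  have := ge_of_tendsto' hlim2 hbound
  simpa using this

lemma norm_coeff_mul_pairing_le {c : ℤ × ℤ → ℂ} {M : ℕ} {C : ℝ} (hc : ∀ k, ‖c k‖ ≤ C * lam k ^ M)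
    (φ : TestFunction) {B : ℝ}
    (h : ∀ i j : ℕ, i + j ≤ 4 * (M + 2) → ∀ x, ‖(partial₁^[i] (partial₂^[j] φ.1)) x‖ ≤ B)
    (k : ℤ × ℤ) :
    ‖c k * pairing k φ.1‖ ≤ (C * (4 ^ (M + 2) * ((2 * Real.pi) * B))) * lam k ^ (-2 : ℝ) := by
  have hC : 0 ≤ C := by
    have := (norm_nonneg _).trans (hc 0); simpa [lam] using this
  have h1 := lam_pow_mul_norm_pairing_le (M + 2) k φ h
  rw [Real.rpow_neg (lam_pos k).le, ← div_eq_mul_inv, le_div_iff₀ (Real.rpow_pos_of_pos (lam_pos k) _),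
    show (2 : ℝ) = ((2 : ℕ) : ℝ) by norm_num, Real.rpow_natCast, norm_mul]
  push_cast
  calc ‖c k‖ * ‖pairing k φ.1‖ * lam k ^ 2
      ≤ (C * lam k ^ M) * ‖pairing k φ.1‖ * lam k ^ 2 := by
        gcongr; exact hc k
    _ = C * (lam k ^ (M + 2) * ‖pairing k φ.1‖) := by ring
    _ ≤ _ := by gcongr

/-- Every family of polynomial growth is the family of Fourier coefficients of a distribution. -/
theorem exists_distribution {c : ℤ × ℤ → ℂ} {M : ℕ} {C : ℝ} (hc : ∀ k, ‖c k‖ ≤ C * lam k ^ M) :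
    ∃ u : Distribution, fcoeff u = c := by
  have hs : ∀ φ : TestFunction, Summable fun k => c k * pairingL k φ := fun φ => by
    obtain ⟨B, -, hB⟩ := exists_bound φ (4 * (M + 2))
    exact Summable.of_norm_bounded ((summable_lam_rpow (by norm_num)).mul_left _)
      (norm_coeff_mul_pairing_le hc φ hB)
  let u : TestFunction →ₗ[ℂ] ℂ :=
    { toFun := fun φ => ∑' k, c k * pairingL k φ
      map_add' := fun φ ψ => by
        simp only [map_add, mul_add]; exact (hs φ).tsum_add (hs ψ)
      map_smul' := fun a φ => by
        simp only [map_smul, smul_eq_mul, RingHom.id_apply]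
        rw [← tsum_mul_left]; congr 1; funext k; ring }
  refine ⟨⟨u, 4 * (M + 2), (C * (4 ^ (M + 2) * (2 * Real.pi))) * ∑' k, lam k ^ (-2 : ℝ),
    fun φ B hB => ?_⟩, ?_⟩
  · have h1 := norm_coeff_mul_pairing_le hc φ hB
    have h2 := (summable_lam_rpow (b := 2) (by norm_num)).mul_left
      (C * (4 ^ (M + 2) * ((2 * Real.pi) * B)))
    refine (tsum_of_norm_bounded h2.hasSum h1).trans (le_of_eq ?_)
    rw [tsum_mul_left]; ring
  · funext l
    change ∑' k, c k * pairing k (expo (-l)) = c l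
    simp [pairing_expo]

/-! ### Sobolev spaces -/

/-- The distributions `u` with `û(-k) = conj û(k)` and `∑ (1 + |k|²)^s |û(k)|² < ∞`. -/
def sobolevSubmodule (s : ℝ) : Submodule ℝ Distribution where
  carrier := {u | (∀ k, fcoeff u (-k) = (starRingEnd ℂ) (fcoeff u k)) ∧
    Summable fun k => lam k ^ s * ‖fcoeff u k‖ ^ 2}
  add_mem' := by
    rintro u v ⟨hu, hu'⟩ ⟨hv, hv'⟩
    have e : ∀ k, fcoeff (u + v) k = fcoeff u k + fcoeff v k := fun k => rfl
    refine ⟨fun k => by rw [e, e, hu, hv, map_add], ?_⟩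
    refine Summable.of_nonneg_of_le (fun k => mul_nonneg (Real.rpow_nonneg (lam_pos k).le _)
      (sq_nonneg _)) (fun k => ?_) ((hu'.add hv').mul_left 2)
    rw [e, ← mul_add, mul_left_comm]
    refine mul_le_mul_of_nonneg_left ?_ (Real.rpow_nonneg (lam_pos k).le _)
    have := norm_add_le (fcoeff u k) (fcoeff v k)
    nlinarith [sq_nonneg (‖fcoeff u k‖ - ‖fcoeff v k‖), norm_nonneg (fcoeff u k + fcoeff v k),
      norm_nonneg (fcoeff u k), norm_nonneg (fcoeff v k)]
  zero_mem' := by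
    have e : ∀ k, fcoeff 0 k = 0 := fun k => rfl
    exact ⟨fun k => by simp [e], by simp [e]⟩
  smul_mem' := by
    rintro c u ⟨hu, hu'⟩
    have e : ∀ k, fcoeff (c • u) k = c * fcoeff u k := fun k => by
      change c • fcoeff u k = _; simp
    refine ⟨fun k => by simp [e, hu], ?_⟩
    refine (hu'.mul_left (c ^ 2)).congr fun k => ?_
    rw [e, norm_mul, mul_pow]; simp; ring

/-- The real Sobolev space `H^s(𝕋²)`. -/
def Sobolev (s : ℝ) : Type := sobolevSubmodule s

namespace Sobolev

variable {s : ℝ}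

instance : AddCommGroup (Sobolev s) := inferInstanceAs (AddCommGroup (sobolevSubmodule s))
instance : Module ℝ (Sobolev s) := inferInstanceAs (Module ℝ (sobolevSubmodule s))

/-- The distribution underlying an element of `H^s(𝕋²)`. -/
def toDistribution (u : Sobolev s) : Distribution := u.1

/-- The Fourier coefficient `û(k)`. -/
def coeff (u : Sobolev s) (k : ℤ × ℤ) : ℂ := fcoeff u.toDistribution k

lemma coeff_add (u v : Sobolev s) (k : ℤ × ℤ) : (u + v).coeff k = u.coeff k + v.coeff k := rfl

lemma coeff_smul (c : ℝ) (u : Sobolev s) (k : ℤ × ℤ) : (c • u).coeff k = c * u.coeff k := by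
  change c • u.coeff k = _; simp

lemma coeff_neg_index (u : Sobolev s) (k : ℤ × ℤ) : u.coeff (-k) = (starRingEnd ℂ) (u.coeff k) :=
  u.2.1 k

lemma summable_coeff (u : Sobolev s) : Summable fun k => lam k ^ s * ‖u.coeff k‖ ^ 2 := u.2.2

lemma re_mul_neg (u v : Sobolev s) (k : ℤ × ℤ) : (u.coeff k * v.coeff (-k)).re =
    (u.coeff k).re * (v.coeff k).re + (u.coeff k).im * (v.coeff k).im := by
  rw [coeff_neg_index]; simp [Complex.mul_re]

lemma ext_coeff {u v : Sobolev s} (h : ∀ k, u.coeff k = v.coeff k) : u = v := by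
  rw [← sub_eq_zero]
  apply Subtype.ext
  apply fcoeff_injective
  intro k
  change u.coeff k - v.coeff k = 0
  simp [h]

lemma abs_re_mul_neg_le (u v : Sobolev s) (k : ℤ × ℤ) : |(u.coeff k * v.coeff (-k)).re| ≤
    ‖u.coeff k‖ ^ 2 + ‖v.coeff k‖ ^ 2 := by
  refine (Complex.abs_re_le_norm _).trans ?_
  rw [coeff_neg_index, norm_mul, RCLike.norm_conj]
  nlinarith [sq_nonneg (‖u.coeff k‖ - ‖v.coeff k‖), sq_nonneg ‖u.coeff k‖, sq_nonneg ‖v.coeff k‖]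

lemma summable_inner (u v : Sobolev s) :
    Summable fun k => lam k ^ s * (u.coeff k * v.coeff (-k)).re := by
  refine Summable.of_norm_bounded (u.summable_coeff.add v.summable_coeff) fun k => ?_
  rw [norm_mul, Real.norm_of_nonneg (Real.rpow_nonneg (lam_pos k).le _), ← mul_add]
  exact mul_le_mul_of_nonneg_left (abs_re_mul_neg_le u v k) (Real.rpow_nonneg (lam_pos k).le _)

/-- The inner product `(u, v) = ∑_k (1 + |k|²)^s û(k) v̂(-k)`. (This sum is real; its real part
is taken term by term.) -/
@[reducible] def core (s : ℝ) : InnerProductSpace.Core ℝ (Sobolev s) where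
  inner u v := ∑' k, lam k ^ s * (u.coeff k * v.coeff (-k)).re
  conj_inner_symm u v := by
    simp only [conj_trivial]
    congr 1; funext k; rw [re_mul_neg, re_mul_neg]; ring
  re_inner_nonneg u := by
    refine tsum_nonneg fun k => mul_nonneg (Real.rpow_nonneg (lam_pos k).le _) ?_
    rw [re_mul_neg]
    nlinarith [mul_self_nonneg (u.coeff k).re, mul_self_nonneg (u.coeff k).im]
  add_left u v w := by
    rw [← (summable_inner u w).tsum_add (summable_inner v w)]
    congr 1; funext k; rw [coeff_add, add_mul, Complex.add_re, mul_add]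
  smul_left u v r := by
    rw [conj_trivial, ← tsum_mul_left]
    congr 1; funext k; rw [coeff_smul, mul_assoc, Complex.re_ofReal_mul]; ring
  definite u hu := by
    have h0 : ∀ k, 0 ≤ lam k ^ s * (u.coeff k * u.coeff (-k)).re := fun k => by
      refine mul_nonneg (Real.rpow_nonneg (lam_pos k).le _) ?_
      rw [re_mul_neg]
      nlinarith [mul_self_nonneg (u.coeff k).re, mul_self_nonneg (u.coeff k).im]
    have h1 := (hasSum_zero_iff_of_nonneg h0).1 (hu ▸ (summable_inner u u).hasSum)
    apply ext_coeff
    intro k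
    have h2 := congrFun h1 k
    have h3 := (Real.rpow_pos_of_pos (lam_pos k) s).ne'
    simp only [Pi.zero_apply, mul_eq_zero, h3, false_or, re_mul_neg] at h2
    have h4 : (u.coeff k).re = 0 := by
      nlinarith [mul_self_nonneg (u.coeff k).re, mul_self_nonneg (u.coeff k).im]
    have h5 : (u.coeff k).im = 0 := by
      nlinarith [mul_self_nonneg (u.coeff k).re, mul_self_nonneg (u.coeff k).im]
    exact Complex.ext h4 h5

instance : NormedAddCommGroup (Sobolev s) := (core s).toNormedAddCommGroup
instance : InnerProductSpace ℝ (Sobolev s) := InnerProductSpace.ofCore (core s).toCore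
instance : MeasurableSpace (Sobolev s) := borel _
instance : BorelSpace (Sobolev s) := ⟨rfl⟩

lemma inner_def (u v : Sobolev s) :
    ⟪u, v⟫ = ∑' k, lam k ^ s * (u.coeff k * v.coeff (-k)).re := rfl

lemma norm_sq_eq (u : Sobolev s) : ‖u‖ ^ 2 = ∑' k, lam k ^ s * ‖u.coeff k‖ ^ 2 := by
  rw [← real_inner_self_eq_norm_sq, inner_def]
  congr 1; funext k; rw [re_mul_neg, Complex.sq_norm, Complex.normSq_apply]

end Sobolev

namespace Sobolev

variable {s : ℝ}

/-- `Re û(k) + Im û(k)`: these real numbers determine `u`, and they are free. -/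
def hartley (u : Sobolev s) (k : ℤ × ℤ) : ℝ := (u.coeff k).re + (u.coeff k).im

lemma abs_hartley_mul_le (u v : Sobolev s) (k : ℤ × ℤ) :
    |u.hartley k * v.hartley k| ≤ ‖u.coeff k‖ ^ 2 + ‖v.coeff k‖ ^ 2 := by
  have h : ∀ w : Sobolev s, w.hartley k ^ 2 ≤ 2 * ‖w.coeff k‖ ^ 2 := fun w => by
    rw [hartley, Complex.sq_norm, Complex.normSq_apply]
    nlinarith [sq_nonneg ((w.coeff k).re - (w.coeff k).im)]
  have hu := h u
  have hv := h v
  rw [abs_le]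
  constructor <;>
  nlinarith [sq_nonneg (u.hartley k - v.hartley k), sq_nonneg (u.hartley k + v.hartley k)]

lemma summable_hartley (u v : Sobolev s) {r : ℝ} (hr : r ≤ s) :
    Summable fun k => lam k ^ r * (u.hartley k * v.hartley k) := by
  refine Summable.of_norm_bounded (u.summable_coeff.add v.summable_coeff) fun k => ?_
  rw [norm_mul, Real.norm_of_nonneg (Real.rpow_nonneg (lam_pos k).le _), ← mul_add]
  exact mul_le_mul (Real.rpow_le_rpow_of_exponent_le (one_le_lam k) hr) (abs_hartley_mul_le u v k)
    (norm_nonneg _) (Real.rpow_nonneg (lam_pos k).le _)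

lemma tsum_hartley (u v : Sobolev s) {r : ℝ} (hr : r ≤ s) :
    ∑' k, lam k ^ r * (u.hartley k * v.hartley k) =
      ∑' k, lam k ^ r * (u.coeff k * v.coeff (-k)).re := by
  have h1 := summable_hartley u v hr
  have h1' : Summable fun k => lam k ^ r * (u.hartley (-k) * v.hartley (-k)) := by
    have := (Equiv.neg (ℤ × ℤ)).summable_iff.2 h1
    refine this.congr fun k => ?_
    simp [lam_neg]
  have h2 : ∑' k, lam k ^ r * (u.hartley (-k) * v.hartley (-k)) =
      ∑' k, lam k ^ r * (u.hartley k * v.hartley k) := by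
    rw [← (Equiv.neg (ℤ × ℤ)).tsum_eq (fun k => lam k ^ r * (u.hartley k * v.hartley k))]
    simp [lam_neg]
  have h3 : ∀ k, lam k ^ r * (u.coeff k * v.coeff (-k)).re =
      2⁻¹ * (lam k ^ r * (u.hartley k * v.hartley k) +
        lam k ^ r * (u.hartley (-k) * v.hartley (-k))) := fun k => by
    rw [re_mul_neg]
    simp only [hartley, coeff_neg_index, Complex.conj_re, Complex.conj_im]
    ring
  simp only [h3]
  rw [tsum_mul_left, h1.tsum_add h1', h2]
  ring

lemma exists_of_hartley (x : ℤ × ℤ → ℝ) (hx : Summable fun k => lam k ^ s * x k ^ 2) :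
    ∃ u : Sobolev s, ∀ k, u.hartley k = x k := by
  let c : ℤ × ℤ → ℂ := fun k => ⟨(x k + x (-k)) / 2, (x k - x (-k)) / 2⟩
  have hx' : Summable fun k => lam k ^ s * x (-k) ^ 2 := by
    have := (Equiv.neg (ℤ × ℤ)).summable_iff.2 hx
    refine this.congr fun k => ?_
    simp [lam_neg]
  have hc2 : ∀ k, ‖c k‖ ^ 2 = (x k ^ 2 + x (-k) ^ 2) / 2 := fun k => by
    rw [Complex.sq_norm, Complex.normSq_apply]; simp only [c]; ring
  have hsum : Summable fun k => lam k ^ s * ‖c k‖ ^ 2 := by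
    refine ((hx.add hx').mul_left 2⁻¹).congr fun k => ?_
    rw [hc2]; ring
  obtain ⟨M, hM⟩ := exists_nat_ge (-s)
  have hb : ∀ k, ‖c k‖ ≤ (1 + ∑' k, lam k ^ s * ‖c k‖ ^ 2) * lam k ^ M := fun k => by
    have h0 : ∀ k, 0 ≤ lam k ^ s * ‖c k‖ ^ 2 := fun k =>
      mul_nonneg (Real.rpow_nonneg (lam_pos k).le _) (sq_nonneg _)
    have h1 := hsum.le_tsum k fun j _ => h0 j
    have h2 : 1 ≤ lam k ^ s * lam k ^ M := by
      rw [← Real.rpow_natCast, ← Real.rpow_add (lam_pos k)]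
      exact Real.one_le_rpow (one_le_lam k) (by linarith)
    have h3 : 1 ≤ lam k ^ M := one_le_pow₀ (one_le_lam k)
    have h4 : ‖c k‖ ^ 2 ≤ (lam k ^ s * ‖c k‖ ^ 2) * lam k ^ M := by
      nlinarith [sq_nonneg ‖c k‖]
    have h5 : ‖c k‖ ≤ 1 + ‖c k‖ ^ 2 := by nlinarith [sq_nonneg (‖c k‖ - 1)]
    nlinarith
  obtain ⟨u, hu⟩ := exists_distribution hb
  refine ⟨⟨u, fun k => ?_, by rwa [hu]⟩, fun k => ?_⟩
  · rw [hu]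
    apply Complex.ext
    · simp [c, add_comm]
    · simp [c]; ring
  · change (fcoeff u k).re + (fcoeff u k).im = _
    rw [hu]; simp only [c]; ring

/-- The coordinates of `u` in a Hilbert basis of `H^s(𝕋²)`. -/
def coord (u : Sobolev s) (k : ℤ × ℤ) : ℝ := lam k ^ (s / 2) * u.hartley k

lemma coord_mul (u v : Sobolev s) (k : ℤ × ℤ) :
    u.coord k * v.coord k = lam k ^ s * (u.hartley k * v.hartley k) := by
  have : lam k ^ s = lam k ^ (s / 2) * lam k ^ (s / 2) := by
    rw [← Real.rpow_add (lam_pos k)]; congr 1; ring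
  rw [this, coord, coord]; ring

lemma memℓp_coord (u : Sobolev s) : Memℓp u.coord 2 := by
  refine memℓp_gen ?_
  simp only [ENNReal.toReal_ofNat, Real.rpow_ofNat, Real.norm_eq_abs, sq_abs]
  refine (summable_hartley u u le_rfl).congr fun k => ?_
  rw [← coord_mul, sq]

/-- The Hilbert basis of `H^s(𝕋²)` whose coordinates are given by `coord`. -/
def basis (s : ℝ) : HilbertBasis (ℤ × ℤ) ℝ (Sobolev s) := by
  let J : Sobolev s →ₗ[ℝ] lp (fun _ : ℤ × ℤ => ℝ) 2 :=
    { toFun := fun u => ⟨u.coord, u.memℓp_coord⟩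
      map_add' := fun u v => by
        ext k
        change coord (u + v) k = coord u k + coord v k
        simp [coord, hartley, coeff_add]; ring
      map_smul' := fun c u => by
        ext k
        change coord (c • u) k = c * coord u k
        simp [coord, hartley, coeff_smul]; ring }
  have hJ : ∀ u, ‖J u‖ = ‖u‖ := fun u => by
    rw [← sq_eq_sq₀ (norm_nonneg _) (norm_nonneg _), ← real_inner_self_eq_norm_sq,
      ← real_inner_self_eq_norm_sq, inner_def, ← tsum_hartley u u le_rfl, lp.inner_eq_tsum]
    congr 1; funext k
    exact coord_mul u u k
  refine HilbertBasis.ofRepr (LinearIsometryEquiv.ofSurjective ⟨J, hJ⟩ ?_)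
  intro x
  have hx := lp.memℓp x
  have hx2 : Summable fun k => x k ^ 2 := by
    simpa using hx.summable (by norm_num)
  obtain ⟨u, hu⟩ := exists_of_hartley (s := s) (fun k => lam k ^ (-(s / 2)) * x k) <| by
    refine hx2.congr fun k => ?_
    have : lam k ^ s * (lam k ^ (-(s / 2))) ^ 2 = 1 := by
      rw [← Real.rpow_natCast, ← Real.rpow_mul (lam_pos k).le, ← Real.rpow_add (lam_pos k)]
      convert Real.rpow_zero _ using 2; push_cast; ring
    rw [mul_pow, ← mul_assoc, this, one_mul]
  refine ⟨u, ?_⟩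
  ext k
  change lam k ^ (s / 2) * u.hartley k = x k
  rw [hu, ← mul_assoc, ← Real.rpow_add (lam_pos k)]
  simp

lemma basis_repr (u : Sobolev s) (k : ℤ × ℤ) : (basis s).repr u k = u.coord k := rfl

instance : CompleteSpace (Sobolev s) :=
  ((basis s).repr.isometry.isUniformInducing.completeSpace_congr
    (basis s).repr.surjective).2 inferInstance

instance : SecondCountableTopology (Sobolev s) := by
  have : TopologicalSpace.SeparableSpace (Sobolev s) := by
    rw [← TopologicalSpace.isSeparable_univ_iff]
    have h := ((Set.countable_range (basis s)).isSeparable.span (R := ℝ)).closure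
    have h2 := (basis s).dense_span
    have h3 := congrArg (fun p : Submodule ℝ (Sobolev s) => (p : Set (Sobolev s))) h2
    simp only [Submodule.topologicalClosure_coe, Submodule.top_coe] at h3
    rwa [h3] at h
  exact UniformSpace.secondCountable_of_separable _

end Sobolev

/-- A family with square-summable standard deviations is the family of coordinates of a centred
Gaussian measure on a Hilbert space. -/
theorem exists_gaussian {E ι : Type*} [NormedAddCommGroup E] [InnerProductSpace ℝ E]
    [CompleteSpace E] [MeasurableSpace E] [BorelSpace E] [Countable ι]
    (b : HilbertBasis ι ℝ E) (σ : ι → ℝ) (hσ : Summable fun k => σ k ^ 2) :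
    ∃ μ : Measure E, IsGaussian μ ∧ (∀ l : E, ∫ z, ⟪l, z⟫ ∂μ = 0) ∧
      ∀ l m : E, ∫ z, ⟪l, z⟫ * ⟪m, z⟫ ∂μ = ∑' k, σ k ^ 2 * (b.repr l k * b.repr m k) := by
  classical
  let P : Measure (ι → ℝ) := Measure.infinitePi fun _ => gaussianReal 0 1
  have hev : ∀ k, MeasurePreserving (Function.eval k) P (gaussianReal 0 1) := fun k =>
    measurePreserving_eval_infinitePi (fun _ : ι => gaussianReal 0 1) k
  -- almost sure square summability
  have hae : ∀ᵐ w ∂P, Summable fun k => (σ k * w k) ^ 2 := by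
    have hm : ∀ k, Measurable fun w : ι → ℝ => ENNReal.ofReal ((σ k * w k) ^ 2) := fun k => by
      fun_prop
    have hV : ∫⁻ x, ENNReal.ofReal (x ^ 2) ∂(gaussianReal 0 1) ≠ ⊤ := by
      have := ((memLp_id_gaussianReal (μ := 0) (v := 1) 2).integrable_sq).lintegral_lt_top
      exact this.ne
    have hint : ∫⁻ w, ∑' k, ENNReal.ofReal ((σ k * w k) ^ 2) ∂P ≠ ⊤ := by
      rw [lintegral_tsum fun k => (hm k).aemeasurable]
      have : ∀ k, ∫⁻ w, ENNReal.ofReal ((σ k * w k) ^ 2) ∂P =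
          ENNReal.ofReal (σ k ^ 2) * ∫⁻ x, ENNReal.ofReal (x ^ 2) ∂(gaussianReal 0 1) := fun k => by
        rw [← (hev k).lintegral_comp (f := fun x => ENNReal.ofReal (x ^ 2)) (by fun_prop),
          ← lintegral_const_mul _ (by fun_prop)]
        congr 1; funext w
        rw [← ENNReal.ofReal_mul (sq_nonneg _), mul_pow]
      simp only [this]
      rw [ENNReal.tsum_mul_right]
      refine ENNReal.mul_ne_top ?_ hV
      rw [← ENNReal.ofReal_tsum_of_nonneg (fun k => sq_nonneg _) hσ]
      exact ENNReal.ofReal_ne_top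
    filter_upwards [ae_lt_top (Measurable.tsum hm) hint] with w hw
    refine (ENNReal.summable_toReal hw.ne).congr fun k => ?_
    exact ENNReal.toReal_ofReal (sq_nonneg _)
  let S : Finset ι → (ι → ℝ) → E := fun F w => ∑ k ∈ F, (σ k * w k) • b k
  let T : (ι → ℝ) → E := fun w => ∑' k, (σ k * w k) • b k
  have hST : ∀ᵐ w ∂P, Tendsto (fun F => S F w) atTop (𝓝 (T w)) := by
    filter_upwards [hae] with w hw
    have hs : Summable fun k => (σ k * w k) • b k := by
      let x : lp (fun _ : ι => ℝ) 2 := ⟨fun k => σ k * w k, memℓp_gen (by simpa [mul_pow] using hw)⟩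
      exact (b.hasSum_repr_symm x).summable
    exact hs.hasSum
  have hSm : ∀ F, StronglyMeasurable (S F) := fun F =>
    Finset.stronglyMeasurable_fun_sum F fun k _ =>
      (Measurable.stronglyMeasurable (by fun_prop)).smul_const _
  have hTm : AEStronglyMeasurable T P :=
    aestronglyMeasurable_of_tendsto_ae atTop (fun F => (hSm F).aestronglyMeasurable) hST
  let μ : Measure E := P.map T
  have hμ : IsProbabilityMeasure μ := Measure.isProbabilityMeasure_map hTm.aemeasurable
  -- the laws of the linear functionals
  have hv : ∀ l : E, Summable fun k => σ k ^ 2 * (b.repr l k * b.repr l k) := fun l => by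
    have hl : Summable fun k => b.repr l k ^ 2 := by
      simpa using (lp.memℓp (b.repr l)).summable (by norm_num)
    obtain ⟨C, hC⟩ : ∃ C, ∀ k, σ k ^ 2 ≤ C :=
      ⟨∑' k, σ k ^ 2, fun k => hσ.le_tsum k fun j _ => sq_nonneg _⟩
    refine Summable.of_nonneg_of_le (fun k => mul_nonneg (sq_nonneg _) (mul_self_nonneg _))
      (fun k => ?_) (hl.mul_left C)
    rw [← sq]
    exact mul_le_mul_of_nonneg_right (hC k) (sq_nonneg _)
  let v : E → ℝ≥0 := fun l => (∑' k, σ k ^ 2 * (b.repr l k * b.repr l k)).toNNReal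
  have hvr : ∀ l, (v l : ℝ) = ∑' k, σ k ^ 2 * (b.repr l k * b.repr l k) := fun l =>
    Real.coe_toNNReal _ (tsum_nonneg fun k => mul_nonneg (sq_nonneg _) (mul_self_nonneg _))
  have hlaw : ∀ l : E, μ.map (fun z => ⟪l, z⟫) = gaussianReal 0 (v l) := by
    intro l
    have hmap : μ.map (fun z => ⟪l, z⟫) = P.map (fun w => ⟪l, T w⟫) :=
      AEMeasurable.map_map_of_aemeasurable (by fun_prop) hTm.aemeasurable
    rw [hmap]
    have hX : AEStronglyMeasurable (fun w => ⟪l, T w⟫) P := by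
      exact AEStronglyMeasurable.inner aestronglyMeasurable_const hTm
    have : IsProbabilityMeasure (P.map fun w => ⟪l, T w⟫) :=
      Measure.isProbabilityMeasure_map hX.aemeasurable
    refine Measure.ext_of_charFun ?_
    funext t
    have hfin : ∀ F : Finset ι, ∫ w, Complex.exp (t * ⟪l, S F w⟫ * Complex.I) ∂P =
        Complex.exp (((-(t ^ 2 / 2) * ∑ k ∈ F, σ k ^ 2 * (b.repr l k * b.repr l k) : ℝ)) : ℂ) := by
      intro F
      have e1 : ∀ w, ⟪l, S F w⟫ = ∑ k ∈ F, (σ k * b.repr l k) * w k := fun w => by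
        simp only [S, inner_sum, inner_smul_right, b.repr_apply_apply]
        refine Finset.sum_congr rfl fun k _ => ?_
        rw [real_inner_comm]; ring
      have hind : iIndepFun (fun k (w : ι → ℝ) => (σ k * b.repr l k) * w k) P :=
        iIndepFun_infinitePi (P := fun _ : ι => gaussianReal 0 1)
          (X := fun k x => (σ k * b.repr l k) * x) (by fun_prop)
      have hmeas : ∀ k, Measurable fun w : ι → ℝ => (σ k * b.repr l k) * w k := fun k =>
        (measurable_pi_apply k).const_mul _
      have h1 := (hind.restrict F).charFun_map_fun_finsetSum_eq_prod (s := F)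
        (X := fun k (w : ι → ℝ) => (σ k * b.repr l k) * w k)
        (fun k _ => (hmeas k).aemeasurable)
      have h2 := congrFun h1 t
      rw [charFun_apply_real, integral_map
        (Finset.measurable_fun_sum F fun k _ => hmeas k).aemeasurable (by fun_prop)] at h2
      simp only [e1]
      rw [h2, Finset.prod_apply]
      have h3 : ∀ k, charFun (P.map fun w => (σ k * b.repr l k) * w k) t =
          Complex.exp ((-(t ^ 2 / 2) * (σ k ^ 2 * (b.repr l k * b.repr l k)) : ℝ)) := fun k => by
        have h4 : P.map (fun w => (σ k * b.repr l k) * w k) =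
            (gaussianReal 0 1).map (fun x => (σ k * b.repr l k) * x) := by
          rw [← (hev k).map_eq, Measure.map_map (by fun_prop) (by fun_prop)]; rfl
        rw [h4, gaussianReal_map_const_mul, charFun_gaussianReal]
        congr 1
        simp
        ring
      simp only [h3]
      rw [← Complex.exp_sum, Finset.mul_sum]
      push_cast
      rfl
    have hl1 : Tendsto (fun F => ∫ w, Complex.exp (t * ⟪l, S F w⟫ * Complex.I) ∂P) atTop
        (𝓝 (∫ w, Complex.exp (t * ⟪l, T w⟫ * Complex.I) ∂P)) := by
      refine tendsto_integral_filter_of_dominated_convergence (fun _ => 1)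
        (Eventually.of_forall fun F => ?_) (Eventually.of_forall fun F => ?_)
        (integrable_const _) ?_
      · have := (hSm F).aestronglyMeasurable (μ := P)
        have h5 : AEStronglyMeasurable (fun w => ⟪l, S F w⟫) P :=
          AEStronglyMeasurable.inner aestronglyMeasurable_const this
        have h6 : Continuous fun x : ℝ => Complex.exp (t * x * Complex.I) := by fun_prop
        exact h6.comp_aestronglyMeasurable h5
      · refine Eventually.of_forall fun w => ?_
        rw [← Complex.ofReal_mul, Complex.norm_exp_ofReal_mul_I]
      · filter_upwards [hST] with w hw
        have h6 : Continuous fun z : E => Complex.exp (t * ⟪l, z⟫ * Complex.I) := by fun_prop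
        exact (h6.tendsto _).comp hw
    have hl2 : Tendsto (fun F : Finset ι =>
        Complex.exp (((-(t ^ 2 / 2) * ∑ k ∈ F, σ k ^ 2 * (b.repr l k * b.repr l k) : ℝ)) : ℂ)) atTop
        (𝓝 (Complex.exp (((-(t ^ 2 / 2) * v l : ℝ)) : ℂ))) := by
      have h7 : Continuous fun x : ℝ => Complex.exp (((-(t ^ 2 / 2) * x : ℝ)) : ℂ) := by fun_prop
      have h8 := (hv l).hasSum
      rw [← hvr] at h8
      exact (h7.tendsto _).comp h8
    simp only [hfin] at hl1
    have huniq := tendsto_nhds_unique hl1 hl2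
    rw [charFun_apply_real, integral_map hX.aemeasurable (by fun_prop), huniq,
      charFun_gaussianReal]
    congr 1
    push_cast
    ring
  have hmean : ∀ l : E, ∫ z, ⟪l, z⟫ ∂μ = 0 := fun l => by
    have : ∫ x, x ∂(μ.map (fun z => ⟪l, z⟫)) = ∫ z, ⟪l, z⟫ ∂μ :=
      integral_map (by fun_prop) (by fun_prop)
    rw [← this, hlaw, integral_id_gaussianReal]
  have hsq : ∀ l : E, ∫ z, ⟪l, z⟫ ^ 2 ∂μ = v l := fun l => by
    have h1 : ∫ x, x ^ 2 ∂(μ.map (fun z => ⟪l, z⟫)) = ∫ z, ⟪l, z⟫ ^ 2 ∂μ :=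
      integral_map (by fun_prop) (by fun_prop)
    have h2 := variance_id_gaussianReal (μ := 0) (v := v l)
    rw [variance_eq_integral (by fun_prop)] at h2
    rw [← h1, hlaw, ← h2]
    simp
  have hG : IsGaussian μ := by
    refine isGaussian_of_map_eq_gaussianReal fun L => ?_
    obtain ⟨l, rfl⟩ := (InnerProductSpace.toDual ℝ E).surjective L
    exact ⟨0, v l, hlaw l⟩
  refine ⟨μ, hG, hmean, fun l m => ?_⟩
  have hint : ∀ l : E, Integrable (fun z => ⟪l, z⟫ ^ 2) μ := fun l =>
    (IsGaussian.memLp_dual μ (InnerProductSpace.toDual ℝ E l) 2 (by simp)).integrable_sq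
  have hpol : ∀ z, ⟪l, z⟫ * ⟪m, z⟫ = 4⁻¹ * (⟪l + m, z⟫ ^ 2 - ⟪l - m, z⟫ ^ 2) := fun z => by
    rw [inner_add_left, inner_sub_left]; ring
  simp only [hpol]
  rw [integral_const_mul, integral_sub (hint _) (hint _), hsq, hsq, hvr, hvr,
    ← (hv _).tsum_sub (hv _), ← tsum_mul_left]
  congr 1; funext k
  simp only [map_add, map_sub, lp.coeFn_add, lp.coeFn_sub, Pi.add_apply, Pi.sub_apply]
  ring

/-! ### The free field -/

/-- `(A^{1+δ} l, m)` in `H^{-δ}(𝕋²)`, where `A = (1 - Δ)⁻¹` multiplies the `k`-th Fourier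
coefficient by `λ_k⁻¹`. -/
def covForm (δ : ℝ) (l m : Sobolev (-δ)) : ℝ :=
  ∑' k, lam k ^ (-δ) * (((lam k ^ (-(1 + δ)) : ℝ) * l.coeff k) * m.coeff (-k)).re

/-- `μ` is the centred Gaussian measure `N(0, A^{1+δ})` on `H^{-δ}(𝕋²)`. -/
structure IsFreeField (δ : ℝ) (μ : Measure (Sobolev (-δ))) : Prop where
  isGaussian : IsGaussian μ
  mean_eq : ∀ l, ∫ z, ⟪l, z⟫ ∂μ = 0
  cov_eq : ∀ l m, ∫ z, ⟪l, z⟫ * ⟪m, z⟫ ∂μ = covForm δ l m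

theorem existsUnique_isFreeField {δ : ℝ} (hδ : 0 < δ) :
    ∃! μ : Measure (Sobolev (-δ)), IsFreeField δ μ := by
  have hσ2 : ∀ k, (lam k ^ (-((1 + δ) / 2))) ^ 2 = lam k ^ (-(1 + δ)) := fun k => by
    rw [← Real.rpow_natCast, ← Real.rpow_mul (lam_pos k).le]
    congr 1; push_cast; ring
  obtain ⟨μ, h1, h2, h3⟩ := exists_gaussian (Sobolev.basis (-δ))
    (fun k => lam k ^ (-((1 + δ) / 2)))
    (by simp only [hσ2]; exact summable_lam_rpow (by linarith))
  have hμ : IsFreeField δ μ := by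
    refine ⟨h1, h2, fun l m => ?_⟩
    rw [h3, covForm]
    have e := Sobolev.tsum_hartley l m (r := -(1 + δ) + -δ) (by linarith)
    have e1 : ∀ k, (lam k ^ (-((1 + δ) / 2))) ^ 2 *
        ((Sobolev.basis (-δ)).repr l k * (Sobolev.basis (-δ)).repr m k) =
        lam k ^ (-(1 + δ) + -δ) * (l.hartley k * m.hartley k) := fun k => by
      rw [Sobolev.basis_repr, Sobolev.basis_repr, Sobolev.coord_mul, hσ2, ← mul_assoc,
        ← Real.rpow_add (lam_pos k)]
    simp only [e1]
    rw [e]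
    congr 1; funext k
    rw [Real.rpow_add (lam_pos k), mul_assoc (_ : ℂ), Complex.re_ofReal_mul]
    ring
  have hchar : ∀ ρ : Measure (Sobolev (-δ)), IsFreeField δ ρ → ∀ t,
      charFun ρ t = Complex.exp (-(covForm δ t t : ℂ) / 2) := fun ρ hρ t => by
    have := hρ.isGaussian
    have hvar : Var[fun x => ⟪t, x⟫; ρ] = covForm δ t t := by
      rw [variance_eq_integral (by fun_prop), hρ.mean_eq, ← hρ.cov_eq]
      simp [sq]
    have hm : ∫ x, ((⟪t, x⟫ : ℝ) : ℂ) ∂ρ = 0 := by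
      rw [integral_complex_ofReal, hρ.mean_eq]; simp
    rw [IsGaussian.charFun_eq, hvar, hm]
    congr 1; ring
  refine ⟨μ, hμ, fun ν hν => ?_⟩
  have := hν.isGaussian
  apply Measure.ext_of_charFun
  funext t
  rw [hchar ν hν, hchar μ hμ]

/-- The massive Gaussian free field `μ₀` on `H^{-δ}(𝕋²)`. -/
def freeField {δ : ℝ} (hδ : 0 < δ) : Measure (Sobolev (-δ)) :=
  (existsUnique_isFreeField hδ).choose

lemma isFreeField_freeField {δ : ℝ} (hδ : 0 < δ) : IsFreeField δ (freeField hδ) :=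
  (existsUnique_isFreeField hδ).choose_spec.1

/-! ### Functions as distributions -/

/-- The distribution `φ ↦ ∫ f φ dx` given by a continuous real function `f`. -/
def regular (f : C(Torus, ℝ)) : Distribution :=
  have hcoe : Continuous fun x => (f x : ℂ) := by fun_prop
  ⟨{ toFun := fun φ => ∫ x, (f x : ℂ) * φ.1 x
     map_add' := fun φ ψ => by
       have h1 := continuous_test φ
       have h2 := continuous_test ψ
       rw [← integral_add (integrable_of_continuous (by fun_prop))
         (integrable_of_continuous (by fun_prop))]
       congr 1; funext x; simp [mul_add]
     map_smul' := fun c φ => by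
       simp only [RingHom.id_apply, smul_eq_mul]
       rw [← integral_const_mul]; congr 1; funext x; simp; ring },
   0, ∫ x, ‖(f x : ℂ)‖, fun φ B hB => by
     have h1 := continuous_test φ
     refine (norm_integral_le_integral_norm _).trans ?_
     rw [← integral_mul_const]
     refine integral_mono (integrable_of_continuous (by fun_prop)).norm
       ((integrable_of_continuous hcoe).norm.mul_const B) fun x => ?_
     simp only [norm_mul]
     exact mul_le_mul_of_nonneg_left (hB 0 0 le_rfl x) (norm_nonneg _)⟩

lemma expo_neg (k : ℤ × ℤ) (x : Torus) : expo (-k) x = (starRingEnd ℂ) (expo k x) := by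
  simp only [expo, Prod.fst_neg, Prod.snd_neg, fourier_neg, map_mul, map_inv₀,
    Complex.conj_ofReal, map_ofNat]

lemma fcoeff_regular (f : C(Torus, ℝ)) (k : ℤ × ℤ) :
    fcoeff (regular f) k = ∫ x, (f x : ℂ) * (starRingEnd ℂ) (expo k x) := by
  simp only [← expo_neg]; rfl

lemma regular_mem {s : ℝ} (hs : s ≤ 0) (f : C(Torus, ℝ)) : regular f ∈ sobolevSubmodule s := by
  constructor
  · intro k
    rw [fcoeff_regular, fcoeff_regular, ← integral_conj]
    congr 1; funext x
    rw [map_mul, expo_neg, Complex.conj_ofReal]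
  · let e : ℤ × ℤ → C(Torus, ℂ) := fun k => ⟨expo k, continuous_expo k⟩
    let F : C(Torus, ℂ) := ⟨fun x => (f x : ℂ), by fun_prop⟩
    let v : ℤ × ℤ → Lp ℂ 2 (volume : Measure Torus) := fun k =>
      ContinuousMap.toLp 2 volume ℂ (e k)
    have hv : Orthonormal ℂ v := by
      rw [orthonormal_iff_ite]
      intro k l
      rw [ContinuousMap.inner_toLp]
      have := pairing_expo l k
      simp only [pairing, expo_neg] at this
      simp only [e, ContinuousMap.coe_mk]
      refine this.trans ?_
      simp only [eq_comm]
    have hB := hv.inner_products_summable (x := ContinuousMap.toLp 2 volume ℂ F)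
    refine Summable.of_nonneg_of_le (fun k => mul_nonneg (Real.rpow_nonneg (lam_pos k).le _)
      (sq_nonneg _)) (fun k => ?_) hB
    rw [fcoeff_regular, ContinuousMap.inner_toLp]
    simp only [e, F, ContinuousMap.coe_mk]
    exact mul_le_of_le_one_left (sq_nonneg _)
      (Real.rpow_le_one_of_one_le_of_nonpos (one_le_lam k) hs)

/-- The embedding of continuous functions into `H^s(𝕋²)`, `s ≤ 0`. -/
def ofContinuous {s : ℝ} (hs : s ≤ 0) (f : C(Torus, ℝ)) : Sobolev s :=
  ⟨regular f, regular_mem hs f⟩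

/-! ### Wick powers -/

/-- The cut-off regions: compact symmetric subsets of the plane with `0` in the interior. -/
structure IsCutoff (Λ : Set (ℝ × ℝ)) : Prop where
  isCompact : IsCompact Λ
  neg_eq : -Λ = Λ
  zero_mem : 0 ∈ interior Λ

open Classical in
/-- The lattice points in `Λ` (finitely many, as `Λ` is bounded in all uses). -/
def latticePoints (Λ : Set (ℝ × ℝ)) : Finset (ℤ × ℤ) :=
  if h : {k : ℤ × ℤ | ((k.1 : ℝ), (k.2 : ℝ)) ∈ Λ}.Finite then h.toFinset else ∅

/-- `ρ_Λ = (2π)⁻¹ (∑_{k ∈ Λ} (1 + |k|²)⁻¹)^{1/2}`, the standard deviation of the free field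
projected to the modes in `Λ`, at any point. -/
def rho (Λ : Set (ℝ × ℝ)) : ℝ :=
  (2 * Real.pi)⁻¹ * √(∑ k ∈ latticePoints Λ, (lam k)⁻¹)

/-- `(Π_Λ z)(x) = ∑_{k ∈ Λ} ẑ(k) e_k(x)`, which is real when `Λ = -Λ`. -/
def proj {s : ℝ} (Λ : Set (ℝ × ℝ)) (z : Sobolev s) (x : Torus) : ℝ :=
  (∑ k ∈ latticePoints Λ, z.coeff k * expo k x).re

/-- The normalized Hermite polynomials
`(-1)^n (n!)^{-1/2} exp(ξ²/2) (d/dξ)^n exp(-ξ²/2)`. -/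
def hermiteH (n : ℕ) (ξ : ℝ) : ℝ := Polynomial.aeval ξ (Polynomial.hermite n) / √(n.factorial)

/-- The regularized Wick power
`x ↦ (n!)^{1/2} ρ_Λ^n ℍ_n(ρ_Λ⁻¹ (Π_Λ z)(x))`, a continuous function on the torus. -/
def wick {s : ℝ} (n : ℕ) (Λ : Set (ℝ × ℝ)) (z : Sobolev s) : C(Torus, ℝ) where
  toFun x := √(n.factorial) * rho Λ ^ n * hermiteH n ((rho Λ)⁻¹ * proj Λ z x)
  continuous_toFun := by
    have h1 : Continuous (proj Λ z) := by
      refine Complex.continuous_re.comp (continuous_finsetSum _ fun k _ => ?_)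
      exact continuous_const.mul (continuous_expo k)
    have h2 : Continuous (hermiteH n) :=
      (Polynomial.continuous_aeval (Polynomial.hermite n)).div_const _
    fun_prop

/-- `(Φ_{n,Λ}(z), g)` in `L²(𝕋²)`, for the regularized Wick power `Φ_{n,Λ}(z)`. -/
def wickTested {s : ℝ} (n : ℕ) (Λ : Set (ℝ × ℝ)) (g : Lp ℝ 2 (volume : Measure Torus))
    (z : Sobolev s) : ℝ := ∫ x, wick n Λ z x * g x

/-- Convergence `u_N → v` in `L^p(μ; F)`, for functions. -/
structure TendstoLp {Ω F : Type*} [MeasurableSpace Ω] [NormedAddCommGroup F] (p : ℝ)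
    (μ : Measure Ω) (u : ℕ → Ω → F) (v : Ω → F) : Prop where
  memLp_seq : ∀ N, MemLp (u N) (ENNReal.ofReal p) μ
  memLp_lim : MemLp v (ENNReal.ofReal p) μ
  tendsto : Tendsto (fun N => eLpNorm (u N - v) (ENNReal.ofReal p) μ) atTop (𝓝 0)

/-- `Φ` is the `n`-th Wick power with values in `H^{-α}(𝕋²)`: for every cut-off region `Λ` and
every `q ≥ 1`, the limit of `Φ_{n,NΛ}` in `L^q(μ₀; H^{-α})` as `N → ∞`. -/
def IsWickPower {δ α : ℝ} (hδ : 0 < δ) (hα : 0 < α) (n : ℕ)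
    (Φ : Sobolev (-δ) → Sobolev (-α)) : Prop :=
  ∀ Λ : Set (ℝ × ℝ), IsCutoff Λ → ∀ q : ℝ, 1 ≤ q →
    TendstoLp q (freeField hδ)
      (fun N z => ofContinuous (neg_nonpos.2 hα.le) (wick n ((N : ℝ) • Λ) z)) Φ

/-- `Ψ` is the `n`-th Wick power tested against `g`: for every cut-off region `Λ` and every
`q ≥ 1`, the limit of `(Φ_{n,NΛ}, g)` in `L^q(μ₀)` as `N → ∞`. -/
def IsWickTested {δ : ℝ} (hδ : 0 < δ) (n : ℕ) (g : Lp ℝ 2 (volume : Measure Torus))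
    (Ψ : Sobolev (-δ) → ℝ) : Prop :=
  ∀ Λ : Set (ℝ × ℝ), IsCutoff Λ → ∀ q : ℝ, 1 ≤ q →
    TendstoLp q (freeField hδ) (fun N z => wickTested n ((N : ℝ) • Λ) g z) Ψ

end TorusField

end

open TorusField

noncomputable section

namespace TorusField

open MeasureTheory ProbabilityTheory Filter Topology
open scoped ENNReal NNReal ContDiff Pointwise RealInnerProductSpace

/-! ### Lattice sums -/

/-! Under the free field the normalized real coordinates X_k are independent standard Gaussians
(`measurePreserving_modes`). Testing Φ_{n,Λ} against g gives the Wick polynomial of degree n in the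
X_k, k ∈ Λ, with symmetric tensor T_g(k₁,…,kₙ) = ∫ g v_{k₁}⋯v_{kₙ}, where v_k are the scaled real
modes (`integral_wick_mul`). The tensor does not depend on Λ; the cut-off only truncates it.

Hypercontractivity with the sharp constant (`integral_wickPoly_rpow_le`) bounds the squared L^p norm
of such a polynomial by (p-1)ⁿ n! ‖T_g‖². It is proved directly on the chaos: Gaussian integration
by parts yields n E|F|^p = (p-1) E(|F|^{p-2}|∇F|²), and Hölder and induction on the degree finish.
For values in H^{-α} the coordinates are summed by Minkowski's inequality in L^{p/2}. Once the sum
of the ‖T_j‖² over a Hilbert basis is finite, dominated convergence of the truncated tensors gives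
the Wick powers, in every L^q and independently of Λ.

What remains is the growth of ‖T_g‖² in n. Passing from real modes to characters is unitary, and
characters multiply by adding frequencies, so ‖T_g‖² = 4π² (4π²)⁻ⁿ (Kⁿ|ĝ|²)(0) with (Kf)(l) = ∑_k
λ_k⁻¹ f(l+k) (`tensorNorm_testTensor`). On powers, Kλ^{-s} ≤ λ^{-s}((1+ε)π log λ + C): the logarithm
comes from the lattice sum of λ_k⁻¹ over λ_k ≤ λ_l. The bound log x ≤ x^d/(e d) with d ≈ β/n spends
an available decay λ^{-β} evenly over n steps; the cost (πn/(eβ))ⁿ is at most n!(π/β)ⁿ, so Kⁿλ^{-β}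
≤ C n! rⁿ for every r > π/β (`exists_iterate_latticeConv_le`).

Hence the squared tensor norms are at most C n! ρⁿ for every ρ > 1/(4πα) in H^{-α}, and for every ρ
> 1/(4π) against g in L², because one application of K already turns the summable |ĝ|² into
superposed translates of λ⁻¹. The n-th term of the series then has L^p norm at most √C
(a²(p-1)ρ)^{n/2}, and the range of a stated in the theorem is where some admissible ρ makes this
geometric. -/

lemma tsum_int_of_even {f : ℤ → ℝ≥0∞} (hf : ∀ n, f (-n) = f n) :
    ∑' n : ℤ, f n = f 0 + 2 * ∑' n : ℕ, f (n + 1) := by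
  have h := (HasSum.of_nat_of_neg_add_one (f := f) (ENNReal.summable.hasSum)
    (ENNReal.summable.hasSum)).tsum_eq
  rw [h, tsum_eq_zero_add' ENNReal.summable]
  have : ∀ n : ℕ, f (-((n : ℤ) + 1)) = f (n + 1) := fun n => hf _
  simp only [this]
  push_cast
  rw [add_assoc, two_mul]

lemma tsum_ofReal_le {f : ℕ → ℝ} (hf : ∀ n, 0 ≤ f n) {c : ℝ}
    (h : ∀ N, ∑ n ∈ Finset.range N, f n ≤ c) : ∑' n, ENNReal.ofReal (f n) ≤ ENNReal.ofReal c := by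
  refine ENNReal.tsum_le_of_sum_range_le fun N => ?_
  rw [← ENNReal.ofReal_sum_of_nonneg fun n _ => hf n]
  exact ENNReal.ofReal_le_ofReal (h N)

/-- The derivative of arctan is decreasing on the positive axis, so on [n/A, (n+1)/A] it is at least
its value at the right end. The right-hand side telescopes, and its total π/(2A) carries the sharp
constant of the lattice sum. -/
lemma inv_sq_add_sq_le {A : ℝ} (hA : 0 < A) (n : ℕ) :
    (A ^ 2 + ((n : ℝ) + 1) ^ 2)⁻¹ ≤
      A⁻¹ * (Real.arctan (((n + 1 : ℕ) : ℝ) / A) - Real.arctan ((n : ℝ) / A)) := by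
  have hle : (n : ℝ) / A ≤ ((n + 1 : ℕ) : ℝ) / A := by
    gcongr; exact Nat.le_succ n
  have h := (convex_Icc ((n : ℝ) / A) (((n + 1 : ℕ) : ℝ) / A)).mul_sub_le_image_sub_of_le_deriv
    (f := Real.arctan) (C := (1 + (((n + 1 : ℕ) : ℝ) / A) ^ 2)⁻¹)
    Real.continuous_arctan.continuousOn Real.differentiable_arctan.differentiableOn
    (fun x hx => by
      rw [interior_Icc] at hx
      have h0 : 0 ≤ (n : ℝ) / A := by positivity
      have : x ^ 2 ≤ (((n + 1 : ℕ) : ℝ) / A) ^ 2 := by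
        have := hx.1; have := hx.2; gcongr; linarith
      simp only [Real.deriv_arctan, one_div]
      exact inv_anti₀ (by positivity) (by linarith))
    _ (Set.left_mem_Icc.2 hle) _ (Set.right_mem_Icc.2 hle) hle
  refine le_trans (le_of_eq ?_) (mul_le_mul_of_nonneg_left h (by positivity))
  push_cast
  field_simp
  ring

lemma tsum_nat_inv_sq_add_sq_le {A : ℝ} (hA : 0 < A) :
    ∑' n : ℕ, ENNReal.ofReal (A ^ 2 + ((n : ℝ) + 1) ^ 2)⁻¹ ≤ ENNReal.ofReal (Real.pi / 2 / A) := by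
  refine tsum_ofReal_le (fun n => by positivity) fun N => ?_
  refine (Finset.sum_le_sum fun n _ => inv_sq_add_sq_le hA n).trans ?_
  rw [← Finset.mul_sum, Finset.sum_range_sub (fun n : ℕ => Real.arctan ((n : ℝ) / A))]
  simp only [Nat.cast_zero, zero_div, Real.arctan_zero, sub_zero]
  rw [div_eq_inv_mul (Real.pi / 2)]
  exact mul_le_mul_of_nonneg_left (Real.arctan_lt_pi_div_two _).le (by positivity)

lemma tsum_int_inv_sq_add_sq_le {A : ℝ} (hA : 0 < A) :
    ∑' b : ℤ, ENNReal.ofReal (A ^ 2 + (b : ℝ) ^ 2)⁻¹ ≤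
      ENNReal.ofReal ((A ^ 2)⁻¹ + Real.pi / A) := by
  rw [tsum_int_of_even (by simp)]
  have := Real.pi_pos
  rw [ENNReal.ofReal_add (by positivity) (by positivity)]
  push_cast
  refine add_le_add (by simp) ?_
  refine (mul_le_mul_right (tsum_nat_inv_sq_add_sq_le hA) 2).trans_eq ?_
  rw [← ENNReal.ofReal_ofNat 2, ← ENNReal.ofReal_mul (by norm_num)]
  congr 1; ring

/-- Sharp growth of the logarithmically divergent lattice sum. -/
lemma tsum_inv_lam_le {R : ℝ} (hR : 1 ≤ R) :
    ∑' k : ℤ × ℤ, (if lam k ≤ R then ENNReal.ofReal (lam k)⁻¹ else 0) ≤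
      ENNReal.ofReal (Real.pi * Real.log R + (1 + 4 * Real.pi)) := by
  have hπ := Real.pi_pos
  -- The disc is relaxed to the strip a² ≤ R. Each row is then a full sum over b, with leading term
  -- π/√(1+a²) ≤ π/|a| for a ≠ 0; the other term is summable in a and affects only the constant.
  let g : ℤ → ℝ≥0∞ := fun a => if (a : ℝ) ^ 2 ≤ R then
    ENNReal.ofReal ((1 + (a : ℝ) ^ 2)⁻¹) + ENNReal.ofReal (Real.pi / √(1 + (a : ℝ) ^ 2)) else 0
  have h1 : ∑' k : ℤ × ℤ, (if lam k ≤ R then ENNReal.ofReal (lam k)⁻¹ else 0) ≤ ∑' a, g a := by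
    rw [ENNReal.tsum_prod (f := fun a b : ℤ => if lam (a, b) ≤ R then ENNReal.ofReal (lam (a, b))⁻¹ else 0)]
    refine ENNReal.tsum_le_tsum fun a => ?_
    by_cases ha : (a : ℝ) ^ 2 ≤ R
    · have hp : 0 < √(1 + (a : ℝ) ^ 2) := by positivity
      have h := tsum_int_inv_sq_add_sq_le hp
      rw [Real.sq_sqrt (by positivity), ENNReal.ofReal_add (by positivity) (by positivity)] at h
      simp only [g, ha, if_true]
      refine le_trans (ENNReal.tsum_le_tsum fun b => ?_) h
      split_ifs
      · simp [lam, add_assoc]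
      · simp
    · simp only [g, ha, if_false]
      refine le_of_eq (ENNReal.tsum_eq_zero.2 fun b => if_neg fun h => ha ?_)
      simp only [lam] at h
      nlinarith [sq_nonneg (b : ℝ)]
  refine h1.trans ?_
  rw [tsum_int_of_even (by simp [g])]
  have h2 : ∀ n : ℕ, g ((n : ℤ) + 1) ≤ ENNReal.ofReal (1 ^ 2 + ((n : ℝ) + 1) ^ 2)⁻¹ +
      ENNReal.ofReal (Real.pi * (if n ∈ Finset.range ⌊√R⌋₊ then ((n + 1 : ℕ) : ℝ)⁻¹ else 0)) := by
    intro n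
    simp only [g]
    split_ifs with h h' h'
    · push_cast
      rw [one_pow]
      refine add_le_add le_rfl (ENNReal.ofReal_le_ofReal ?_)
      rw [div_eq_mul_inv]
      gcongr
      exact Real.le_sqrt_of_sq_le (by linarith)
    · exfalso
      apply h'
      rw [Finset.mem_range, Nat.lt_iff_add_one_le, Nat.le_floor_iff (by positivity)]
      push_cast at h ⊢
      exact Real.le_sqrt_of_sq_le h
    · simp
    · simp
  have h3 : ∑' n : ℕ, ENNReal.ofReal (Real.pi *
      (if n ∈ Finset.range ⌊√R⌋₊ then ((n + 1 : ℕ) : ℝ)⁻¹ else 0)) ≤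
      ENNReal.ofReal (Real.pi * (1 + Real.log R / 2)) := by
    refine tsum_ofReal_le (fun n => by positivity) fun N => ?_
    rw [← Finset.mul_sum]
    refine mul_le_mul_of_nonneg_left ?_ hπ.le
    -- Rows run up to √R, which halves the logarithm; the two signs of a restore the coefficient π
    -- of log R.
    have hh := harmonic_floor_le_one_add_log (√R) (Real.one_le_sqrt.2 hR)
    rw [Real.log_sqrt (by linarith)] at hh
    refine le_trans ?_ hh
    rw [harmonic]
    push_cast
    rw [← Finset.sum_filter]
    refine (Finset.sum_le_sum_of_subset_of_nonneg (t := Finset.range ⌊√R⌋₊) ?_ ?_)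
    · intro n hn; exact (Finset.mem_filter.1 hn).2
    · intros; positivity
  have h4 := ENNReal.tsum_le_tsum h2
  rw [ENNReal.tsum_add] at h4
  have h5 := h4.trans (add_le_add (tsum_nat_inv_sq_add_sq_le one_pos) h3)
  have h6 : g 0 ≤ ENNReal.ofReal (1 + Real.pi) := by
    have : (0 : ℝ) ≤ R := by linarith
    simp only [g]
    norm_num [this]
    rw [ENNReal.ofReal_add (by norm_num) hπ.le]
    simp
  have hlog := Real.log_nonneg hR
  refine (add_le_add h6 (mul_le_mul_right h5 2)).trans_eq ?_
  rw [← ENNReal.ofReal_add (by positivity) (by positivity), ← ENNReal.ofReal_ofNat 2,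
    ← ENNReal.ofReal_mul (by norm_num), ← ENNReal.ofReal_add (by positivity) (by positivity)]
  congr 1
  ring

/-- Bernoulli's inequality for the concave power 1 - β at -1/a, multiplied by a^(1-β). The
right-hand side telescopes, in place of integrating x^(-β). -/
lemma rpow_neg_le_sub {β a : ℝ} (h0 : 0 < β) (h1 : β < 1) (ha : 1 ≤ a) :
    (1 - β) * a ^ (-β) ≤ a ^ (1 - β) - (a - 1) ^ (1 - β) := by
  have ha0 : 0 < a := by linarith
  have h := rpow_one_add_le_one_add_mul_self (s := -a⁻¹) (p := 1 - β)
    (by have := inv_le_one_of_one_le₀ ha; linarith) (by linarith) (by linarith)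
  have e : (a - 1) = a * (1 + -a⁻¹) := by field_simp; ring
  have e2 : a ^ (1 - β) * a⁻¹ = a ^ (-β) := by
    rw [← Real.rpow_neg_one, ← Real.rpow_add ha0]; congr 1; ring
  rw [e, Real.mul_rpow ha0.le (by have := inv_le_one_of_one_le₀ ha; linarith)]
  have := mul_le_mul_of_nonneg_left h (Real.rpow_nonneg ha0.le (1 - β))
  rw [← e2]
  linarith

/-- The companion for tails: (1 - 1/a)^(-s) ≥ 1 + s/a, from log(1 - x) ≤ -x and exp y ≥ 1 + y. -/
lemma rpow_neg_one_sub_le {s a : ℝ} (h0 : 0 < s) (ha : 1 < a) :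
    s * a ^ (-1 - s) ≤ (a - 1) ^ (-s) - a ^ (-s) := by
  have ha0 : 0 < a := by linarith
  have hi : a⁻¹ < 1 := inv_lt_one_of_one_lt₀ ha
  have e : (a - 1) = a * (1 - a⁻¹) := by field_simp
  have e2 : a ^ (-s) * a⁻¹ = a ^ (-1 - s) := by
    rw [← Real.rpow_neg_one a, ← Real.rpow_add ha0]; congr 1; ring
  have h : 1 + s * a⁻¹ ≤ (1 - a⁻¹) ^ (-s) := by
    rw [Real.rpow_def_of_pos (by linarith)]
    have h1 := Real.log_le_sub_one_of_pos (x := 1 - a⁻¹) (by linarith)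
    have h2 := Real.add_one_le_exp (Real.log (1 - a⁻¹) * -s)
    nlinarith
  rw [e, Real.mul_rpow ha0.le (by linarith), ← e2]
  have := mul_le_mul_of_nonneg_left h (Real.rpow_nonneg ha0.le (-s))
  linarith

lemma sum_range_rpow_neg_le {β : ℝ} (h0 : 0 < β) (h1 : β < 1) (N : ℕ) :
    ∑ n ∈ Finset.range N, ((n : ℝ) + 1) ^ (-β) ≤ (1 - β)⁻¹ * (N : ℝ) ^ (1 - β) := by
  have h2 : 0 < 1 - β := by linarith
  rw [← div_eq_inv_mul, le_div_iff₀ h2, mul_comm, Finset.mul_sum]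
  refine (Finset.sum_le_sum fun (n : ℕ) _ => rpow_neg_le_sub (a := (n : ℝ) + 1) h0 h1 (by linarith [(Nat.cast_nonneg n : (0 : ℝ) ≤ n)])).trans ?_
  have := Finset.sum_range_sub (fun n : ℕ => (n : ℝ) ^ (1 - β)) N
  simp only [Nat.cast_add, Nat.cast_one] at this
  simp only [add_sub_cancel_right, this]
  simp [Real.zero_rpow h2.ne']

lemma sum_Ico_rpow_le {s : ℝ} (h0 : 0 < s) {M N : ℕ} (hM : 1 ≤ M) (hMN : M ≤ N) :
    ∑ n ∈ Finset.Ico M N, ((n : ℝ) + 1) ^ (-1 - s) ≤ s⁻¹ * (M : ℝ) ^ (-s) := by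
  rw [← div_eq_inv_mul, le_div_iff₀ h0, mul_comm, Finset.mul_sum]
  refine (Finset.sum_le_sum (g := fun n : ℕ => -((n + 1 : ℕ) : ℝ) ^ (-s) - -(n : ℝ) ^ (-s))
    fun n hn => ?_).trans ?_
  · have : (1 : ℝ) ≤ n := by
      have := (Finset.mem_Ico.1 hn).1; exact_mod_cast hM.trans this
    have h := rpow_neg_one_sub_le (a := (n : ℝ) + 1) h0 (by linarith)
    simp only [add_sub_cancel_right] at h
    push_cast
    linarith
  · rw [Finset.sum_Ico_sub (fun n : ℕ => -(n : ℝ) ^ (-s)) hMN]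
    have : 0 ≤ (N : ℝ) ^ (-s) := by positivity
    linarith

/-- One-dimensional sum controlling the far part of the lattice convolution. -/
lemma sum_range_far_le {η β s L : ℝ} (hη : 0 < η) (hβ : β < 1) (hs : s ∈ Set.Icc η β)
    (hL : 1 ≤ L) (N : ℕ) :
    ∑ n ∈ Finset.range N, (L + ((n : ℝ) + 1) ^ 2) ^ (-(1 / 2) : ℝ) * ((n : ℝ) + 1) ^ (-s) ≤
      ((1 - β)⁻¹ + 2 * η⁻¹) * L ^ (-(s / 2)) := by
  obtain ⟨hs1, hs2⟩ := hs
  have hL0 : 0 < L := by linarith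
  have hsq : 1 ≤ √L := Real.one_le_sqrt.2 hL
  -- The summand changes behaviour at n ≈ √L. Below, the first factor is at most L^(-1/2) and the
  -- powers n^(-s) are summed, which needs s ≤ β < 1. Above, the first factor is at most 1/(n+1) and
  -- a convergent tail remains, which needs s ≥ η > 0. The constants depend on s only through η and
  -- β.
  set M := ⌊√L⌋₊ with hM
  have hM1 : 1 ≤ M := Nat.le_floor (by simpa using hsq)
  have hML : (M : ℝ) ≤ √L := Nat.floor_le (by positivity)
  have hLM : √L ≤ 2 * M := by
    have h1 := Nat.lt_floor_add_one (√L)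
    have h2 : (1 : ℝ) ≤ M := by exact_mod_cast hM1
    rw [← hM] at h1
    linarith
  have hpos : ∀ n : ℕ, 0 < (n : ℝ) + 1 := fun n => by positivity
  have e1 : √L ^ (-s) = L ^ (-(s / 2)) := by
    rw [Real.sqrt_eq_rpow, ← Real.rpow_mul hL0.le]; congr 1; ring
  have t1 : ∑ n ∈ Finset.range M, (L + ((n : ℝ) + 1) ^ 2) ^ (-(1 / 2) : ℝ) * ((n : ℝ) + 1) ^ (-s) ≤
      (1 - β)⁻¹ * L ^ (-(s / 2)) := by
    calc _ ≤ ∑ n ∈ Finset.range M, L ^ (-(1 / 2) : ℝ) * ((n : ℝ) + 1) ^ (-s) := by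
          refine Finset.sum_le_sum fun n _ => mul_le_mul_of_nonneg_right ?_ (by positivity)
          exact Real.rpow_le_rpow_of_nonpos hL0 (by nlinarith [hpos n]) (by norm_num)
      _ ≤ L ^ (-(1 / 2) : ℝ) * ((1 - s)⁻¹ * (M : ℝ) ^ (1 - s)) := by
          rw [← Finset.mul_sum]
          exact mul_le_mul_of_nonneg_left (sum_range_rpow_neg_le (by linarith) (by linarith) M)
            (by positivity)
      _ ≤ L ^ (-(1 / 2) : ℝ) * ((1 - β)⁻¹ * √L ^ (1 - s)) := by
          have : 0 < 1 - β := by linarith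
          gcongr
          linarith
      _ = _ := by
          rw [Real.sqrt_eq_rpow, ← Real.rpow_mul hL0.le, mul_left_comm, ← Real.rpow_add hL0]
          congr 2; ring
  have t2 : ∀ K, M ≤ K → ∑ n ∈ Finset.Ico M K,
      (L + ((n : ℝ) + 1) ^ 2) ^ (-(1 / 2) : ℝ) * ((n : ℝ) + 1) ^ (-s) ≤
      2 * η⁻¹ * L ^ (-(s / 2)) := by
    intro K hK
    calc _ ≤ ∑ n ∈ Finset.Ico M K, ((n : ℝ) + 1) ^ (-1 - s) := by
          refine Finset.sum_le_sum fun n _ => ?_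
          have : ((n : ℝ) + 1) ^ (-1 - s) = (((n : ℝ) + 1) ^ 2) ^ (-(1 / 2) : ℝ) * ((n : ℝ) + 1) ^ (-s) := by
            rw [← Real.rpow_natCast, ← Real.rpow_mul (hpos n).le, ← Real.rpow_add (hpos n)]
            congr 1; push_cast; ring
          rw [this]
          refine mul_le_mul_of_nonneg_right ?_ (by positivity)
          exact Real.rpow_le_rpow_of_nonpos (by positivity) (by linarith) (by norm_num)
      _ ≤ s⁻¹ * (M : ℝ) ^ (-s) := sum_Ico_rpow_le (by linarith) hM1 hK
      _ ≤ η⁻¹ * (2 * L ^ (-(s / 2))) := by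
          have hM0 : (0 : ℝ) < M := by exact_mod_cast hM1
          have h3 : (M : ℝ) ^ (-s) ≤ 2 * L ^ (-(s / 2)) := by
            calc (M : ℝ) ^ (-s) ≤ (√L / 2) ^ (-s) :=
                  Real.rpow_le_rpow_of_nonpos (by positivity) (by linarith) (by linarith)
              _ = 2 ^ s * √L ^ (-s) := by
                  rw [Real.div_rpow (by positivity) (by norm_num), Real.rpow_neg (by norm_num : (0:ℝ) ≤ 2)]
                  field_simp
              _ ≤ 2 * L ^ (-(s / 2)) := by
                  rw [e1]
                  refine mul_le_mul_of_nonneg_right ?_ (by positivity)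
                  exact (Real.rpow_le_rpow_of_exponent_le (by norm_num)
                    (show s ≤ 1 by linarith)).trans_eq (Real.rpow_one 2)
          exact mul_le_mul (inv_anti₀ hη hs1) h3 (by positivity) (by positivity)
      _ = _ := by ring
  have hnn : ∀ n : ℕ, 0 ≤ (L + ((n : ℝ) + 1) ^ 2) ^ (-(1 / 2) : ℝ) * ((n : ℝ) + 1) ^ (-s) :=
    fun n => by positivity
  have hle := le_max_left M N
  calc _ ≤ ∑ n ∈ Finset.range (max M N),
        (L + ((n : ℝ) + 1) ^ 2) ^ (-(1 / 2) : ℝ) * ((n : ℝ) + 1) ^ (-s) :=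
        Finset.sum_le_sum_of_subset_of_nonneg
          (Finset.range_mono (le_max_right M N)) fun n _ _ => hnn n
    _ ≤ _ := by
        rw [← Finset.sum_range_add_sum_Ico _ hle, add_mul]
        exact add_le_add t1 (t2 _ hle)

/-- With k = (a, b), the inequalities (L + λ_k)² ≥ (L + a²)(L + b²) and λ_k² ≥ (1 + a²)(1 + b²)
dominate the summand by a product of one-dimensional ones. Each factor sums to O(L^(-s/2)). -/
lemma tsum_far_le {η β s L : ℝ} (hη : 0 < η) (hβ : β < 1) (hs : s ∈ Set.Icc η β) (hL : 1 ≤ L) :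
    ∑' k : ℤ × ℤ, ENNReal.ofReal ((L + lam k)⁻¹ * lam k ^ (-s)) ≤
      ENNReal.ofReal ((1 + 2 * ((1 - β)⁻¹ + 2 * η⁻¹)) ^ 2 * L ^ (-s)) := by
  have hL0 : 0 < L := by linarith
  have hs0 : 0 < s := by linarith [hs.1]
  set D : ℝ := (1 - β)⁻¹ + 2 * η⁻¹ with hD
  have hD0 : 0 ≤ D := by have : 0 < 1 - β := by linarith
                         positivity
  let f : ℤ → ℝ := fun a => (L + (a : ℝ) ^ 2) ^ (-(1 / 2) : ℝ) * (1 + (a : ℝ) ^ 2) ^ (-(s / 2))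
  have hf0 : ∀ a, 0 ≤ f a := fun a => by positivity
  have h1 : ∀ k : ℤ × ℤ, (L + lam k)⁻¹ * lam k ^ (-s) ≤ f k.1 * f k.2 := by
    intro k
    have a1 : (L + lam k)⁻¹ ≤
        (L + (k.1 : ℝ) ^ 2) ^ (-(1 / 2) : ℝ) * (L + (k.2 : ℝ) ^ 2) ^ (-(1 / 2) : ℝ) := by
      rw [← Real.mul_rpow (by positivity) (by positivity), Real.rpow_neg (by positivity),
        ← Real.sqrt_eq_rpow]
      refine inv_anti₀ (by positivity) (Real.sqrt_le_iff.2 ⟨by have := lam_pos k; linarith, ?_⟩)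
      unfold lam
      nlinarith [sq_nonneg (k.1 : ℝ), sq_nonneg (k.2 : ℝ), mul_nonneg (sq_nonneg (k.1 : ℝ)) (sq_nonneg (k.2 : ℝ))]
    have a2 : lam k ^ (-s) ≤ (1 + (k.1 : ℝ) ^ 2) ^ (-(s / 2)) * (1 + (k.2 : ℝ) ^ 2) ^ (-(s / 2)) := by
      rw [← Real.mul_rpow (by positivity) (by positivity)]
      have : lam k ^ (-s) = (lam k ^ 2) ^ (-(s / 2)) := by
        rw [← Real.rpow_natCast, ← Real.rpow_mul (lam_pos k).le]; congr 1; push_cast; ring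
      rw [this]
      refine Real.rpow_le_rpow_of_nonpos (by positivity) ?_ (by linarith)
      unfold lam
      nlinarith [sq_nonneg (k.1 : ℝ), sq_nonneg (k.2 : ℝ), mul_nonneg (sq_nonneg (k.1 : ℝ)) (sq_nonneg (k.2 : ℝ))]
    refine (mul_le_mul a1 a2 (Real.rpow_nonneg (lam_pos k).le _) (by positivity)).trans_eq ?_
    simp only [f]; ring
  have h2 : ∑' a : ℤ, ENNReal.ofReal (f a) ≤ ENNReal.ofReal ((1 + 2 * D) * L ^ (-(s / 2))) := by
    rw [tsum_int_of_even (by simp [f]), add_mul, ENNReal.ofReal_add (by positivity) (by positivity)]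
    refine add_le_add (ENNReal.ofReal_le_ofReal ?_) ?_
    · simp only [f]
      norm_num
      exact Real.rpow_le_rpow_of_exponent_le hL (by linarith [hs.2])
    · rw [mul_assoc, ENNReal.ofReal_mul (by norm_num), ENNReal.ofReal_ofNat]
      refine mul_le_mul_right ?_ 2
      refine tsum_ofReal_le (fun n => hf0 _) fun N => ?_
      refine le_trans (Finset.sum_le_sum fun n _ => ?_) (sum_range_far_le hη hβ hs hL N)
      simp only [f]
      push_cast
      refine mul_le_mul_of_nonneg_left ?_ (by positivity)
      have e : ((n : ℝ) + 1) ^ (-s) = (((n : ℝ) + 1) ^ 2) ^ (-(s / 2)) := by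
        rw [← Real.rpow_natCast, ← Real.rpow_mul (by positivity)]; congr 1; push_cast; ring
      rw [e]
      exact Real.rpow_le_rpow_of_nonpos (by positivity) (by linarith) (by linarith)
  calc _ ≤ ∑' k : ℤ × ℤ, ENNReal.ofReal (f k.1) * ENNReal.ofReal (f k.2) := by
        refine ENNReal.tsum_le_tsum fun k => ?_
        rw [← ENNReal.ofReal_mul (hf0 _)]
        exact ENNReal.ofReal_le_ofReal (h1 k)
    _ = (∑' a : ℤ, ENNReal.ofReal (f a)) ^ 2 := by
        rw [ENNReal.tsum_prod (f := fun a b => ENNReal.ofReal (f a) * ENNReal.ofReal (f b))]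
        simp only [ENNReal.tsum_mul_left, ENNReal.tsum_mul_right]
        rw [sq]
    _ ≤ _ := by
        refine (pow_le_pow_left' h2 2).trans_eq ?_
        rw [← ENNReal.ofReal_pow (by positivity), mul_pow, ← Real.rpow_natCast (L ^ _),
          ← Real.rpow_mul hL0.le]
        congr 3; push_cast; ring

/-! ### Convolution powers of `λ⁻¹` -/

/-- √λ_k is the Euclidean length of (1, k). This is the triangle inequality, in which the first
coordinate 2 of the sum may be lowered to 1. -/
lemma sqrt_lam_add_le (l k : ℤ × ℤ) : √(lam (l + k)) ≤ √(lam l) + √(lam k) := by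
  refine Real.sqrt_le_iff.2 ⟨by positivity, ?_⟩
  have h1 : (l.1 : ℝ) * k.1 + l.2 * k.2 ≤ √(lam l) * √(lam k) := by
    rw [← Real.sqrt_mul (lam_pos l).le]
    refine Real.le_sqrt_of_sq_le ?_
    unfold lam
    nlinarith [sq_nonneg ((l.1 : ℝ) * k.2 - l.2 * k.1), sq_nonneg (l.1 : ℝ), sq_nonneg (l.2 : ℝ),
      sq_nonneg (k.1 : ℝ), sq_nonneg (k.2 : ℝ)]
  have h2 : lam (l + k) ≤ lam l + lam k + 2 * ((l.1 : ℝ) * k.1 + l.2 * k.2) := by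
    simp only [lam, Prod.fst_add, Prod.snd_add, Int.cast_add]
    nlinarith
  nlinarith [Real.sq_sqrt (lam_pos l).le, Real.sq_sqrt (lam_pos k).le]

/-- The operator `f ↦ ∑_k λ_k⁻¹ f(· + k)`. -/
def latticeConv (f : ℤ × ℤ → ℝ≥0∞) (l : ℤ × ℤ) : ℝ≥0∞ :=
  ∑' k, ENNReal.ofReal (lam k)⁻¹ * f (l + k)

lemma latticeConv_mono {f g : ℤ × ℤ → ℝ≥0∞} (h : f ≤ g) : latticeConv f ≤ latticeConv g :=
  fun l => ENNReal.tsum_le_tsum fun k => mul_le_mul_right (h (l + k)) _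

lemma latticeConv_const_mul (c : ℝ≥0∞) (f : ℤ × ℤ → ℝ≥0∞) :
    latticeConv (fun l => c * f l) = fun l => c * latticeConv f l := by
  funext l
  simp only [latticeConv, ← ENNReal.tsum_mul_left]
  congr 1; funext k; ring

lemma latticeConv_tsum {J : Type*} (f : J → ℤ × ℤ → ℝ≥0∞) :
    latticeConv (fun l => ∑' j, f j l) = fun l => ∑' j, latticeConv (f j) l := by
  funext l
  simp only [latticeConv, ← ENNReal.tsum_mul_left]
  exact ENNReal.tsum_comm

lemma latticeConv_shift (f : ℤ × ℤ → ℝ≥0∞) (m : ℤ × ℤ) :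
    latticeConv (fun l => f (l + m)) = fun l => latticeConv f (l + m) := by
  funext l
  simp only [latticeConv, add_right_comm]

/-- Monotonicity, homogeneity, countable additivity and translation invariance carry a bound on the
iterates of λ^(-β) over to every superposition of its translates. -/
lemma iterate_latticeConv_mono (n : ℕ) {f g : ℤ × ℤ → ℝ≥0∞} (h : f ≤ g) :
    latticeConv^[n] f ≤ latticeConv^[n] g := by
  induction n generalizing f g with
  | zero => exact h
  | succ n ih => exact ih (latticeConv_mono h)

lemma iterate_latticeConv_const_mul (n : ℕ) (c : ℝ≥0∞) (f : ℤ × ℤ → ℝ≥0∞) :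
    latticeConv^[n] (fun l => c * f l) = fun l => c * latticeConv^[n] f l := by
  induction n generalizing f with
  | zero => rfl
  | succ n ih => simp only [Function.iterate_succ_apply, latticeConv_const_mul, ih]

lemma iterate_latticeConv_tsum (n : ℕ) {J : Type*} (f : J → ℤ × ℤ → ℝ≥0∞) :
    latticeConv^[n] (fun l => ∑' j, f j l) = fun l => ∑' j, latticeConv^[n] (f j) l := by
  induction n generalizing f with
  | zero => rfl
  | succ n ih => simp only [Function.iterate_succ_apply, latticeConv_tsum, ih]

lemma iterate_latticeConv_shift (n : ℕ) (f : ℤ × ℤ → ℝ≥0∞) (m : ℤ × ℤ) :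
    latticeConv^[n] (fun l => f (l + m)) = fun l => latticeConv^[n] f (l + m) := by
  induction n generalizing f with
  | zero => rfl
  | succ n ih => simp only [Function.iterate_succ_apply, latticeConv_shift, ih]

/-- Two regions. If √λ_k ≤ (1-t)√λ_l, the shift is short: √λ_{l+k} ≥ t√λ_l, so the power at l + k is
comparable to that at l with ratio at most t⁻². Otherwise λ_k dominates both λ_l and λ_{l+k}, so
λ_k⁻¹ is controlled by (λ_l + λ_{l+k})⁻¹. Only the first region produces the logarithm, and its
constant tends to 1 as t → 1. -/
lemma lam_inv_mul_rpow_le {t s : ℝ} (ht0 : 0 < t) (ht1 : t < 1) (hs0 : 0 < s) (hs1 : s ≤ 1)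
    (l k : ℤ × ℤ) :
    (lam k)⁻¹ * lam (l + k) ^ (-s) ≤
      (t ^ 2)⁻¹ * lam l ^ (-s) * (if lam k ≤ lam l then (lam k)⁻¹ else 0) +
        (1 + (1 - t)⁻¹) ^ 2 * 2 * ((lam l + lam (l + k))⁻¹ * lam (l + k) ^ (-s)) := by
  have h1 := lam_pos l
  have h2 := lam_pos k
  have h3 := lam_pos (l + k)
  have q1 := Real.sqrt_pos.2 h1
  have q2 := Real.sqrt_pos.2 h2
  have ht : 0 < 1 - t := by linarith
  by_cases hk : √(lam k) ≤ (1 - t) * √(lam l)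
  · have hkl : lam k ≤ lam l := (Real.sqrt_le_sqrt_iff h1.le).1 (hk.trans (by nlinarith))
    rw [if_pos hkl]
    refine le_add_of_le_of_nonneg ?_ (by positivity)
    rw [mul_comm]
    refine mul_le_mul_of_nonneg_right ?_ (by positivity)
    have h4 : √(lam l) ≤ √(lam (l + k)) + √(lam k) := by
      have := sqrt_lam_add_le (l + k) (-k)
      rwa [add_neg_cancel_right, lam_neg] at this
    have h5 : t * √(lam l) ≤ √(lam (l + k)) := by linarith
    have h6 : t ^ 2 * lam l ≤ lam (l + k) := by
      rw [← Real.sq_sqrt h1.le, ← Real.sq_sqrt h3.le, ← mul_pow]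
      exact pow_le_pow_left₀ (by positivity) h5 2
    calc lam (l + k) ^ (-s) ≤ (t ^ 2 * lam l) ^ (-s) :=
          Real.rpow_le_rpow_of_nonpos (by positivity) h6 (by linarith)
      _ = (t ^ 2) ^ (-s) * lam l ^ (-s) := Real.mul_rpow (by positivity) h1.le
      _ ≤ (t ^ 2) ^ (-1 : ℝ) * lam l ^ (-s) := by
          refine mul_le_mul_of_nonneg_right ?_ (by positivity)
          exact Real.rpow_le_rpow_of_exponent_ge (by positivity) (by nlinarith) (by linarith)
      _ = _ := by rw [Real.rpow_neg_one]
  · push Not at hk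
    refine le_add_of_nonneg_of_le (by positivity) ?_
    rw [← mul_assoc]
    refine mul_le_mul_of_nonneg_right ?_ (by positivity)
    have h4 : √(lam l) ≤ (1 - t)⁻¹ * √(lam k) := by
      rw [← div_eq_inv_mul, le_div_iff₀ ht]; linarith
    have h5 : √(lam (l + k)) ≤ (1 + (1 - t)⁻¹) * √(lam k) := by
      linarith [sqrt_lam_add_le l k]
    have hi : 0 < (1 - t)⁻¹ := by positivity
    have h6 : lam l ≤ (1 + (1 - t)⁻¹) ^ 2 * lam k := by
      rw [← Real.sq_sqrt h1.le, ← Real.sq_sqrt h2.le, ← mul_pow]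
      exact pow_le_pow_left₀ (by positivity) (by nlinarith) 2
    have h7 : lam (l + k) ≤ (1 + (1 - t)⁻¹) ^ 2 * lam k := by
      rw [← Real.sq_sqrt h3.le, ← Real.sq_sqrt h2.le, ← mul_pow]
      exact pow_le_pow_left₀ (by positivity) h5 2
    rw [← div_eq_mul_inv, le_div_iff₀ (by positivity), inv_mul_le_iff₀ h2]
    linarith

/-- The near region contributes λ_l^(-s) times the logarithmic lattice sum; the far region,
translated by l, is O(λ_l^(-s)). Uniformity of C in s is essential, because the exponent drifts when
the bound is iterated. -/
lemma latticeConv_rpow_le {t η β : ℝ} (ht0 : 0 < t) (ht1 : t < 1) (hη : 0 < η) (hβ : β < 1) :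
    ∃ C : ℝ, 0 ≤ C ∧ ∀ s ∈ Set.Icc η β, ∀ l,
      latticeConv (fun k => ENNReal.ofReal (lam k ^ (-s))) l ≤
        ENNReal.ofReal (lam l ^ (-s) * ((t ^ 2)⁻¹ * Real.pi * Real.log (lam l) + C)) := by
  have hπ := Real.pi_pos
  have ht : 0 < 1 - t := by linarith
  refine ⟨(t ^ 2)⁻¹ * (1 + 4 * Real.pi) +
    (1 + (1 - t)⁻¹) ^ 2 * 2 * (1 + 2 * ((1 - β)⁻¹ + 2 * η⁻¹)) ^ 2, by positivity,
    fun s hs l => ?_⟩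
  have hL := one_le_lam l
  have hL0 := lam_pos l
  have hlog := Real.log_nonneg hL
  have hs0 : 0 < s := by linarith [hs.1]
  have hs1 : s ≤ 1 := by linarith [hs.2]
  have h1 : ∀ k, ENNReal.ofReal (lam k)⁻¹ * ENNReal.ofReal (lam (l + k) ^ (-s)) ≤
      ENNReal.ofReal ((t ^ 2)⁻¹ * lam l ^ (-s)) *
        (if lam k ≤ lam l then ENNReal.ofReal (lam k)⁻¹ else 0) +
      ENNReal.ofReal ((1 + (1 - t)⁻¹) ^ 2 * 2) *
        ENNReal.ofReal ((lam l + lam (l + k))⁻¹ * lam (l + k) ^ (-s)) := by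
    intro k
    have h2 := lam_pos k
    have h3 := lam_pos (l + k)
    have e : (if lam k ≤ lam l then ENNReal.ofReal (lam k)⁻¹ else 0) =
        ENNReal.ofReal (if lam k ≤ lam l then (lam k)⁻¹ else 0) := by
      split_ifs <;> simp
    have hnn : 0 ≤ (if lam k ≤ lam l then (lam k)⁻¹ else 0) := by split_ifs <;> positivity
    rw [e, ← ENNReal.ofReal_mul (by positivity), ← ENNReal.ofReal_mul (by positivity),
      ← ENNReal.ofReal_mul (by positivity), ← ENNReal.ofReal_add (by positivity) (by positivity)]
    exact ENNReal.ofReal_le_ofReal (lam_inv_mul_rpow_le ht0 ht1 hs0 hs1 l k)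
  refine (ENNReal.tsum_le_tsum h1).trans ?_
  rw [ENNReal.tsum_add, ENNReal.tsum_mul_left, ENNReal.tsum_mul_left]
  have h2 := (Equiv.addLeft l).tsum_eq
    (fun k => ENNReal.ofReal ((lam l + lam k)⁻¹ * lam k ^ (-s)))
  simp only [Equiv.coe_addLeft] at h2
  rw [h2]
  refine (add_le_add (mul_le_mul_right (tsum_inv_lam_le hL) _)
    (mul_le_mul_right (tsum_far_le hη hβ hs hL) _)).trans_eq ?_
  rw [← ENNReal.ofReal_mul (by positivity), ← ENNReal.ofReal_mul (by positivity),
    ← ENNReal.ofReal_add (by positivity) (by positivity)]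
  congr 1
  ring

/-- This is log y ≤ y/e at y = x^d. The optimal constant 1/e matters: it turns nⁿ into nⁿ/eⁿ ≤ n!
after n iterations. -/
lemma log_le_rpow_div_exp {x d : ℝ} (hx : 0 < x) (hd : 0 < d) :
    Real.log x ≤ x ^ d / (Real.exp 1 * d) := by
  have hy : 0 < x ^ d := Real.rpow_pos_of_pos hx d
  have h := Real.log_le_sub_one_of_pos (x := x ^ d / Real.exp 1) (by positivity)
  rw [Real.log_div hy.ne' (Real.exp_pos 1).ne', Real.log_exp, Real.log_rpow hx] at h
  rw [le_div_iff₀ (by positivity)]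
  have h2 : d * Real.log x ≤ x ^ d / Real.exp 1 := by linarith
  rw [le_div_iff₀ (Real.exp_pos 1)] at h2
  linarith

/-- The logarithm is traded for a loss d in the exponent at the price 1/(e d), so that the bound is
again a pure power and can be iterated. -/
lemma latticeConv_rpow_le_rpow {t η β : ℝ} (ht0 : 0 < t) (ht1 : t < 1) (hη : 0 < η) (hβ : β < 1) :
    ∃ C : ℝ, 0 ≤ C ∧ ∀ s ∈ Set.Icc η β, ∀ d, 0 < d →
      latticeConv (fun k => ENNReal.ofReal (lam k ^ (-s))) ≤
        fun l => ENNReal.ofReal ((t ^ 2)⁻¹ * Real.pi / (Real.exp 1 * d) + C) *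
          ENNReal.ofReal (lam l ^ (-(s - d))) := by
  have hπ := Real.pi_pos
  obtain ⟨C, hC, h⟩ := latticeConv_rpow_le ht0 ht1 hη hβ
  refine ⟨C, hC, fun s hs d hd l => (h s hs l).trans ?_⟩
  have hL := one_le_lam l
  have hL0 := lam_pos l
  beta_reduce
  rw [← ENNReal.ofReal_mul (by positivity)]
  refine ENNReal.ofReal_le_ofReal ?_
  have e : lam l ^ (-(s - d)) = lam l ^ (-s) * lam l ^ d := by
    rw [← Real.rpow_add hL0]; congr 1; ring
  have h1 := log_le_rpow_div_exp hL0 hd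
  have h2 : 1 ≤ lam l ^ d := Real.one_le_rpow hL hd.le
  rw [e]
  calc lam l ^ (-s) * ((t ^ 2)⁻¹ * Real.pi * Real.log (lam l) + C)
      ≤ lam l ^ (-s) * ((t ^ 2)⁻¹ * Real.pi * (lam l ^ d / (Real.exp 1 * d)) + C * lam l ^ d) := by
        gcongr
        nlinarith
    _ = _ := by ring

/-- Growth of the convolution powers of `λ⁻¹` against a negative power of `λ`. -/
theorem exists_iterate_latticeConv_le {β r : ℝ} (hβ0 : 0 < β) (hβ1 : β < 1)
    (hr : Real.pi / β < r) : ∃ C : ℝ, ∀ (n : ℕ) (l : ℤ × ℤ),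
      latticeConv^[n] (fun k => ENNReal.ofReal (lam k ^ (-β))) l ≤
        ENNReal.ofReal (C * (n.factorial * r ^ n)) := by
  have hπ := Real.pi_pos
  have hr0 : 0 < r := lt_trans (by positivity) hr
  -- The slack r > π/β is spent in three factors t: two in the near region of the convolution, and
  -- one by consuming only tβ of the exponent, so that all exponents stay above η = (1-t)β > 0.
  obtain ⟨t, ht0, ht1, ht⟩ : ∃ t : ℝ, 0 < t ∧ t < 1 ∧ t ^ 3 = Real.pi / (β * r) := by
    refine ⟨(Real.pi / (β * r)) ^ ((3 : ℕ) : ℝ)⁻¹, by positivity, ?_, ?_⟩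
    · refine Real.rpow_lt_one (by positivity) ?_ (by positivity)
      rw [div_lt_one (by positivity)]
      rw [div_lt_iff₀ hβ0] at hr
      linarith
    · exact Real.rpow_inv_natCast_pow (by positivity) (by norm_num)
  have hη0 : 0 < (1 - t) * β := mul_pos (by linarith) hβ0
  have hr' : (t ^ 2)⁻¹ * Real.pi / (t * β) = r := by
    have : t ^ 3 * (β * r) = Real.pi := by rw [ht]; field_simp
    field_simp
    linarith
  obtain ⟨C, hC, h⟩ := latticeConv_rpow_le_rpow ht0 ht1 hη0 hβ1
  refine ⟨Real.exp (C * Real.exp 1 / r), fun n l => ?_⟩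
  rcases Nat.eq_zero_or_pos n with rfl | hn
  · simp only [Function.iterate_zero, id, Nat.factorial_zero, Nat.cast_one, pow_zero, mul_one]
    refine ENNReal.ofReal_le_ofReal ?_
    exact (Real.rpow_le_one_of_one_le_of_nonpos (one_le_lam l) (by linarith)).trans
      (Real.one_le_exp (by positivity))
  have hn0 : (0 : ℝ) < n := by exact_mod_cast hn
  -- The n steps lose equal amounts of exponent, tβ in total. The division is why n = 0 was treated
  -- apart.
  set d : ℝ := t * β / n with hd
  have hd0 : 0 < d := by positivity
  set K : ℝ := (t ^ 2)⁻¹ * Real.pi / (Real.exp 1 * d) + C with hK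
  have hK0 : 0 ≤ K := by positivity
  have key : ∀ j : ℕ, j ≤ n → latticeConv^[j] (fun k => ENNReal.ofReal (lam k ^ (-β))) ≤
      fun l => ENNReal.ofReal K ^ j * ENNReal.ofReal (lam l ^ (-(β - j * d))) := by
    intro j hj
    induction j with
    | zero => simp
    | succ j ih =>
      rw [Function.iterate_succ_apply']
      refine (latticeConv_mono (ih (by omega))).trans ?_
      rw [latticeConv_const_mul]
      intro l
      have hjn : (j : ℝ) ≤ n := by exact_mod_cast (by omega : j ≤ n)
      have hjd : j * d ≤ t * β := by
        rw [hd, mul_div_assoc', div_le_iff₀ hn0]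
        nlinarith [mul_pos ht0 hβ0]
      have h1 := h (β - j * d) ⟨by linarith, by nlinarith [mul_nonneg (j.cast_nonneg (α := ℝ)) hd0.le]⟩ d hd0 l
      refine (mul_le_mul_right h1 _).trans_eq ?_
      rw [← mul_assoc, ← pow_succ]
      have : β - j * d - d = β - ((j + 1 : ℕ) : ℝ) * d := by push_cast; ring
      rw [this]
  refine (key n le_rfl l).trans ?_
  beta_reduce
  rw [← ENNReal.ofReal_pow hK0, ← ENNReal.ofReal_mul (by positivity)]
  refine ENNReal.ofReal_le_ofReal ?_
  have h1 : lam l ^ (-(β - n * d)) ≤ 1 := by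
    refine Real.rpow_le_one_of_one_le_of_nonpos (one_le_lam l) ?_
    have : n * d = t * β := by rw [hd]; field_simp
    rw [this]; nlinarith
  -- The additive constant C is a relative error of order 1/n, so its n-th power stays bounded by a
  -- constant; the main factor gives rⁿ nⁿ/eⁿ ≤ rⁿ n!.
  have h2 : K = r * n / Real.exp 1 * (1 + C * Real.exp 1 / r / n) := by
    have : (t ^ 2)⁻¹ * Real.pi / (Real.exp 1 * d) = r * n / Real.exp 1 := by
      rw [← hr', hd]; field_simp
    rw [hK, this]; field_simp
  have h3 : (1 + C * Real.exp 1 / r / n) ^ n ≤ Real.exp (C * Real.exp 1 / r) := by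
    have h4 := Real.add_one_le_exp (C * Real.exp 1 / r / n)
    calc _ ≤ Real.exp (C * Real.exp 1 / r / n) ^ n :=
          pow_le_pow_left₀ (by positivity) (by linarith) n
      _ = _ := by rw [← Real.exp_nat_mul]; congr 1; field_simp
  have h5 : (n : ℝ) ^ n / Real.exp 1 ^ n ≤ n.factorial := by
    have := Real.pow_div_factorial_le_exp (n : ℝ) hn0.le n
    rw [div_le_iff₀ (by positivity)] at this ⊢
    rw [← Real.exp_nat_mul, mul_one]
    linarith
  calc K ^ n * lam l ^ (-(β - n * d)) ≤ K ^ n * 1 := by gcongr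
    _ = r ^ n * ((n : ℝ) ^ n / Real.exp 1 ^ n) * (1 + C * Real.exp 1 / r / n) ^ n := by
        rw [h2]; simp only [mul_pow, div_pow]; ring
    _ ≤ r ^ n * n.factorial * Real.exp (C * Real.exp 1 / r) := by gcongr
    _ = _ := by ring

/-! ### Integration by parts for Gaussian measures -/

lemma hasDerivAt_gaussianPDFReal (x : ℝ) :
    HasDerivAt (gaussianPDFReal 0 1) (-x * gaussianPDFReal 0 1 x) x := by
  have h : HasDerivAt (fun x : ℝ => -(x - 0) ^ 2 / (2 * ((1 : ℝ≥0) : ℝ))) (-x) x := by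
    have := (((hasDerivAt_id x).sub_const 0).pow 2).neg.div_const (2 * ((1 : ℝ≥0) : ℝ))
    refine this.congr_deriv ?_
    simp
    ring
  have h2 := (h.exp).const_mul ((√(2 * Real.pi * ((1 : ℝ≥0) : ℝ)))⁻¹)
  refine (h2.congr_deriv ?_)
  simp only [gaussianPDFReal]
  ring

lemma integrable_gaussianReal_iff {f : ℝ → ℝ} :
    Integrable f (gaussianReal 0 1) ↔ Integrable (fun x => gaussianPDFReal 0 1 x * f x) := by
  rw [gaussianReal_of_var_ne_zero _ one_ne_zero]
  have : gaussianPDF 0 1 = fun x => ENNReal.ofReal (gaussianPDFReal 0 1 x) := rfl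
  rw [this, integrable_withDensity_iff_integrable_smul' (by fun_prop) (by simp)]
  simp [ENNReal.toReal_ofReal, gaussianPDFReal_nonneg]

/-- With the Gaussian density φ, the integrand times φ is -(φu)', and the derivative of an
integrable function has integral zero as soon as it is integrable; no decay at infinity has to be
checked. -/
lemma integral_gaussianReal_parts {u u' : ℝ → ℝ} (h : ∀ y, HasDerivAt u (u' y) y)
    (hu : Integrable u (gaussianReal 0 1)) (hyu : Integrable (fun y => y * u y) (gaussianReal 0 1))
    (hu' : Integrable u' (gaussianReal 0 1)) :
    ∫ y, (y * u y - u' y) ∂(gaussianReal 0 1) = 0 := by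
  rw [integral_gaussianReal_eq_integral_smul one_ne_zero]
  have h0 := integrable_gaussianReal_iff.1 hu
  have h1 := integrable_gaussianReal_iff.1 (hu'.sub hyu)
  have := integral_eq_zero_of_hasDerivAt_of_integrable
    (f := fun y => gaussianPDFReal 0 1 y * u y)
    (f' := fun y => gaussianPDFReal 0 1 y * (u' y - y * u y))
    (fun y => by
      refine ((hasDerivAt_gaussianPDFReal y).mul (h y)).congr_deriv ?_
      ring) h1 h0
  rw [← neg_eq_zero, ← integral_neg]
  refine Eq.trans ?_ this
  refine integral_congr_ae (Eventually.of_forall fun y => ?_)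
  simp only [smul_eq_mul]; ring

section Product

variable {ι : Type*}

open Classical in
-- Resampling one coordinate independently does not change the product law. This lets Fubini isolate
-- a single coordinate of an infinite product without splitting the index set.
lemma measurePreserving_update (ν : Measure ℝ) [IsProbabilityMeasure ν] (i : ι) :
    MeasurePreserving (fun w : (ι → ℝ) × ℝ => Function.update w.1 i w.2)
      ((Measure.infinitePi fun _ : ι => ν).prod ν) (Measure.infinitePi fun _ : ι => ν) := by
  have hm : Measurable fun w : (ι → ℝ) × ℝ => Function.update w.1 i w.2 := by
    refine measurable_pi_lambda _ fun j => ?_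
    by_cases hj : j = i
    · subst hj; simpa using measurable_snd
    · simp only [Function.update_of_ne hj]; fun_prop
  refine ⟨hm, Measure.eq_infinitePi _ fun s t ht => ?_⟩
  rw [Measure.map_apply hm (MeasurableSet.pi s.countable_toSet fun j _ => ht j)]
  have : (fun w : (ι → ℝ) × ℝ => Function.update w.1 i w.2) ⁻¹' (Set.pi s t) =
      (Set.pi (s.erase i : Finset ι) t) ×ˢ (if i ∈ s then t i else Set.univ) := by
    ext w
    simp only [Set.mem_preimage, Set.mem_pi, Finset.mem_coe, Set.mem_prod, Finset.mem_erase]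
    constructor
    · intro h
      refine ⟨fun j hj => by simpa [Function.update_of_ne hj.1] using h j hj.2, ?_⟩
      split_ifs with hi
      · simpa using h i hi
      · trivial
    · rintro ⟨h1, h2⟩ j hj
      by_cases hji : j = i
      · subst hji; simpa [hj] using h2
      · rw [Function.update_of_ne hji]; exact h1 j ⟨hji, hj⟩
  rw [this, Measure.prod_prod, Measure.infinitePi_pi _ fun j _ => ht j]
  by_cases hi : i ∈ s
  · rw [if_pos hi, Finset.prod_erase_mul _ _ hi]
  · rw [if_neg hi, Finset.erase_eq_of_notMem hi, measure_univ, mul_one]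

/-- The standard Gaussian measure on a product of real lines. -/
abbrev stdGauss (ι : Type*) : Measure (ι → ℝ) := Measure.infinitePi fun _ : ι => gaussianReal 0 1

open Classical in
-- After the i-th coordinate is resampled, the inner integral over it vanishes by the
-- one-dimensional formula for almost every value of the others.
lemma integral_stdGauss_parts {h h' : (ι → ℝ) → ℝ} (i : ι)
    (hd : ∀ X y, HasDerivAt (fun y => h (Function.update X i y)) (h' (Function.update X i y)) y)
    (h1 : Integrable h (stdGauss ι)) (h2 : Integrable (fun X => X i * h X) (stdGauss ι))
    (h3 : Integrable h' (stdGauss ι)) :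
    ∫ X, X i * h X ∂(stdGauss ι) = ∫ X, h' X ∂(stdGauss ι) := by
  have hU : MeasurePreserving (fun w : (ι → ℝ) × ℝ => Function.update w.1 i w.2)
      ((stdGauss ι).prod (gaussianReal 0 1)) (stdGauss ι) := measurePreserving_update _ i
  have i1 := hU.integrable_comp_of_integrable h1
  have i2 := hU.integrable_comp_of_integrable h2
  have i3 := hU.integrable_comp_of_integrable h3
  rw [← sub_eq_zero, ← integral_sub h2 h3]
  have hf := (h2.sub h3).aestronglyMeasurable
  rw [← hU.map_eq] at hf
  have e := integral_map hU.aemeasurable hf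
  rw [hU.map_eq] at e
  simp only [Pi.sub_apply] at e
  rw [e]
  refine (integral_prod _ (i2.sub i3)).trans ?_
  simp only [Pi.sub_apply, Function.comp_apply]
  have : ∀ᵐ X ∂(stdGauss ι), ∫ y, (Function.update X i y i * h (Function.update X i y) -
      h' (Function.update X i y)) ∂(gaussianReal 0 1) = 0 := by
    filter_upwards [i1.prod_right_ae, i2.prod_right_ae, i3.prod_right_ae] with X a1 a2 a3
    simp only [Function.comp_apply, Function.update_self] at a1 a2 a3 ⊢
    exact integral_gaussianReal_parts (hd X) a1 a2 a3
  rw [integral_congr_ae this]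
  simp

end Product

/-! ### Functions with moments of all orders -/

section Moments

variable {Ω : Type*} [MeasurableSpace Ω] {μ : Measure Ω}

/-- Finiteness of all moments. -/
def HasMoments (f : Ω → ℝ) (μ : Measure Ω) : Prop := ∀ p : ℝ≥0, MemLp f p μ

lemma HasMoments.add {f g : Ω → ℝ} (hf : HasMoments f μ) (hg : HasMoments g μ) :
    HasMoments (fun x => f x + g x) μ := fun p => (hf p).add (hg p)

lemma HasMoments.sub {f g : Ω → ℝ} (hf : HasMoments f μ) (hg : HasMoments g μ) :
    HasMoments (fun x => f x - g x) μ := fun p => (hf p).sub (hg p)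

lemma hasMoments_const [IsProbabilityMeasure μ] (c : ℝ) : HasMoments (fun _ => c) μ := fun _ => memLp_const c

lemma HasMoments.mul {f g : Ω → ℝ} (hf : HasMoments f μ) (hg : HasMoments g μ) :
    HasMoments (fun x => f x * g x) μ := fun p => by
  have : ENNReal.HolderTriple ((2 * p : ℝ≥0) : ℝ≥0∞) ((2 * p : ℝ≥0) : ℝ≥0∞) (p : ℝ≥0∞) := ⟨by
    push_cast
    rw [ENNReal.mul_inv (by simp) (by simp), ← add_mul, ENNReal.inv_two_add_inv_two, one_mul]⟩
  exact MemLp.mul' (hg (2 * p)) (hf (2 * p))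

lemma HasMoments.const_mul [IsProbabilityMeasure μ] {f : Ω → ℝ} (c : ℝ) (hf : HasMoments f μ) :
    HasMoments (fun x => c * f x) μ := (hasMoments_const c).mul hf

lemma HasMoments.sum {J : Type*} (s : Finset J) {f : J → Ω → ℝ} (hf : ∀ j ∈ s, HasMoments (f j) μ) :
    HasMoments (fun x => ∑ j ∈ s, f j x) μ := fun p => by
  have := memLp_finsetSum (μ := μ) (p := (p : ℝ≥0∞)) s (f := f) fun j hj => hf j hj p
  exact this

lemma HasMoments.pow [IsProbabilityMeasure μ] {f : Ω → ℝ} (hf : HasMoments f μ) (n : ℕ) :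
    HasMoments (fun x => f x ^ n) μ := by
  induction n with
  | zero => simpa using hasMoments_const 1
  | succ n ih => simp only [pow_succ]; exact ih.mul hf

lemma HasMoments.abs_rpow [IsProbabilityMeasure μ] {f : Ω → ℝ} (hf : HasMoments f μ) {r : ℝ} (hr : 0 ≤ r) :
    HasMoments (fun x => |f x| ^ r) μ := fun p => by
  obtain ⟨N, hN⟩ := exists_nat_ge r
  have h1 := ((hasMoments_const 1).add (hf.pow (2 * N))) p
  refine h1.mono ?_ (Eventually.of_forall fun x => ?_)
  · have := (hf 0).aestronglyMeasurable.aemeasurable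
    exact (this.abs.pow_const r).aestronglyMeasurable
  · rw [Real.norm_of_nonneg (by positivity), pow_mul, Real.norm_of_nonneg (by positivity)]
    rcases le_total |f x| 1 with h | h
    · have := Real.rpow_le_one (abs_nonneg (f x)) h hr
      have : 0 ≤ (f x ^ 2) ^ N := by positivity
      linarith
    · have h2 : |f x| ^ r ≤ (f x ^ 2) ^ N := by
        rw [← sq_abs, ← pow_mul, ← Real.rpow_natCast]
        refine Real.rpow_le_rpow_of_exponent_le h ?_
        push_cast; linarith [(Nat.cast_nonneg N : (0 : ℝ) ≤ N)]
      linarith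

lemma HasMoments.integrable {f : Ω → ℝ} (hf : HasMoments f μ) : Integrable f μ := by
  simpa using memLp_one_iff_integrable.1 (hf 1)

lemma hasMoments_eval {ι : Type*} (i : ι) : HasMoments (fun X => X i) (stdGauss ι) := fun p => by
  have h : MeasurePreserving (Function.eval i) (stdGauss ι) (gaussianReal 0 1) :=
    measurePreserving_eval_infinitePi (fun _ : ι => gaussianReal 0 1) i
  exact (memLp_id_gaussianReal (μ := 0) (v := 1) p).comp_measurePreserving h

end Moments

lemma hasDerivAt_abs_rpow_mul_self {p : ℝ} (hp : 2 ≤ p) (x : ℝ) :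
    HasDerivAt (fun x : ℝ => |x| ^ (p - 2) * x) ((p - 1) * |x| ^ (p - 2)) x := by
  rcases hp.eq_or_lt with rfl | hp
  -- At p = 2 the convention 0^0 = 1 makes |x|^(p-2) constant, so the formula holds at x = 0 as
  -- well.
  · simpa [show (2 : ℝ) - 1 = 1 by norm_num] using! hasDerivAt_id x
  rcases eq_or_ne x 0 with rfl | hx
  · rw [hasDerivAt_iff_tendsto_slope]
    have h1 : Tendsto (fun y : ℝ => |y| ^ (p - 2)) (𝓝 0) (𝓝 0) := by
      have : Continuous fun y : ℝ => |y| ^ (p - 2) :=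
        continuous_abs.rpow_const fun _ => Or.inr (by linarith)
      have := this.tendsto 0
      simpa [Real.zero_rpow (show p - 2 ≠ 0 by linarith)] using this
    simp only [abs_zero, Real.zero_rpow (show p - 2 ≠ 0 by linarith), mul_zero]
    refine (h1.mono_left nhdsWithin_le_nhds).congr' ?_
    filter_upwards [self_mem_nhdsWithin] with y hy
    have hy : y ≠ 0 := hy
    simp [slope_def_field, hy]
  · have h1 := ((hasDerivAt_abs hx).rpow_const (p := p - 2) (Or.inl (abs_ne_zero.2 hx))).mul
      (hasDerivAt_id x)
    refine h1.congr_deriv ?_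
    have h2 : |x| ^ (p - 2 - 1) * |x| = |x| ^ (p - 2) := by
      rw [← Real.rpow_add_one (abs_ne_zero.2 hx)]; congr 1; ring
    have h3 : (SignType.sign x : ℝ) * x = |x| := sign_mul_self x
    simp only [id]
    rw [← h2]
    linear_combination ((p - 2) * |x| ^ (p - 2 - 1)) * h3

/-! ### Wick polynomials and their hypercontractivity -/

section Wick

variable {ι : Type*}

/-- The Wick polynomial `∑_{i₁, …, iₙ ∈ S} A_{i₁ … iₙ} :X_{i₁} ⋯ X_{iₙ}:`; the symmetric tensor `A`
is given as a function on multisets. -/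
def wickPoly (S : Finset ι) : ℕ → (Multiset ι → ℝ) → (ι → ℝ) → ℝ
  | 0, A, _ => A 0
  | 1, A, X => ∑ i ∈ S, X i * A {i}
  | n + 2, A, X => ∑ i ∈ S, X i * wickPoly S (n + 1) (fun m => A (i ::ₘ m)) X -
      (n + 1) * ∑ i ∈ S, wickPoly S n (fun m => A (i ::ₘ i ::ₘ m)) X

/-- `∑_{i₁, …, iₙ ∈ S} A_{i₁ … iₙ}²`. -/
def wickNorm (S : Finset ι) : ℕ → (Multiset ι → ℝ) → ℝ
  | 0, A => A 0 ^ 2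
  | n + 1, A => ∑ i ∈ S, wickNorm S n (fun m => A (i ::ₘ m))

lemma wickNorm_nonneg (S : Finset ι) (n : ℕ) (A : Multiset ι → ℝ) : 0 ≤ wickNorm S n A := by
  induction n generalizing A with
  | zero => exact sq_nonneg _
  | succ n ih => exact Finset.sum_nonneg fun i _ => ih _

/-- One recursion for all degrees: at n = 0 the truncated index n - 1 comes with the factor 0. -/
lemma wickPoly_succ (S : Finset ι) (n : ℕ) (A : Multiset ι → ℝ) (X : ι → ℝ) :
    wickPoly S (n + 1) A X = ∑ i ∈ S, X i * wickPoly S n (fun m => A (i ::ₘ m)) X -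
      n * ∑ i ∈ S, wickPoly S (n - 1) (fun m => A (i ::ₘ i ::ₘ m)) X := by
  cases n with
  | zero => simp [wickPoly]
  | succ n => simp [wickPoly]

lemma wickPoly_add (S : Finset ι) (n : ℕ) (A B : Multiset ι → ℝ) (X : ι → ℝ) :
    wickPoly S n (fun m => A m + B m) X = wickPoly S n A X + wickPoly S n B X := by
  induction n using Nat.strong_induction_on generalizing A B with
  | _ n ih =>
    cases n with
    | zero => rfl
    | succ n =>
      simp only [wickPoly_succ, ih n (by omega), ih (n - 1) (by omega), mul_add,
        Finset.sum_add_distrib]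
      ring

lemma wickPoly_const_mul (S : Finset ι) (n : ℕ) (c : ℝ) (A : Multiset ι → ℝ) (X : ι → ℝ) :
    wickPoly S n (fun m => c * A m) X = c * wickPoly S n A X := by
  induction n using Nat.strong_induction_on generalizing A with
  | _ n ih =>
    cases n with
    | zero => rfl
    | succ n =>
      simp only [wickPoly_succ, ih n (by omega), ih (n - 1) (by omega), mul_sub, Finset.mul_sum]
      congr 1 <;> refine Finset.sum_congr rfl fun i _ => ?_ <;> ring

lemma wickPoly_zero (S : Finset ι) (n : ℕ) (X : ι → ℝ) : wickPoly S n (fun _ => 0) X = 0 := by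
  simpa using wickPoly_const_mul S n 0 (fun _ => 0) X

open Classical in
/-- Restricting the tensor amounts to restricting the index set. -/
lemma wickPoly_indicator {S T : Finset ι} (hST : S ⊆ T) (n : ℕ) (A : Multiset ι → ℝ) (X : ι → ℝ) :
    wickPoly T n (fun m => if ∀ i ∈ m, i ∈ S then A m else 0) X = wickPoly S n A X := by
  induction n using Nat.strong_induction_on generalizing A with
  | _ n ih =>
    cases n with
    | zero => simp [wickPoly]
    | succ n =>
      have e1 : ∀ i, wickPoly T n (fun m => if ∀ j ∈ i ::ₘ m, j ∈ S then A (i ::ₘ m) else 0) X =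
          if i ∈ S then wickPoly S n (fun m => A (i ::ₘ m)) X else 0 := fun i => by
        split_ifs with hi
        · rw [← ih n (by omega)]; congr 1; funext m; simp [hi]
        · refine (congrArg (fun B => wickPoly T n B X) (funext fun m => ?_)).trans
            (wickPoly_zero T n X)
          simp [hi]
      have e2 : ∀ i, wickPoly T (n - 1)
          (fun m => if ∀ j ∈ i ::ₘ i ::ₘ m, j ∈ S then A (i ::ₘ i ::ₘ m) else 0) X =
          if i ∈ S then wickPoly S (n - 1) (fun m => A (i ::ₘ i ::ₘ m)) X else 0 := fun i => by
        split_ifs with hi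
        · rw [← ih (n - 1) (by omega)]; congr 1; funext m; simp [hi]
        · refine (congrArg (fun B => wickPoly T (n - 1) B X) (funext fun m => ?_)).trans
            (wickPoly_zero T (n - 1) X)
          simp [hi]
      simp only [wickPoly_succ, e1, e2, mul_ite, mul_zero]
      rw [← Finset.sum_filter, ← Finset.sum_filter, Finset.filter_mem_eq_inter,
        Finset.inter_eq_right.2 hST]

open Classical in
-- Differentiating the recursion gives one copy of the lower polynomial from the explicit factor X_i
-- and, by induction, terms that reassemble into n further copies of it. The reassembly exchanges i
-- with the summation index, so it rests on the symmetry of A, which multisets build in.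
lemma hasDerivAt_wickPoly (S : Finset ι) (n : ℕ) (A : Multiset ι → ℝ) {i : ι} (hi : i ∈ S)
    (X : ι → ℝ) (y : ℝ) :
    HasDerivAt (fun y => wickPoly S n A (Function.update X i y))
      (n * wickPoly S (n - 1) (fun m => A (i ::ₘ m)) (Function.update X i y)) y := by
  induction n using Nat.strong_induction_on generalizing A with
  | _ n ih =>
    cases n with
    | zero => simpa [wickPoly] using hasDerivAt_const y (A 0)
    | succ n =>
      have hX : ∀ j, HasDerivAt (fun y => Function.update X i y j) (if j = i then 1 else 0) y := by
        intro j
        split_ifs with h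
        · subst h; simpa using hasDerivAt_id' y
        · simpa [Function.update_of_ne h] using hasDerivAt_const y (X j)
      simp only [wickPoly_succ S n A]
      have h1 := HasDerivAt.fun_sum (u := S) fun j _ =>
        (hX j).mul (ih n (by omega) (fun m => A (j ::ₘ m)))
      have h2 := (HasDerivAt.fun_sum (u := S) fun j _ =>
        ih (n - 1) (by omega) (fun m => A (j ::ₘ j ::ₘ m))).const_mul (n : ℝ)
      refine (h1.sub h2).congr_deriv ?_
      simp only [Finset.sum_add_distrib, ite_mul, one_mul, zero_mul, Finset.sum_ite_eq', hi,
        if_true, Nat.add_sub_cancel]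
      cases n with
      | zero => simp
      | succ n =>
        simp only [Nat.add_sub_cancel, wickPoly_succ S n (fun m => A (i ::ₘ m))]
        have c1 : ∀ j m, A (j ::ₘ i ::ₘ m) = A (i ::ₘ j ::ₘ m) := fun j m => by
          rw [Multiset.cons_swap]
        have c2 : ∀ j m, A (j ::ₘ j ::ₘ i ::ₘ m) = A (i ::ₘ j ::ₘ j ::ₘ m) := fun j m => by
          rw [Multiset.cons_swap j i, Multiset.cons_swap j i]
        simp only [c1, c2]
        have e3 : ∀ j, Function.update X i y j * (((n + 1 : ℕ) : ℝ) * wickPoly S n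
            (fun m => A (i ::ₘ j ::ₘ m)) (Function.update X i y)) = ((n + 1 : ℕ) : ℝ) *
            (Function.update X i y j * wickPoly S n
            (fun m => A (i ::ₘ j ::ₘ m)) (Function.update X i y)) := fun j => by ring
        simp only [e3, ← Finset.mul_sum]
        push_cast
        ring

lemma hasMoments_wickPoly (S : Finset ι) (n : ℕ) (A : Multiset ι → ℝ) :
    HasMoments (wickPoly S n A) (stdGauss ι) := by
  induction n using Nat.strong_induction_on generalizing A with
  | _ n ih =>
    cases n with
    | zero => exact hasMoments_const _
    | succ n =>
      rw [show wickPoly S (n + 1) A = _ from funext (wickPoly_succ S n A)]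
      exact (HasMoments.sum S fun i _ => (hasMoments_eval i).mul (ih n (by omega) _)).sub
        (HasMoments.const_mul _ (HasMoments.sum S fun i _ => ih (n - 1) (by omega) _))

lemma measurable_wickPoly (S : Finset ι) (n : ℕ) (A : Multiset ι → ℝ) :
    Measurable (wickPoly S n A) := by
  induction n using Nat.strong_induction_on generalizing A with
  | _ n ih =>
    cases n with
    | zero => exact measurable_const
    | succ n =>
      rw [show wickPoly S (n + 1) A = _ from funext (wickPoly_succ S n A)]
      exact (Finset.measurable_fun_sum S fun i _ => (measurable_pi_apply i).mul
        (ih n (by omega) _)).sub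
        ((Finset.measurable_fun_sum S fun i _ => ih (n - 1) (by omega) _).const_mul _)

/-- The number operator identity `n E|F|^p = (p - 1) E(|F|^{p-2} |∇F|²)` for Wick polynomials. -/
lemma integral_abs_wickPoly_rpow (S : Finset ι) (n : ℕ) (A : Multiset ι → ℝ) {p : ℝ} (hp : 2 ≤ p) :
    ∫ X, |wickPoly S (n + 1) A X| ^ p ∂(stdGauss ι) =
      (p - 1) * (n + 1) * ∑ i ∈ S, ∫ X, |wickPoly S (n + 1) A X| ^ (p - 2) *
        wickPoly S n (fun m => A (i ::ₘ m)) X ^ 2 ∂(stdGauss ι) := by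
  classical
  set F := wickPoly S (n + 1) A with hF
  let G : ι → (ι → ℝ) → ℝ := fun i => wickPoly S n (fun m => A (i ::ₘ m))
  let L : ι → (ι → ℝ) → ℝ := fun i => wickPoly S (n - 1) (fun m => A (i ::ₘ i ::ₘ m))
  have mF : HasMoments F (stdGauss ι) := hasMoments_wickPoly _ _ _
  have mG : ∀ i, HasMoments (G i) (stdGauss ι) := fun i => hasMoments_wickPoly _ _ _
  have mL : ∀ i, HasMoments (L i) (stdGauss ι) := fun i => hasMoments_wickPoly _ _ _
  have mR : HasMoments (fun X => |F X| ^ (p - 2)) (stdGauss ι) := mF.abs_rpow (by linarith)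
  have mP : HasMoments (fun X => |F X| ^ (p - 2) * F X) (stdGauss ι) := mR.mul mF
  -- One factor F of |F|^p is expanded by the Wick recursion and X_i is integrated by parts. The
  -- derivative falling on G_i gives n L_i, which cancels the contraction term of the recursion
  -- exactly; the derivative of |F|^(p-2) F is what survives.
  have parts : ∀ i ∈ S, ∫ X, X i * (G i X * (|F X| ^ (p - 2) * F X)) ∂(stdGauss ι) =
      ∫ X, (n * (L i X * (|F X| ^ (p - 2) * F X)) +
        (p - 1) * (n + 1) * (|F X| ^ (p - 2) * G i X ^ 2)) ∂(stdGauss ι) := by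
    intro i hi
    refine integral_stdGauss_parts i (fun X y => ?_) ((mG i).mul mP).integrable
      ((hasMoments_eval i).mul ((mG i).mul mP)).integrable
      (((((mL i).mul mP).const_mul _).add ((mR.mul ((mG i).pow 2)).const_mul _)).integrable)
    have d1 := hasDerivAt_wickPoly S n (fun m => A (i ::ₘ m)) hi X y
    have d2 := hasDerivAt_wickPoly S (n + 1) A hi X y
    have d3 := (hasDerivAt_abs_rpow_mul_self hp (F (Function.update X i y))).comp y d2
    refine (d1.mul d3).congr_deriv ?_
    simp only [Function.comp_apply, Nat.add_sub_cancel, hF, G, L]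
    push_cast
    ring
  have e : ∀ X, |F X| ^ p = ∑ i ∈ S, X i * (G i X * (|F X| ^ (p - 2) * F X)) -
      ∑ i ∈ S, n * (L i X * (|F X| ^ (p - 2) * F X)) := by
    intro X
    have h1 : |F X| ^ p = F X * (|F X| ^ (p - 2) * F X) := by
      have : |F X| ^ p = |F X| ^ (p - 2) * |F X| ^ (2 : ℕ) := by
        rw [← Real.rpow_natCast, ← Real.rpow_add' (abs_nonneg _) (by push_cast; linarith)]
        congr 1; push_cast; ring
      rw [this, sq_abs]; ring
    rw [h1]
    nth_rewrite 1 [hF]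
    rw [wickPoly_succ, sub_mul, Finset.sum_mul, mul_assoc, Finset.sum_mul, Finset.mul_sum]
    simp only [mul_assoc, G, L]
  have i1 : ∀ i, Integrable (fun X => X i * (G i X * (|F X| ^ (p - 2) * F X))) (stdGauss ι) :=
    fun i => ((hasMoments_eval i).mul ((mG i).mul mP)).integrable
  have i2 : ∀ i, Integrable (fun X => (n : ℝ) * (L i X * (|F X| ^ (p - 2) * F X))) (stdGauss ι) :=
    fun i => (((mL i).mul mP).const_mul _).integrable
  have i3 : ∀ i, Integrable (fun X => (p - 1) * (n + 1) * (|F X| ^ (p - 2) * G i X ^ 2))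
      (stdGauss ι) := fun i => ((mR.mul ((mG i).pow 2)).const_mul _).integrable
  simp only [e]
  rw [integral_sub (integrable_finsetSum _ fun i _ => i1 i)
    (integrable_finsetSum _ fun i _ => i2 i), integral_finsetSum _ fun i _ => i1 i,
    integral_finsetSum _ fun i _ => i2 i, Finset.sum_congr rfl parts, Finset.mul_sum,
    ← Finset.sum_sub_distrib]
  refine Finset.sum_congr rfl fun i _ => ?_
  rw [integral_add (i2 i) (i3 i), add_sub_cancel_left, integral_const_mul]

/-- Hypercontractivity on the `n`-th Wiener chaos, with the sharp constant. -/
theorem integral_wickPoly_rpow_le (S : Finset ι) (n : ℕ) (A : Multiset ι → ℝ) {p : ℝ}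
    (hp : 2 ≤ p) :
    (∫ X, |wickPoly S n A X| ^ p ∂(stdGauss ι)) ^ (2 / p) ≤
      (p - 1) ^ n * n.factorial * wickNorm S n A := by
  have hp0 : 0 < p := by linarith
  induction n generalizing A with
  | zero =>
    simp only [wickPoly, integral_const, probReal_univ, one_smul, pow_zero, Nat.factorial_zero,
      Nat.cast_one, one_mul, wickNorm]
    rw [← Real.rpow_mul (abs_nonneg _), mul_div_cancel₀ _ hp0.ne', Real.rpow_two, sq_abs]
  | succ n ih =>
    set F := wickPoly S (n + 1) A with hF
    let G : ι → (ι → ℝ) → ℝ := fun i => wickPoly S n (fun m => A (i ::ₘ m))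
    have mF : HasMoments F (stdGauss ι) := hasMoments_wickPoly _ _ _
    have mG : ∀ i, HasMoments (G i) (stdGauss ι) := fun i => hasMoments_wickPoly _ _ _
    set a := ∫ X, |F X| ^ p ∂(stdGauss ι) with ha
    have ha0 : 0 ≤ a := integral_nonneg fun X => by positivity
    have hN := wickNorm_nonneg S (n + 1) A
    -- The argument ends by dividing by a power of a = E|F|^p, so a = 0 is disposed of first.
    rcases ha0.eq_or_lt with h0 | ha1
    · rw [← h0, Real.zero_rpow (by positivity)]
      have : 0 ≤ p - 1 := by linarith
      positivity
    have holder : ∀ i, ∫ X, |F X| ^ (p - 2) * G i X ^ 2 ∂(stdGauss ι) ≤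
        a ^ (1 - 2 / p) * (∫ X, |G i X| ^ p ∂(stdGauss ι)) ^ (2 / p) := by
      intro i
      -- The Hölder exponents are p/(p-2) and p/2, and the first degenerates at p = 2, where both
      -- sides are equal.
      rcases hp.eq_or_lt with h2 | h2
      · rw [← h2]; norm_num
      have hc : (p / (p - 2)).HolderConjugate (p / 2) := by
        rw [Real.holderConjugate_iff]
        constructor
        · rw [lt_div_iff₀ (by linarith)]; linarith
        · rw [inv_div, inv_div]; field_simp; ring
      have h := integral_mul_le_Lp_mul_Lq_of_nonneg (μ := stdGauss ι) hc
        (f := fun X => |F X| ^ (p - 2)) (g := fun X => G i X ^ 2)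
        (Eventually.of_forall fun X => by positivity) (Eventually.of_forall fun X => by positivity)
        (mF.abs_rpow (r := p - 2) (by linarith) (p / (p - 2)).toNNReal)
        ((mG i).pow 2 (p / 2).toNNReal)
      refine h.trans_eq ?_
      have e1 : ∀ X, (|F X| ^ (p - 2)) ^ (p / (p - 2)) = |F X| ^ p := fun X => by
        rw [← Real.rpow_mul (abs_nonneg _)]; congr 1; field_simp [show p - 2 ≠ 0 by linarith]
      have e2 : ∀ X, (G i X ^ 2) ^ (p / 2) = |G i X| ^ p := fun X => by
        rw [← sq_abs, ← Real.rpow_natCast, ← Real.rpow_mul (abs_nonneg _)]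
        congr 1; push_cast; field_simp
      simp only [e1, e2]
      congr 2
      · field_simp
      · field_simp
    have hid := integral_abs_wickPoly_rpow S n A hp
    rw [← hF, ← ha] at hid
    have hp1 : 0 ≤ (p - 1) * (n + 1) := by
      have : 0 ≤ p - 1 := by linarith
      positivity
    -- The number operator identity supplies (p-1)(n+1), Hölder the power of a, and the induction
    -- hypothesis bounds each partial derivative. Cancelling a^(1-2/p) leaves the claim.
    have hle : a ≤ a ^ (1 - 2 / p) * ((p - 1) ^ (n + 1) * (n + 1).factorial * wickNorm S (n + 1) A) := by
      calc a = (p - 1) * (n + 1) * ∑ i ∈ S, ∫ X, |F X| ^ (p - 2) * G i X ^ 2 ∂(stdGauss ι) := hid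
        _ ≤ (p - 1) * (n + 1) * ∑ i ∈ S, a ^ (1 - 2 / p) * ((p - 1) ^ n * n.factorial *
            wickNorm S n (fun m => A (i ::ₘ m))) := by
          refine mul_le_mul_of_nonneg_left (Finset.sum_le_sum fun i _ => (holder i).trans ?_) hp1
          exact mul_le_mul_of_nonneg_left (ih _) (by positivity)
        _ = _ := by
          rw [wickNorm, Nat.factorial_succ, ← Finset.mul_sum, ← Finset.mul_sum]
          push_cast; ring
    have e3 : a = a ^ (1 - 2 / p) * a ^ (2 / p) := by
      rw [← Real.rpow_add ha1]; simp
    nth_rewrite 1 [e3] at hle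
    exact le_of_mul_le_mul_left hle (Real.rpow_pos_of_pos ha1 _)

/-- Hypercontractivity in terms of `L^p` norms. -/
theorem eLpNorm_wickPoly_sq_le (S : Finset ι) (n : ℕ) (A : Multiset ι → ℝ) {p : ℝ} (hp : 2 ≤ p) :
    eLpNorm (wickPoly S n A) (ENNReal.ofReal p) (stdGauss ι) ^ 2 ≤
      ENNReal.ofReal ((p - 1) ^ n * n.factorial * wickNorm S n A) := by
  have hp0 : 0 < p := by linarith
  have hm : MemLp (wickPoly S n A) (ENNReal.ofReal p) (stdGauss ι) :=
    hasMoments_wickPoly S n A p.toNNReal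
  rw [hm.eLpNorm_eq_integral_rpow_norm (by simpa using hp0) (by simp),
    ENNReal.toReal_ofReal hp0.le, ← ENNReal.ofReal_pow (by positivity)]
  refine ENNReal.ofReal_le_ofReal (le_trans (le_of_eq ?_) (integral_wickPoly_rpow_le S n A hp))
  rw [← Real.rpow_natCast, ← Real.rpow_mul (integral_nonneg fun X => by positivity)]
  simp only [Real.norm_eq_abs]
  congr 1
  push_cast
  field_simp

end Wick

/-! ### The free field in independent coordinates -/

/-- The normalized coordinates of the free field. -/
def modes {s : ℝ} (z : Sobolev s) (k : ℤ × ℤ) : ℝ := √(lam k) * z.hartley k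

lemma inner_basis {s : ℝ} (z : Sobolev s) (k : ℤ × ℤ) :
    ⟪Sobolev.basis s k, z⟫ = lam k ^ (s / 2) * z.hartley k := by
  rw [← HilbertBasis.repr_apply_apply, Sobolev.basis_repr]; rfl

lemma modes_eq_inner {s : ℝ} (z : Sobolev s) (k : ℤ × ℤ) :
    modes z k = ⟪(√(lam k) * lam k ^ (-(s / 2))) • Sobolev.basis s k, z⟫ := by
  rw [real_inner_smul_left, inner_basis, modes, mul_assoc, ← mul_assoc (lam k ^ _),
    ← Real.rpow_add (lam_pos k)]
  simp

lemma measurable_modes {s : ℝ} : Measurable (modes : Sobolev s → ℤ × ℤ → ℝ) := by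
  refine measurable_pi_lambda _ fun k => ?_
  simp only [modes_eq_inner]
  fun_prop

/-- The covariance is diagonal in the Hilbert basis. Undoing the weight λ^(-δ/2) of the coordinates,
each Hartley coefficient has variance λ_k⁻¹, which is why `modes` multiplies by √λ_k. -/
lemma covForm_basis (δ : ℝ) (hδ : 0 < δ) (k l : ℤ × ℤ) :
    covForm δ (Sobolev.basis (-δ) k) (Sobolev.basis (-δ) l) =
      if k = l then lam k ^ (-(1 + δ)) else 0 := by
  have e0 : ∀ m, lam m ^ (-δ) *
      (((lam m ^ (-(1 + δ)) : ℝ) * (Sobolev.basis (-δ) k).coeff m) *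
        (Sobolev.basis (-δ) l).coeff (-m)).re =
      lam m ^ (-(1 + δ) + -δ) *
        ((Sobolev.basis (-δ) k).coeff m * (Sobolev.basis (-δ) l).coeff (-m)).re := fun m => by
    rw [Real.rpow_add (lam_pos m), mul_assoc (_ : ℂ), Complex.re_ofReal_mul]
    ring
  have e1 : ∀ k m, (Sobolev.basis (-δ) k).hartley m = if k = m then lam m ^ (δ / 2) else 0 := by
    intro k m
    have h1 := inner_basis (Sobolev.basis (-δ) k) m
    have h2 := orthonormal_iff_ite.1 (Sobolev.basis (-δ)).orthonormal m k
    rw [h1] at h2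
    have h3 : lam m ^ (δ / 2) * lam m ^ (-δ / 2) = 1 := by
      rw [← Real.rpow_add (lam_pos m)]; convert Real.rpow_zero _ using 2; ring
    rw [← one_mul (Sobolev.hartley _ _), ← h3, mul_assoc, h2]
    simp only [eq_comm (a := m), mul_ite, mul_one, mul_zero]
  rw [covForm]
  simp only [e0]
  rw [← Sobolev.tsum_hartley _ _ (by linarith)]
  simp only [e1]
  rw [tsum_eq_single k (fun m hm => by simp [hm.symm])]
  simp only [if_true]
  by_cases h : l = k
  · subst h
    simp only [if_true]
    rw [← Real.rpow_add (lam_pos l), ← Real.rpow_add (lam_pos l)]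
    congr 1; ring
  · simp [h, Ne.symm h]

lemma integral_modes {δ : ℝ} (hδ : 0 < δ) (k : ℤ × ℤ) :
    ∫ z, modes z k ∂(freeField hδ) = 0 := by
  simp only [modes_eq_inner]
  exact (isFreeField_freeField hδ).mean_eq _

lemma integral_modes_mul {δ : ℝ} (hδ : 0 < δ) (k l : ℤ × ℤ) :
    ∫ z, modes z k * modes z l ∂(freeField hδ) = if k = l then 1 else 0 := by
  have h := (isFreeField_freeField hδ).cov_eq (Sobolev.basis (-δ) k) (Sobolev.basis (-δ) l)
  rw [covForm_basis δ hδ] at h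
  simp only [modes_eq_inner, real_inner_smul_left]
  have : ∀ z : Sobolev (-δ), √(lam k) * lam k ^ (-(-δ / 2)) * ⟪Sobolev.basis (-δ) k, z⟫ *
      (√(lam l) * lam l ^ (-(-δ / 2)) * ⟪Sobolev.basis (-δ) l, z⟫) =
      (√(lam k) * lam k ^ (-(-δ / 2)) * (√(lam l) * lam l ^ (-(-δ / 2)))) *
      (⟪Sobolev.basis (-δ) k, z⟫ * ⟪Sobolev.basis (-δ) l, z⟫) := fun z => by ring
  simp only [this]
  rw [integral_const_mul, h]
  split_ifs with hkl
  · subst hkl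
    have hl := lam_pos k
    rw [Real.sqrt_eq_rpow, ← Real.rpow_add hl, ← Real.rpow_add hl, ← Real.rpow_add hl]
    convert Real.rpow_zero _ using 2; ring
  · simp

lemma hasGaussianLaw_modes {δ : ℝ} (hδ : 0 < δ) {ι : Type*} [Finite ι] (c : ι → ℤ × ℤ) :
    HasGaussianLaw (fun z i => modes z (c i)) (freeField hδ) := by
  have := Fintype.ofFinite ι
  have := (isFreeField_freeField hδ).isGaussian
  have h := (IsGaussian.hasGaussianLaw_id (μ := freeField hδ)).map
    (ContinuousLinearMap.pi fun i => innerSL ℝ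
      ((√(lam (c i)) * lam (c i) ^ (-(-δ / 2))) • Sobolev.basis (-δ) (c i)))
  have e : (fun (z : Sobolev (-δ)) i => modes z (c i)) = ⇑(ContinuousLinearMap.pi fun i => innerSL ℝ
      ((√(lam (c i)) * lam (c i) ^ (-(-δ / 2))) • Sobolev.basis (-δ) (c i))) ∘ id := by
    funext z i
    exact modes_eq_inner z (c i)
  rw [e]
  exact h

/-- Under the free field the normalized coordinates are independent standard Gaussian variables. -/
theorem measurePreserving_modes {δ : ℝ} (hδ : 0 < δ) :
    MeasurePreserving modes (freeField hδ) (stdGauss (ℤ × ℤ)) := by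
  have := (isFreeField_freeField hδ).isGaussian
  have hmem : ∀ k, MemLp (fun z => modes z k) 2 (freeField hδ) := fun k =>
    ((hasGaussianLaw_modes hδ (fun _ : Unit => k)).eval ()).memLp_two
  have hcov : ∀ k l, cov[fun z => modes z k, fun z => modes z l; freeField hδ] =
      if k = l then 1 else 0 := fun k l => by
    rw [covariance_eq_sub (hmem k) (hmem l), integral_modes, integral_modes, mul_zero, sub_zero]
    exact integral_modes_mul hδ k l
  -- Each finite subfamily is jointly Gaussian and uncorrelated, hence independent.
  have hind : iIndepFun (fun k z => modes z k) (freeField hδ) := by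
    rw [iIndepFun_iff_finset]
    intro s
    refine HasGaussianLaw.iIndepFun_of_covariance_eq_zero ?_ fun i j hij => ?_
    · exact hasGaussianLaw_modes hδ (fun i : s => (i : ℤ × ℤ))
    · have := hcov i j
      rwa [if_neg (fun h => hij (Subtype.ext h))] at this
  have hmap : ∀ k, (freeField hδ).map (fun z => modes z k) = gaussianReal 0 1 := fun k => by
    have h := ((hasGaussianLaw_modes hδ (fun _ : Unit => k)).eval ()).map_eq_gaussianReal
    have hv := hcov k k
    rw [covariance_self (hmem k).aestronglyMeasurable.aemeasurable, if_pos rfl] at hv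
    rw [h, integral_modes, hv, Real.toNNReal_one]
  refine ⟨measurable_modes, ?_⟩
  have := (iIndepFun_iff_map_fun_eq_infinitePi_map₀ measurable_modes.aemeasurable).1 hind
  simp only [hmap] at this
  exact this

/-! ### Lattice points of the cut-off regions -/

lemma finite_latticePoints {Λ : Set (ℝ × ℝ)} (hΛ : Bornology.IsBounded Λ) :
    {k : ℤ × ℤ | ((k.1 : ℝ), (k.2 : ℝ)) ∈ Λ}.Finite := by
  obtain ⟨R, hR⟩ := hΛ.exists_norm_le
  refine (Set.finite_Icc ((-⌈R⌉, -⌈R⌉) : ℤ × ℤ) (⌈R⌉, ⌈R⌉)).subset fun k hk => ?_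
  have h := hR _ hk
  rw [Prod.norm_def, max_le_iff, Real.norm_eq_abs, Real.norm_eq_abs, abs_le, abs_le] at h
  have hc := Int.le_ceil R
  have aux : ∀ m : ℤ, -R ≤ m → (m : ℝ) ≤ R → -⌈R⌉ ≤ m ∧ m ≤ ⌈R⌉ := fun m h1 h2 => by
    constructor
    · have : ((-⌈R⌉ : ℤ) : ℝ) ≤ m := by push_cast; linarith
      exact_mod_cast this
    · exact_mod_cast h2.trans hc
  have h1 := aux k.1 h.1.1 h.1.2
  have h2 := aux k.2 h.2.1 h.2.2
  exact ⟨⟨h1.1, h2.1⟩, ⟨h1.2, h2.2⟩⟩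

lemma mem_latticePoints {Λ : Set (ℝ × ℝ)} (hΛ : Bornology.IsBounded Λ) {k : ℤ × ℤ} :
    k ∈ latticePoints Λ ↔ ((k.1 : ℝ), (k.2 : ℝ)) ∈ Λ := by
  rw [latticePoints, dif_pos (finite_latticePoints hΛ), Set.Finite.mem_toFinset]
  rfl

namespace IsCutoff

variable {Λ : Set (ℝ × ℝ)}

lemma isBounded_smul (hΛ : IsCutoff Λ) (c : ℝ) : Bornology.IsBounded (c • Λ) := (hΛ.isCompact.smul c).isBounded

lemma neg_mem_latticePoints (hΛ : IsCutoff Λ) (c : ℝ) {k : ℤ × ℤ} (hk : k ∈ latticePoints (c • Λ)) :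
    -k ∈ latticePoints (c • Λ) := by
  rw [mem_latticePoints (hΛ.isBounded_smul c)] at hk ⊢
  obtain ⟨x, hx, hxk⟩ := hk
  refine ⟨-x, by rw [← hΛ.neg_eq]; simpa using hx, ?_⟩
  simp only at hxk
  simp [hxk]

/-- This includes c = 0, so ρ_{NΛ} > 0 for every N and the Hermite rescaling is legitimate from the
first term of the sequence on. -/
lemma zero_mem_latticePoints (hΛ : IsCutoff Λ) (c : ℝ) : 0 ∈ latticePoints (c • Λ) := by
  rw [mem_latticePoints (hΛ.isBounded_smul c)]
  exact ⟨0, interior_subset hΛ.zero_mem, by simp; rfl⟩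

/-- k/N tends to 0, an interior point of Λ. The sets NΛ need not increase with N; it is enough that
every mode is eventually kept. -/
lemma eventually_mem_latticePoints (hΛ : IsCutoff Λ) (k : ℤ × ℤ) :
    ∀ᶠ N : ℕ in atTop, k ∈ latticePoints ((N : ℝ) • Λ) := by
  let x : ℝ × ℝ := ((k.1 : ℝ), (k.2 : ℝ))
  have h1 : Tendsto (fun N : ℕ => (N : ℝ)⁻¹ • x) atTop (𝓝 0) := by
    simpa using (tendsto_inv_atTop_nhds_zero_nat (𝕜 := ℝ)).smul_const x
  filter_upwards [h1.eventually (mem_interior_iff_mem_nhds.1 hΛ.zero_mem), eventually_gt_atTop 0]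
    with N hN hN0
  rw [mem_latticePoints (hΛ.isBounded_smul _)]
  refine ⟨_, hN, ?_⟩
  have : (N : ℝ) ≠ 0 := by exact_mod_cast hN0.ne'
  change (N : ℝ) • (N : ℝ)⁻¹ • x = x
  rw [smul_inv_smul₀ this]

end IsCutoff

/-! ### Real modes -/

/-- The real mode `(cos k·x - sin k·x) / 2π`. -/
def realMode (k : ℤ × ℤ) (x : Torus) : ℝ := (expo k x).re - (expo k x).im

/-- The real mode, scaled by the standard deviation of the corresponding coordinate of the free
field. -/
def scaledMode (k : ℤ × ℤ) (x : Torus) : ℝ := (√(lam k))⁻¹ * realMode k x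

lemma continuous_realMode (k : ℤ × ℤ) : Continuous (realMode k) := by
  have := continuous_expo k
  unfold realMode
  fun_prop

lemma continuous_scaledMode (k : ℤ × ℤ) : Continuous (scaledMode k) :=
  continuous_const.mul (continuous_realMode k)

lemma sum_eq_zero_of_odd {S : Finset (ℤ × ℤ)} (hS : ∀ k ∈ S, -k ∈ S) {f : ℤ × ℤ → ℝ}
    (hf : ∀ k, f (-k) = -f k) : ∑ k ∈ S, f k = 0 := by
  have h : ∑ k ∈ S, f k = ∑ k ∈ S, f (-k) :=
    Finset.sum_nbij' (fun k => -k) (fun k => -k) hS hS (by simp) (by simp) (by simp)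
  simp only [hf, Finset.sum_neg_distrib] at h
  linarith

/-- Write (Re ẑ + Im ẑ)(Re e - Im e) = Re(ẑ e) + (Im ẑ Re e - Re ẑ Im e). The last bracket is odd in
k and cancels over a symmetric set. -/
lemma sum_scaledMode_mul_modes {s : ℝ} {S : Finset (ℤ × ℤ)} (hS : ∀ k ∈ S, -k ∈ S) (z : Sobolev s)
    (x : Torus) :
    ∑ k ∈ S, modes z k * scaledMode k x = (∑ k ∈ S, z.coeff k * expo k x).re := by
  rw [← sub_eq_zero, Complex.re_sum, ← Finset.sum_sub_distrib]
  rw [← sum_eq_zero_of_odd hS (f := fun k => (z.coeff k).im * (expo k x).re -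
    (z.coeff k).re * (expo k x).im) fun k => by
      rw [z.coeff_neg_index, expo_neg]; simp; ring]
  refine Finset.sum_congr rfl fun k _ => ?_
  have : √(lam k) ≠ 0 := (Real.sqrt_pos.2 (lam_pos k)).ne'
  simp only [modes, scaledMode, realMode, Sobolev.hartley, Complex.mul_re]
  field_simp
  ring

/-- (Re e - Im e)² is |e|² minus a cross term odd in k. Thus the pointwise variance does not depend
on x, which makes Wick ordering by the constant ρ_Λ the right one. -/
lemma sum_scaledMode_sq {S : Finset (ℤ × ℤ)} (hS : ∀ k ∈ S, -k ∈ S) (x : Torus) :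
    ∑ k ∈ S, scaledMode k x ^ 2 = ((2 * Real.pi)⁻¹ * √(∑ k ∈ S, (lam k)⁻¹)) ^ 2 := by
  rw [mul_pow, Real.sq_sqrt (Finset.sum_nonneg fun k _ => (inv_pos.2 (lam_pos k)).le),
    Finset.mul_sum, ← sub_eq_zero, ← Finset.sum_sub_distrib]
  rw [← sum_eq_zero_of_odd hS (f := fun k => -2 * (lam k)⁻¹ * ((expo k x).re * (expo k x).im))
    fun k => by rw [lam_neg, expo_neg]; simp]
  refine Finset.sum_congr rfl fun k _ => ?_
  have h : (expo k x).re ^ 2 + (expo k x).im ^ 2 = (2 * Real.pi)⁻¹ ^ 2 := by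
    rw [← norm_expo k x, Complex.sq_norm, Complex.normSq_apply]; ring
  rw [scaledMode, mul_pow, inv_pow, Real.sq_sqrt (lam_pos k).le, ← h, realMode]
  ring

/-! ### Wick powers as Wick polynomials -/

/-- Turns the recursion He_{n+1} = X He_n - He_n' into the three-term recursion that Wick
polynomials share. -/
lemma derivative_hermite_succ (n : ℕ) :
    Polynomial.derivative (Polynomial.hermite (n + 1)) = (n + 1 : ℤ) • Polynomial.hermite n := by
  induction n with
  | zero => simp [Polynomial.hermite_succ]
  | succ n ih =>
    rw [Polynomial.hermite_succ (n + 1), Polynomial.derivative_sub, Polynomial.derivative_mul,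
      Polynomial.derivative_X, one_mul, ih, Polynomial.derivative_smul]
    rw [mul_smul_comm, add_sub_assoc, ← smul_sub, ← Polynomial.hermite_succ n]
    push_cast
    module

/-- The Hermite polynomial of variance `c`. -/
def hermiteVar (c : ℝ) : ℕ → ℝ → ℝ
  | 0, _ => 1
  | 1, y => y
  | n + 2, y => y * hermiteVar c (n + 1) y - (n + 1) * c * hermiteVar c n y

lemma hermiteVar_succ (c : ℝ) (n : ℕ) (y : ℝ) :
    hermiteVar c (n + 1) y = y * hermiteVar c n y - n * c * hermiteVar c (n - 1) y := by
  cases n <;> simp [hermiteVar]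

lemma hermiteVar_sq {ρ : ℝ} (hρ : ρ ≠ 0) (n : ℕ) (y : ℝ) :
    hermiteVar (ρ ^ 2) n y = ρ ^ n * Polynomial.aeval (ρ⁻¹ * y) (Polynomial.hermite n) := by
  induction n using Nat.strong_induction_on with
  | _ n ih =>
    match n with
    | 0 => simp [hermiteVar]
    | 1 => simp [hermiteVar, hρ]
    | n + 2 =>
      rw [hermiteVar, ih n (by omega), ih (n + 1) (by omega), Polynomial.hermite_succ (n + 1),
        derivative_hermite_succ]
      simp only [map_sub, map_mul, Polynomial.aeval_X, zsmul_eq_mul]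
      push_cast
      simp only [map_add, map_natCast, map_one]
      field_simp
      ring

lemma continuous_hermiteVar {T : Type*} [TopologicalSpace T] {c y : T → ℝ} (hc : Continuous c)
    (hy : Continuous y) (n : ℕ) : Continuous fun t => hermiteVar (c t) n (y t) := by
  induction n using Nat.strong_induction_on with
  | _ n ih =>
    match n with
    | 0 => simpa [hermiteVar] using continuous_const
    | 1 => simpa [hermiteVar] using hy
    | n + 2 =>
      have h1 := ih n (by omega)
      have h2 := ih (n + 1) (by omega)
      simp only [hermiteVar]
      fun_prop

lemma integrable_mul_of_continuous {𝕜 : Type*} [RCLike 𝕜] {g φ : Torus → 𝕜}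
    (hg : Integrable g) (hφ : Continuous φ) : Integrable fun x => g x * φ x := by
  obtain ⟨C, hC⟩ := isCompact_univ.exists_bound_of_continuousOn hφ.continuousOn
  exact hg.mul_bdd hφ.aestronglyMeasurable (Eventually.of_forall fun x => hC x trivial)

/-- The symmetric tensor `∫ g(x) ∏_{k ∈ m} v_k(x) dx` for the scaled modes `v_k`. -/
def testTensor (g : Torus → ℝ) (m : Multiset (ℤ × ℤ)) : ℝ :=
  ∫ x, g x * (m.map fun k => scaledMode k x).prod

lemma testTensor_cons (g : Torus → ℝ) (k : ℤ × ℤ) (m : Multiset (ℤ × ℤ)) :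
    testTensor g (k ::ₘ m) = testTensor (fun x => g x * scaledMode k x) m := by
  simp [testTensor, mul_assoc]

/-- With variance ∑ v_k² and argument ∑ X_k v_k, the three-term Hermite recursion integrated against
g is the Wick recursion, the factors v_k and v_k² being absorbed into g. The induction therefore
runs over all integrable g at once. -/
lemma integral_hermiteVar {g : Torus → ℝ} (hg : Integrable g) (S : Finset (ℤ × ℤ)) (n : ℕ)
    (X : ℤ × ℤ → ℝ) :
    ∫ x, g x * hermiteVar (∑ k ∈ S, scaledMode k x ^ 2) n (∑ k ∈ S, X k * scaledMode k x) =
      wickPoly S n (testTensor g) X := by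
  have hc : Continuous fun x => ∑ k ∈ S, scaledMode k x ^ 2 :=
    continuous_finsetSum _ fun k _ => (continuous_scaledMode k).pow 2
  have hy : Continuous fun x => ∑ k ∈ S, X k * scaledMode k x :=
    continuous_finsetSum _ fun k _ => continuous_const.mul (continuous_scaledMode k)
  induction n using Nat.strong_induction_on generalizing g with
  | _ n ih =>
    cases n with
    | zero => simp [hermiteVar, wickPoly, testTensor]
    | succ n =>
      have hgk : ∀ {g : Torus → ℝ}, Integrable g → ∀ k, Integrable fun x => g x * scaledMode k x :=
        fun h k => integrable_mul_of_continuous h (continuous_scaledMode k)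
      have hH := continuous_hermiteVar hc hy
      simp only [wickPoly_succ, testTensor_cons]
      have e1 : ∀ k, wickPoly S n (fun m => testTensor (fun x => g x * scaledMode k x) m) X = _ :=
        fun k => (ih n (by omega) (hgk hg k)).symm
      have e2 : ∀ k, wickPoly S (n - 1)
          (fun m => testTensor (fun x => g x * scaledMode k x * scaledMode k x) m) X = _ :=
        fun k => (ih (n - 1) (by omega) (hgk (hgk hg k) k)).symm
      simp only [e1, e2, ← integral_const_mul]
      rw [← integral_finsetSum _ fun k _ =>
          (integrable_mul_of_continuous (hgk hg k) (hH n)).const_mul _,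
        ← integral_finsetSum _ fun k _ =>
          (integrable_mul_of_continuous (hgk (hgk hg k) k) (hH (n - 1))), ← integral_const_mul,
        ← integral_sub (integrable_finsetSum _ fun k _ =>
          (integrable_mul_of_continuous (hgk hg k) (hH n)).const_mul _)
          ((integrable_finsetSum _ fun k _ =>
          (integrable_mul_of_continuous (hgk (hgk hg k) k) (hH (n - 1)))).const_mul _)]
      congr 1
      funext x
      rw [hermiteVar_succ]
      have a1 : ∀ k, X k * (g x * scaledMode k x * hermiteVar (∑ k ∈ S, scaledMode k x ^ 2) n
          (∑ k ∈ S, X k * scaledMode k x)) = (X k * scaledMode k x) *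
          (g x * hermiteVar (∑ k ∈ S, scaledMode k x ^ 2) n
          (∑ k ∈ S, X k * scaledMode k x)) := fun k => by ring
      have a2 : ∀ k, g x * scaledMode k x * scaledMode k x *
          hermiteVar (∑ k ∈ S, scaledMode k x ^ 2) (n - 1) (∑ k ∈ S, X k * scaledMode k x) =
          scaledMode k x ^ 2 * (g x * hermiteVar (∑ k ∈ S, scaledMode k x ^ 2) (n - 1)
          (∑ k ∈ S, X k * scaledMode k x)) := fun k => by ring
      simp only [a1, a2, ← Finset.sum_mul]
      ring

lemma rho_pos {Λ : Set (ℝ × ℝ)} (h : 0 ∈ latticePoints Λ) : 0 < rho Λ := by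
  have h1 : 0 < ∑ k ∈ latticePoints Λ, (lam k)⁻¹ :=
    Finset.sum_pos (fun k _ => inv_pos.2 (lam_pos k)) ⟨0, h⟩
  have := Real.pi_pos
  unfold rho
  positivity

/-- A regularized Wick power, tested against an integrable function, is a Wick polynomial in the
normalized coordinates of the field. -/
lemma integral_wick_mul {s : ℝ} {Λ : Set (ℝ × ℝ)} (h0 : 0 ∈ latticePoints Λ)
    (hneg : ∀ k ∈ latticePoints Λ, -k ∈ latticePoints Λ) (n : ℕ) {g : Torus → ℝ}
    (hg : Integrable g) (z : Sobolev s) :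
    ∫ x, wick n Λ z x * g x = wickPoly (latticePoints Λ) n (testTensor g) (modes z) := by
  rw [← integral_hermiteVar hg]
  congr 1
  funext x
  have h1 : wick n Λ z x = √(n.factorial) * rho Λ ^ n * hermiteH n ((rho Λ)⁻¹ * proj Λ z x) := rfl
  have h2 : √(n.factorial : ℝ) ≠ 0 := by positivity
  rw [sum_scaledMode_sq hneg, sum_scaledMode_mul_modes hneg, ← rho, ← proj,
    hermiteVar_sq (rho_pos h0).ne', h1, hermiteH]
  field_simp

/-! ### Norms of infinite symmetric tensors -/

section TensorNorm

variable {ι E : Type*} [NormedAddCommGroup E]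

/-- `∑_{i₁, …, iₙ} |A_{i₁ … iₙ}|²`. -/
def tensorNorm : ℕ → (Multiset ι → E) → ℝ≥0∞
  | 0, A => ‖A 0‖ₑ ^ 2
  | n + 1, A => ∑' i, tensorNorm n (fun m => A (i ::ₘ m))

lemma tensorNorm_mono {F : Type*} [NormedAddCommGroup F] (n : ℕ) {A : Multiset ι → E}
    {B : Multiset ι → F} (h : ∀ m, ‖A m‖ₑ ≤ ‖B m‖ₑ) : tensorNorm n A ≤ tensorNorm n B := by
  induction n generalizing A B with
  | zero => exact pow_le_pow_left' (h 0) 2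
  | succ n ih => exact ENNReal.tsum_le_tsum fun i => ih fun m => h _

lemma tensorNorm_const_mul (n : ℕ) (c : ℂ) (A : Multiset ι → ℂ) :
    tensorNorm n (fun m => c * A m) = ‖c‖ₑ ^ 2 * tensorNorm n A := by
  induction n generalizing A with
  | zero => simp [tensorNorm, enorm_mul, mul_pow]
  | succ n ih => simp only [tensorNorm, ih, ENNReal.tsum_mul_left]

/-- Serves the change from real modes to characters, which preserves square sums only over the pair
k, -k jointly. -/
lemma tensorNorm_add_eq_add (n : ℕ) {A B C D : Multiset ι → E}
    (h : ∀ m, ‖A m‖ₑ ^ 2 + ‖B m‖ₑ ^ 2 = ‖C m‖ₑ ^ 2 + ‖D m‖ₑ ^ 2) :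
    tensorNorm n A + tensorNorm n B = tensorNorm n C + tensorNorm n D := by
  induction n generalizing A B C D with
  | zero => exact h 0
  | succ n ih =>
    simp only [tensorNorm, ← ENNReal.tsum_add]
    congr 1; funext i
    exact ih fun m => h _

lemma ofReal_wickNorm_le (S : Finset ι) (n : ℕ) (A : Multiset ι → ℝ) :
    ENNReal.ofReal (wickNorm S n A) ≤ tensorNorm n A := by
  induction n generalizing A with
  | zero =>
    simp only [wickNorm, tensorNorm, Real.enorm_eq_ofReal_abs]
    rw [← ENNReal.ofReal_pow (abs_nonneg _), sq_abs]
  | succ n ih =>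
    rw [wickNorm, ENNReal.ofReal_sum_of_nonneg fun i _ => wickNorm_nonneg _ _ _]
    exact (Finset.sum_le_sum fun i _ => ih _).trans (ENNReal.sum_le_tsum S)

lemma tendsto_tsum_zero_of_dominated {X J : Type*} [Countable J] {l : Filter X}
    [l.IsCountablyGenerated] {f : X → J → ℝ≥0∞} {b : J → ℝ≥0∞} (hb : ∑' j, b j ≠ ⊤)
    (h : ∀ x j, f x j ≤ b j) (hlim : ∀ j, Tendsto (fun x => f x j) l (𝓝 0)) :
    Tendsto (fun x => ∑' j, f x j) l (𝓝 0) := by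
  let _ : MeasurableSpace J := ⊤
  have : MeasurableSingletonClass J := ⟨fun _ => trivial⟩
  simp only [← lintegral_count] at hb ⊢
  have := tendsto_lintegral_filter_of_dominated_convergence (μ := Measure.count) (l := l)
    (F := f) (f := fun _ => 0) b (Eventually.of_forall fun x => measurable_from_top)
    (Eventually.of_forall fun x => Eventually.of_forall fun j => h x j) hb
    (Eventually.of_forall hlim)
  simpa using this

/-- Dominated convergence, one index at a time. The multipliers u will be differences of two
truncation indicators. -/
lemma tendsto_tensorNorm_mul [Countable ι] {X : Type*} {l : Filter X} [l.IsCountablyGenerated]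
    (n : ℕ) {A : Multiset ι → ℝ} (hA : tensorNorm n A ≠ ⊤) {u : X → Multiset ι → ℝ}
    (hu : ∀ x m, ‖u x m‖ₑ ≤ 1) (hlim : ∀ m, Tendsto (fun x => u x m) l (𝓝 0)) :
    Tendsto (fun x => tensorNorm n (fun m => u x m * A m)) l (𝓝 0) := by
  induction n generalizing A u with
  | zero =>
    have h := ((ENNReal.continuous_pow 2).tendsto _).comp ((hlim 0).mul_const (A 0)).enorm
    simpa [tensorNorm, Function.comp_def] using h
  | succ n ih =>
    refine tendsto_tsum_zero_of_dominated hA (fun x i => ?_) fun i => ?_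
    · refine tensorNorm_mono n fun m => ?_
      rw [enorm_mul]
      exact mul_le_of_le_one_left zero_le (hu x _)
    · exact ih (ENNReal.ne_top_of_tsum_ne_top hA i) (fun x m => hu x _) fun m => hlim _

end TensorNorm

/-! ### Tensors of test functions in Fourier space -/

/-- The complex version of `testTensor`. -/
def testTensorC (g : Torus → ℂ) (m : Multiset (ℤ × ℤ)) : ℂ :=
  ∫ x, g x * ((m.map fun k => scaledMode k x).prod : ℝ)

lemma testTensorC_cons (g : Torus → ℂ) (k : ℤ × ℤ) (m : Multiset (ℤ × ℤ)) :
    testTensorC g (k ::ₘ m) = testTensorC (fun x => g x * scaledMode k x) m := by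
  simp [testTensorC, mul_assoc]

lemma testTensorC_const_mul (c : ℂ) (g : Torus → ℂ) (m : Multiset (ℤ × ℤ)) :
    testTensorC (fun x => c * g x) m = c * testTensorC g m := by
  simp only [testTensorC, mul_assoc, integral_const_mul]

lemma continuous_prod_scaledMode (m : Multiset (ℤ × ℤ)) :
    Continuous fun x => (m.map fun k => scaledMode k x).prod :=
  continuous_multiset_prod m fun k _ => continuous_scaledMode k

lemma testTensorC_add {f g : Torus → ℂ} (hf : Integrable f) (hg : Integrable g)
    (m : Multiset (ℤ × ℤ)) :
    testTensorC (fun x => f x + g x) m = testTensorC f m + testTensorC g m := by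
  have hc : Continuous fun x => (((m.map fun k => scaledMode k x).prod : ℝ) : ℂ) :=
    Complex.continuous_ofReal.comp (continuous_prod_scaledMode m)
  simp only [testTensorC, add_mul]
  exact integral_add (integrable_mul_of_continuous hf hc) (integrable_mul_of_continuous hg hc)

lemma testTensorC_ofReal (g : Torus → ℝ) (m : Multiset (ℤ × ℤ)) :
    testTensorC (fun x => (g x : ℂ)) m = testTensor g m := by
  simp only [testTensorC, testTensor, ← Complex.ofReal_mul]
  exact integral_complex_ofReal

lemma realMode_eq (k : ℤ × ℤ) (x : Torus) : (realMode k x : ℂ) =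
    (1 + Complex.I) / 2 * expo k x + (1 - Complex.I) / 2 * expo (-k) x := by
  rw [expo_neg, realMode]
  apply Complex.ext <;> simp <;> ring

lemma scaledMode_eq (k : ℤ × ℤ) (x : Torus) : (scaledMode k x : ℂ) =
    ((√(lam k))⁻¹ : ℝ) * ((1 + Complex.I) / 2 * expo k x + (1 - Complex.I) / 2 * expo (-k) x) := by
  rw [scaledMode, Complex.ofReal_mul, realMode_eq]

/-- The symmetric matrix with diagonal entries (1+i)/2 and off-diagonal entries (1-i)/2 is unitary.
It relates the real modes ±k to the characters ±k. -/
lemma norm_sq_rotate (P Q : ℂ) :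
    ‖(1 + Complex.I) / 2 * P + (1 - Complex.I) / 2 * Q‖ ^ 2 +
      ‖(1 + Complex.I) / 2 * Q + (1 - Complex.I) / 2 * P‖ ^ 2 = ‖P‖ ^ 2 + ‖Q‖ ^ 2 := by
  simp only [Complex.sq_norm, Complex.normSq_apply]
  simp
  ring

lemma testTensorC_mul_scaledMode {g : Torus → ℂ} (hg : Integrable g) (k : ℤ × ℤ)
    (m : Multiset (ℤ × ℤ)) :
    testTensorC (fun x => g x * scaledMode k x) m = ((√(lam k))⁻¹ : ℝ) *
      ((1 + Complex.I) / 2 * testTensorC (fun x => g x * expo k x) m +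
        (1 - Complex.I) / 2 * testTensorC (fun x => g x * expo (-k) x) m) := by
  have hi : ∀ k, Integrable fun x => g x * expo k x := fun k =>
    integrable_mul_of_continuous hg (continuous_expo k)
  rw [← testTensorC_const_mul, ← testTensorC_const_mul, ← testTensorC_add ((hi k).const_mul _)
    ((hi (-k)).const_mul _), ← testTensorC_const_mul]
  congr 1; funext x
  rw [scaledMode_eq]
  ring

/-- Contracting with real modes or with characters gives the same total, since the passage is
unitary on each pair ±k and λ is even. Summing over k and over -k doubles both sides and avoids
choosing half of the lattice. -/
lemma tensorNorm_testTensorC_succ {g : Torus → ℂ} (hg : Integrable g) (n : ℕ) :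
    tensorNorm (n + 1) (testTensorC g) = ∑' k, ENNReal.ofReal (lam k)⁻¹ *
      tensorNorm n (testTensorC fun x => g x * expo k x) := by
  set a : ℤ × ℤ → ℝ≥0∞ := fun k => tensorNorm n (testTensorC fun x => g x * scaledMode k x) with ha
  set b : ℤ × ℤ → ℝ≥0∞ := fun k => ENNReal.ofReal (lam k)⁻¹ *
    tensorNorm n (testTensorC fun x => g x * expo k x) with hb
  have h1 : tensorNorm (n + 1) (testTensorC g) = ∑' k, a k := by
    simp only [tensorNorm, testTensorC_cons, ha]
  have hbk : ∀ k, b k = tensorNorm n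
      (fun m => (((√(lam k))⁻¹ : ℝ) : ℂ) * testTensorC (fun x => g x * expo k x) m) := fun k => by
    rw [tensorNorm_const_mul, ← ofReal_norm, Complex.norm_real, Real.norm_of_nonneg (by positivity),
      ← ENNReal.ofReal_pow (by positivity), inv_pow, Real.sq_sqrt (lam_pos k).le]
  have hab : ∀ k, a k + a (-k) = b k + b (-k) := fun k => by
    rw [hbk, hbk]
    refine tensorNorm_add_eq_add n fun m => ?_
    rw [testTensorC_mul_scaledMode hg, testTensorC_mul_scaledMode hg, lam_neg, neg_neg]
    simp only [enorm_mul, mul_pow, ← mul_add]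
    congr 1
    simp only [← ofReal_norm]
    rw [← ENNReal.ofReal_pow (norm_nonneg _), ← ENNReal.ofReal_pow (norm_nonneg _),
      ← ENNReal.ofReal_pow (norm_nonneg _), ← ENNReal.ofReal_pow (norm_nonneg _),
      ← ENNReal.ofReal_add (by positivity) (by positivity),
      ← ENNReal.ofReal_add (by positivity) (by positivity), norm_sq_rotate]
  have hneg : ∀ f : ℤ × ℤ → ℝ≥0∞, ∑' k, f (-k) = ∑' k, f k := fun f =>
    (Equiv.neg (ℤ × ℤ)).tsum_eq f
  have h2 : 2 * ∑' k, a k = 2 * ∑' k, b k := by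
    rw [two_mul, two_mul]
    nth_rewrite 2 [← hneg a]
    nth_rewrite 2 [← hneg b]
    rw [← ENNReal.tsum_add, ← ENNReal.tsum_add]
    congr 1; funext k; exact hab k
  rw [h1]
  exact (ENNReal.mul_right_inj (by norm_num) (by norm_num)).1 h2

lemma expo_mul_expo (k l : ℤ × ℤ) (x : Torus) :
    expo k x * expo l x = (2 * Real.pi : ℂ)⁻¹ * expo (k + l) x := by
  simp only [expo, Prod.fst_add, Prod.snd_add, fourier_add]
  ring

/-- The squared Fourier coefficients `|∫ g e_l dx|²`. -/
def fourierSq (g : Torus → ℂ) (l : ℤ × ℤ) : ℝ≥0∞ := ‖∫ x, g x * expo l x‖ₑ ^ 2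

/-- Since e_l e_k = (2π)⁻¹ e_{l+k}, each further index shifts the frequency by k with weight
λ_k⁻¹/(4π²), which is one application of `latticeConv`. -/
lemma tensorNorm_testTensorC_mul_expo {g : Torus → ℂ} (hg : Integrable g) (n : ℕ) (l : ℤ × ℤ) :
    tensorNorm n (testTensorC fun x => g x * expo l x) =
      ENNReal.ofReal (4 * Real.pi ^ 2)⁻¹ ^ n * latticeConv^[n] (fourierSq g) l := by
  induction n generalizing l with
  | zero => simp [tensorNorm, testTensorC, fourierSq]
  | succ n ih =>
    have hi : ∀ k, Integrable fun x => g x * expo k x := fun k =>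
      integrable_mul_of_continuous hg (continuous_expo k)
    rw [tensorNorm_testTensorC_succ (hi l), Function.iterate_succ_apply', latticeConv,
      ← ENNReal.tsum_mul_left]
    congr 1; funext k
    have e : (fun x => g x * expo l x * expo k x) =
        fun x => (2 * Real.pi : ℂ)⁻¹ * (g x * expo (l + k) x) := by
      funext x; rw [mul_assoc, expo_mul_expo]; ring
    have e2 : testTensorC (fun x => (2 * Real.pi : ℂ)⁻¹ * (g x * expo (l + k) x)) =
        fun m => (2 * Real.pi : ℂ)⁻¹ * testTensorC (fun x => g x * expo (l + k) x) m :=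
      funext fun m => testTensorC_const_mul _ _ _
    have e3 : ‖(2 * Real.pi : ℂ)⁻¹‖ₑ ^ 2 = ENNReal.ofReal (4 * Real.pi ^ 2)⁻¹ := by
      rw [← ofReal_norm, ← ENNReal.ofReal_pow (norm_nonneg _)]
      congr 1
      simp [abs_of_pos Real.pi_pos]
      ring
    rw [e, e2, tensorNorm_const_mul, ih, e3, pow_succ]
    ring

/-- The tensor norm of a test function is a convolution power evaluated in Fourier space. -/
theorem tensorNorm_testTensor {g : Torus → ℝ} (hg : Integrable g) (n : ℕ) :
    tensorNorm n (testTensor g) = ENNReal.ofReal (4 * Real.pi ^ 2) *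
      (ENNReal.ofReal (4 * Real.pi ^ 2)⁻¹ ^ n *
        latticeConv^[n] (fourierSq fun x => (g x : ℂ)) 0) := by
  have hπ := Real.pi_pos
  have hgC : Integrable fun x => (g x : ℂ) := hg.ofReal
  rw [← tensorNorm_testTensorC_mul_expo hgC n 0]
  have e0 : ∀ x, expo 0 x = (2 * Real.pi : ℂ)⁻¹ := fun x => by simp [expo]
  have e1 : tensorNorm n (testTensor g) = tensorNorm n (testTensorC fun x => (g x : ℂ)) := by
    apply le_antisymm <;> refine tensorNorm_mono n fun m => ?_ <;>
      rw [testTensorC_ofReal, ← ofReal_norm, ← ofReal_norm, Complex.norm_real]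
  -- The constant character e_0 = (2π)⁻¹ is inserted to start the recursion at frequency 0; this is
  -- the source of the prefactor 4π².
  have e2 : testTensorC (fun x => (g x : ℂ)) = fun m => (2 * Real.pi : ℂ) *
      testTensorC (fun x => (g x : ℂ) * expo 0 x) m := by
    funext m
    rw [← testTensorC_const_mul]
    congr 1; funext x
    rw [e0]
    have : (Real.pi : ℂ) ≠ 0 := by exact_mod_cast hπ.ne'
    field_simp
  rw [e1, e2, tensorNorm_const_mul]
  congr 1
  rw [← ofReal_norm, ← ENNReal.ofReal_pow (norm_nonneg _)]
  congr 1
  simp [abs_of_pos Real.pi_pos]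
  ring

/-! ### Growth of the tensor norms -/

/-- The test function whose integral against `f` is the `j`-th coordinate of `f` in `H^{-α}`. -/
def sobolevMode (α : ℝ) (j : ℤ × ℤ) (x : Torus) : ℝ := lam j ^ (-α / 2) * realMode j x

lemma continuous_sobolevMode (α : ℝ) (j : ℤ × ℤ) : Continuous (sobolevMode α j) :=
  continuous_const.mul (continuous_realMode j)

lemma integrable_sobolevMode (α : ℝ) (j : ℤ × ℤ) : Integrable (sobolevMode α j) :=
  (continuous_sobolevMode α j).integrable_of_hasCompactSupport (HasCompactSupport.of_compactSpace _)

lemma integral_expo_mul_expo (j l : ℤ × ℤ) :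
    ∫ x, expo j x * expo l x = if j = -l then 1 else 0 := by
  have := pairing_expo j (-l)
  rwa [neg_neg] at this

lemma fourierSq_sobolevMode_le (α : ℝ) (j l : ℤ × ℤ) :
    fourierSq (fun x => (sobolevMode α j x : ℂ)) l ≤ ENNReal.ofReal (lam j ^ (-α)) *
      ((if j = -l then 1 else 0) + (if j = l then 1 else 0)) := by
  have hi : ∀ k, Integrable fun x => expo k x * expo l x := fun k =>
    integrable_of_continuous ((continuous_expo k).mul (continuous_expo l))
  have e1 : ∫ x, (sobolevMode α j x : ℂ) * expo l x = (lam j ^ (-α / 2) : ℝ) *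
      ((1 + Complex.I) / 2 * (if j = -l then 1 else 0) +
        (1 - Complex.I) / 2 * (if j = l then 1 else 0)) := by
    have : ∀ x, (sobolevMode α j x : ℂ) * expo l x = (lam j ^ (-α / 2) : ℝ) *
        ((1 + Complex.I) / 2 * (expo j x * expo l x) +
          (1 - Complex.I) / 2 * (expo (-j) x * expo l x)) := fun x => by
      rw [sobolevMode, Complex.ofReal_mul, realMode_eq]; ring
    simp only [this]
    rw [integral_const_mul, integral_add ((hi _).const_mul _) ((hi _).const_mul _),
      integral_const_mul, integral_const_mul, integral_expo_mul_expo, integral_expo_mul_expo]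
    simp only [neg_inj]
  have e2 : ENNReal.ofReal (lam j ^ (-α)) = ‖((lam j ^ (-α / 2) : ℝ) : ℂ)‖ₑ ^ 2 := by
    have := Real.rpow_nonneg (lam_pos j).le (-α / 2)
    rw [← ofReal_norm, Complex.norm_real, Real.norm_of_nonneg this, ← ENNReal.ofReal_pow this,
      ← Real.rpow_natCast, ← Real.rpow_mul (lam_pos j).le]
    congr 2; push_cast; ring
  rw [fourierSq, e1, enorm_mul, mul_pow, e2]
  refine mul_le_mul_right ?_ _
  rw [← ofReal_norm, ← ENNReal.ofReal_pow (norm_nonneg _), Complex.sq_norm]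
  split_ifs
  · simp [Complex.normSq_apply]
    norm_num
  · simp [Complex.normSq_apply]
    norm_num
  · simp [Complex.normSq_apply]
    norm_num
  · simp

/-- Each real mode has its spectrum at ±j only. Summing over the basis before convolving replaces
all spectra by the single decaying symbol λ^(-α), which is how the Sobolev exponent enters the rate.
-/
lemma tsum_fourierSq_sobolevMode_le (α : ℝ) (l : ℤ × ℤ) :
    ∑' j, fourierSq (fun x => (sobolevMode α j x : ℂ)) l ≤
      2 * ENNReal.ofReal (lam l ^ (-α)) := by
  refine (ENNReal.tsum_le_tsum fun j => fourierSq_sobolevMode_le α j l).trans ?_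
  simp only [mul_add, mul_ite, mul_one, mul_zero]
  rw [ENNReal.tsum_add, tsum_ite_eq, tsum_ite_eq, lam_neg, two_mul]

/-- Growth of the tensors of the Wick powers in `H^{-α}`. -/
theorem exists_tensorNorm_sobolevMode_le {α ρ : ℝ} (hα0 : 0 < α) (hα1 : α ≤ 1)
    (hρ : (4 * Real.pi * α)⁻¹ < ρ) : ∃ C : ℝ, ∀ n : ℕ,
      ∑' j, tensorNorm n (testTensor (sobolevMode α j)) ≤
        ENNReal.ofReal (C * (n.factorial * ρ ^ n)) := by
  have hπ := Real.pi_pos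
  have hρ0 : 0 < ρ := lt_trans (by positivity) hρ
  -- The factor (4π²)⁻ⁿ of the tensor norm turns rⁿ into ρⁿ, and the assumption on ρ becomes π/r <
  -- α.
  set r : ℝ := 4 * Real.pi ^ 2 * ρ with hr
  have hr0 : 0 < r := by positivity
  have h1 : Real.pi / r < α := by
    rw [inv_lt_iff_one_lt_mul₀ (by positivity)] at hρ
    rw [div_lt_iff₀ hr0, hr]
    nlinarith
  -- A β strictly below α keeps r > π/β and also secures β < 1 in the borderline case α = 1, where
  -- the convolution bound is unavailable at α itself.
  obtain ⟨β, hβ1, hβ2⟩ := exists_between h1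
  have hβ0 : 0 < β := lt_trans (by positivity) hβ1
  obtain ⟨C, hC⟩ := exists_iterate_latticeConv_le (r := r) hβ0 (by linarith)
    (by rw [div_lt_iff₀ hβ0]; rwa [div_lt_iff₀ hr0, mul_comm] at hβ1)
  refine ⟨4 * Real.pi ^ 2 * (2 * C), fun n => ?_⟩
  have e : ∑' j, tensorNorm n (testTensor (sobolevMode α j)) = ENNReal.ofReal (4 * Real.pi ^ 2) *
      (ENNReal.ofReal (4 * Real.pi ^ 2)⁻¹ ^ n *
        latticeConv^[n] (fun l => ∑' j, fourierSq (fun x => (sobolevMode α j x : ℂ)) l) 0) := by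
    simp only [fun j => tensorNorm_testTensor (integrable_sobolevMode α j) n,
      ENNReal.tsum_mul_left, iterate_latticeConv_tsum]
  have h2 : latticeConv^[n] (fun l => ∑' j, fourierSq (fun x => (sobolevMode α j x : ℂ)) l) 0 ≤
      2 * ENNReal.ofReal (C * (n.factorial * r ^ n)) := by
    have h3 := iterate_latticeConv_mono n
      (f := fun l => ∑' j, fourierSq (fun x => (sobolevMode α j x : ℂ)) l)
      (g := fun l => 2 * ENNReal.ofReal (lam l ^ (-β))) fun l =>
        (tsum_fourierSq_sobolevMode_le α l).trans (mul_le_mul_right (ENNReal.ofReal_le_ofReal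
          (Real.rpow_le_rpow_of_exponent_le (one_le_lam l) (by linarith))) 2)
    refine (h3 0).trans ?_
    rw [iterate_latticeConv_const_mul]
    exact mul_le_mul_right (hC n 0) 2
  rw [e]
  refine (mul_le_mul_right (mul_le_mul_right h2 _) _).trans_eq ?_
  rw [← ENNReal.ofReal_ofNat 2, ← ENNReal.ofReal_pow (by positivity),
    ← ENNReal.ofReal_mul (by norm_num), ← ENNReal.ofReal_mul (by positivity),
    ← ENNReal.ofReal_mul (by positivity)]
  congr 1
  rw [hr, mul_pow, inv_pow]
  field_simp

lemma integrable_Lp (g : Lp ℝ 2 (volume : Measure Torus)) : Integrable g :=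
  (Lp.memLp g).integrable (by norm_num)

/-- Bessel's inequality for the characters of the torus. -/
lemma tsum_fourierSq_ne_top (g : Lp ℝ 2 (volume : Measure Torus)) :
    ∑' l, fourierSq (fun x => (g x : ℂ)) l ≠ ⊤ := by
  let e : ℤ × ℤ → C(Torus, ℂ) := fun k => ⟨expo k, continuous_expo k⟩
  let v : ℤ × ℤ → Lp ℂ 2 (volume : Measure Torus) := fun k =>
    ContinuousMap.toLp 2 volume ℂ (e k)
  have hv : Orthonormal ℂ v := by
    rw [orthonormal_iff_ite]
    intro k l
    rw [ContinuousMap.inner_toLp]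
    have := pairing_expo l k
    simp only [pairing, expo_neg] at this
    simp only [e, ContinuousMap.coe_mk]
    refine this.trans ?_
    simp only [eq_comm]
  have hG : MemLp (fun x => (g x : ℂ)) 2 (volume : Measure Torus) := (Lp.memLp g).ofReal
  have hB := hv.inner_products_summable (x := hG.toLp _)
  have hin : ∀ k, inner ℂ (v k) (hG.toLp _) = ∫ x, (g x : ℂ) * expo (-k) x := fun k => by
    rw [L2.inner_def]
    refine integral_congr_ae ?_
    filter_upwards [hG.coeFn_toLp, ContinuousMap.coeFn_toLp (p := 2) (𝕜 := ℂ) volume (e k)]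
      with x h1 h2
    rw [h1, h2]
    simp [e, expo_neg]
  have h1 : ∑' l, fourierSq (fun x => (g x : ℂ)) l =
      ∑' k, ENNReal.ofReal (‖inner ℂ (v k) (hG.toLp _)‖ ^ 2) := by
    rw [← (Equiv.neg (ℤ × ℤ)).tsum_eq]
    congr 1; funext k
    rw [hin, ENNReal.ofReal_pow (norm_nonneg _), ofReal_norm]
    rfl
  rw [h1, ← ENNReal.ofReal_tsum_of_nonneg (fun k => sq_nonneg _) hB]
  exact ENNReal.ofReal_ne_top

/-- A summable spectrum q need not decay, so one convolution is spent on writing it as a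
superposition of translates of λ⁻¹ ≤ λ^(-β) with weights q(K). This makes every β < 1 available, so
that tested Wick powers behave as if α = 1. -/
lemma iterate_latticeConv_succ_le {q : ℤ × ℤ → ℝ≥0∞} {β : ℝ} (hβ : β ≤ 1) (n : ℕ) :
    latticeConv^[n + 1] q 0 ≤ ∑' K, q K *
      latticeConv^[n] (fun k => ENNReal.ofReal (lam k ^ (-β))) (0 + -K) := by
  have h1 : latticeConv q ≤ fun l => ∑' K, q K * ENNReal.ofReal (lam (l + -K) ^ (-β)) := by
    intro l
    have h2 := (Equiv.addLeft (-l)).tsum_eq (fun k => ENNReal.ofReal (lam k)⁻¹ * q (l + k))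
    simp only [Equiv.coe_addLeft] at h2
    rw [latticeConv, ← h2]
    refine ENNReal.tsum_le_tsum fun K => ?_
    rw [mul_comm, add_neg_cancel_left]
    refine mul_le_mul_right (ENNReal.ofReal_le_ofReal ?_) _
    have : lam (-l + K) = lam (l + -K) := by rw [← lam_neg]; congr 1; abel
    rw [this, ← Real.rpow_neg_one]
    exact Real.rpow_le_rpow_of_exponent_le (one_le_lam _) (by linarith)
  rw [Function.iterate_succ_apply]
  refine (iterate_latticeConv_mono n h1 0).trans_eq ?_
  rw [iterate_latticeConv_tsum n (fun K l => q K * ENNReal.ofReal (lam (l + -K) ^ (-β)))]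
  beta_reduce
  refine tsum_congr fun K => ?_
  rw [iterate_latticeConv_const_mul,
    iterate_latticeConv_shift n (fun l => ENNReal.ofReal (lam l ^ (-β)))]

/-- Growth of the tensors of the Wick powers tested against a square-integrable function. -/
theorem exists_tensorNorm_Lp_le (g : Lp ℝ 2 (volume : Measure Torus)) {ρ : ℝ}
    (hρ : (4 * Real.pi)⁻¹ < ρ) : ∃ C : ℝ, ∀ n : ℕ,
      tensorNorm n (testTensor g) ≤ ENNReal.ofReal (C * (n.factorial * ρ ^ n)) := by
  have hπ := Real.pi_pos
  have hρ0 : 0 < ρ := lt_trans (by positivity) hρ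
  set r : ℝ := 4 * Real.pi ^ 2 * ρ with hr
  have hr0 : 0 < r := by positivity
  have h1 : Real.pi / r < 1 := by
    rw [inv_lt_iff_one_lt_mul₀ (by positivity)] at hρ
    rw [div_lt_iff₀ hr0, hr]
    nlinarith
  obtain ⟨β, hβ1, hβ2⟩ := exists_between h1
  have hβ0 : 0 < β := lt_trans (by positivity) hβ1
  obtain ⟨C, hC⟩ := exists_iterate_latticeConv_le (r := r) hβ0 hβ2
    (by rw [div_lt_iff₀ hβ0]; rwa [div_lt_iff₀ hr0, mul_comm] at hβ1)
  -- At n = 0 and frequency 0 the bounded quantity is 1, which forces C > 0.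
  have hC0 : 0 < C := by
    by_contra! h
    have := hC 0 0
    simp [lam, ENNReal.ofReal_eq_zero.2 h] at this
  set q := fourierSq fun x => (g x : ℂ) with hq
  set S : ℝ := (∑' l, q l).toReal with hS
  have hS' : ∑' l, q l = ENNReal.ofReal S := (ENNReal.ofReal_toReal (tsum_fourierSq_ne_top g)).symm
  have hS0 : 0 ≤ S := ENNReal.toReal_nonneg
  refine ⟨4 * Real.pi ^ 2 * S * (1 + C / r), fun n => ?_⟩
  rw [tensorNorm_testTensor (integrable_Lp g)]
  have h2 : latticeConv^[n] q 0 ≤ ENNReal.ofReal (S * (1 + C / r) * (n.factorial * r ^ n)) := by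
    cases n with
    | zero =>
      refine (ENNReal.le_tsum 0).trans (hS'.trans_le (ENNReal.ofReal_le_ofReal ?_))
      simp only [Nat.factorial_zero, Nat.cast_one, pow_zero, mul_one]
      exact le_mul_of_one_le_right hS0 (by have : 0 ≤ C / r := by positivity
                                           linarith)
    | succ n =>
      refine (iterate_latticeConv_succ_le hβ2.le n).trans ?_
      refine (ENNReal.tsum_le_tsum fun K => mul_le_mul_right (hC n _) (q K)).trans ?_
      rw [ENNReal.tsum_mul_right, hS', ← ENNReal.ofReal_mul hS0]
      refine ENNReal.ofReal_le_ofReal ?_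
      rw [mul_assoc]
      refine mul_le_mul_of_nonneg_left ?_ hS0
      have h3 : (n.factorial : ℝ) ≤ (n + 1).factorial := by
        exact_mod_cast Nat.factorial_le (Nat.le_succ n)
      -- Only n of the n + 1 convolutions contribute growth; the missing power of r goes into the
      -- constant C/r. The added 1 in 1 + C/r serves the case n = 0.
      calc C * (n.factorial * r ^ n) = C / r * (n.factorial * r ^ (n + 1)) := by
            rw [pow_succ]; field_simp
        _ ≤ (1 + C / r) * ((n + 1).factorial * r ^ (n + 1)) := by
            have : 0 ≤ C / r := by positivity
            gcongr
            linarith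
  refine (mul_le_mul_right (mul_le_mul_right h2 _) _).trans_eq ?_
  rw [← ENNReal.ofReal_pow (by positivity), ← ENNReal.ofReal_mul (by positivity),
    ← ENNReal.ofReal_mul (by positivity)]
  congr 1
  rw [hr, mul_pow, inv_pow]
  field_simp

/-! ### Convergence of Wick polynomials with values in a Hilbert space -/

section Minkowski

variable {Ω J : Type*} [MeasurableSpace Ω] {μ : Measure Ω}

/-- Minkowski's inequality for countable sums. -/
lemma eLpNorm_tsum_le [Countable J] {g : J → Ω → ℝ≥0∞} (hg : ∀ j, AEMeasurable (g j) μ) {q : ℝ}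
    (hq : 1 ≤ q) : eLpNorm (fun w => ∑' j, g j w) (ENNReal.ofReal q) μ ≤
      ∑' j, eLpNorm (g j) (ENNReal.ofReal q) μ := by
  have hq0 : 0 < q := by linarith
  have e : ∀ f : Ω → ℝ≥0∞, eLpNorm f (ENNReal.ofReal q) μ = (∫⁻ w, f w ^ q ∂μ) ^ (1 / q) :=
    fun f => by
      rw [eLpNorm_eq_lintegral_rpow_enorm_toReal (by simpa using hq0) (by simp),
        ENNReal.toReal_ofReal hq0.le]
      simp
  have h1 : ∀ w, (∑' j, g j w) ^ q = ⨆ s : Finset J, (∑ j ∈ s, g j w) ^ q := fun w => by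
    rw [ENNReal.tsum_eq_iSup_sum]
    exact (ENNReal.orderIsoRpow q hq0).map_iSup _
  have hd : Directed (· ≤ ·) fun (s : Finset J) w => (∑ j ∈ s, g j w) ^ q :=
    Monotone.directed_le fun s t hst w =>
      ENNReal.rpow_le_rpow (Finset.sum_le_sum_of_subset hst) hq0.le
  rw [e]
  simp only [h1]
  rw [lintegral_iSup_directed (fun s => (Finset.aemeasurable_fun_sum s fun j _ => hg j).pow_const q)
    hd]
  refine ((ENNReal.orderIsoRpow (1 / q) (by positivity)).map_iSup _).trans_le (iSup_le fun s => ?_)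
  refine le_trans ?_ (ENNReal.sum_le_tsum s)
  have h2 := eLpNorm_sum_le (μ := μ) (p := ENNReal.ofReal q) (f := g) (s := s)
    (fun j _ => (hg j).aestronglyMeasurable) (by simpa using hq)
  refine le_trans (le_of_eq ?_) h2
  rw [e]
  simp [ENNReal.orderIsoRpow]

/-- Minkowski's inequality in L^{p/2} for the sum of squares of the coordinates; this is where p ≥ 2
matters for values in a Hilbert space. -/
lemma eLpNorm_sq_le_tsum [Countable J] {F : Type*} [NormedAddCommGroup F] {f : Ω → F}
    {g : J → Ω → ℝ} (hg : ∀ j, AEMeasurable (g j) μ)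
    (h : ∀ w, ‖f w‖ₑ ^ 2 = ∑' j, ‖g j w‖ₑ ^ 2) {p : ℝ} (hp : 2 ≤ p) :
    eLpNorm f (ENNReal.ofReal p) μ ^ 2 ≤ ∑' j, eLpNorm (g j) (ENNReal.ofReal p) μ ^ 2 := by
  have hpe : ENNReal.ofReal p = ENNReal.ofReal (p / 2) * ENNReal.ofReal 2 := by
    rw [← ENNReal.ofReal_mul (by linarith)]; congr 1; ring
  have e1 := eLpNorm_enorm_rpow (p := ENNReal.ofReal (p / 2)) (μ := μ) f (q := 2) (by norm_num)
  have e2 := fun j => eLpNorm_enorm_rpow (p := ENNReal.ofReal (p / 2)) (μ := μ) (g j) (q := 2)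
    (by norm_num)
  rw [← hpe] at e1
  simp only [← hpe] at e2
  simp only [ENNReal.rpow_ofNat] at e1 e2
  rw [← e1]
  simp only [← e2, h]
  exact eLpNorm_tsum_le (fun j => (hg j).enorm.pow_const 2) (by linarith)

end Minkowski

/-- A family of random variables `u x` with values in `F` whose coordinates `L j (u x)` are the
Wick polynomials of fixed square-summable tensors `T j`, truncated to the finite sets `S x`. -/
structure IsWickFamily {Ω ι J F X : Type*} [MeasurableSpace Ω] [NormedAddCommGroup F]
    (μ : Measure Ω) (L : J → F →+ ℝ) (Z : Ω → ι → ℝ) (n : ℕ) (T : J → Multiset ι → ℝ)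
    (S : X → Finset ι) (u : X → Ω → F) : Prop where
  norm_sq : ∀ v, ‖v‖ₑ ^ 2 = ∑' j, ‖L j v‖ₑ ^ 2
  measurePreserving : MeasurePreserving Z μ (stdGauss ι)
  aestronglyMeasurable : ∀ x, AEStronglyMeasurable (u x) μ
  apply_eq : ∀ x j w, L j (u x w) = wickPoly (S x) n (T j) (Z w)
  tsum_ne_top : ∑' j, tensorNorm n (T j) ≠ ⊤

namespace IsWickFamily

variable {Ω ι J F X : Type*} [MeasurableSpace Ω] [NormedAddCommGroup F]
  {μ : Measure Ω} {L : J → F →+ ℝ} {Z : Ω → ι → ℝ} {n : ℕ} {T : J → Multiset ι → ℝ}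
  {S : X → Finset ι} {u : X → Ω → F}

open Classical in
-- Both truncations are rewritten over the common index set, so their difference is again a Wick
-- polynomial, with the tensor multiplied by values in {-1, 0, 1}.
lemma apply_sub_eq (h : IsWickFamily μ L Z n T S u) (x y : X) (j : J) (w : Ω) :
    L j ((u x - u y) w) = wickPoly (S x ∪ S y) n (fun m =>
      ((if ∀ i ∈ m, i ∈ S x then 1 else 0) - (if ∀ i ∈ m, i ∈ S y then 1 else 0)) * T j m)
      (Z w) := by
  have h1 := wickPoly_indicator (Finset.subset_union_left (s₁ := S x) (s₂ := S y)) n (T j) (Z w)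
  have h2 := wickPoly_indicator (Finset.subset_union_right (s₁ := S x) (s₂ := S y)) n (T j) (Z w)
  rw [Pi.sub_apply, map_sub, h.apply_eq, h.apply_eq, ← h1, ← h2, sub_eq_add_neg, ← neg_one_mul,
    ← wickPoly_const_mul, ← wickPoly_add]
  congr 1
  funext m
  split_ifs <;> ring

variable [Countable J]

/-- Hypercontractivity in each coordinate, summed by Minkowski. The finite set R disappears from the
bound, which makes it usable for differences and for limits. -/
lemma eLpNorm_sq_le_of_apply_eq (h : IsWickFamily μ L Z n T S u) {f : Ω → F} {R : Finset ι}
    {B : J → Multiset ι → ℝ} (hf : ∀ j w, L j (f w) = wickPoly R n (B j) (Z w)) {p : ℝ}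
    (hp : 2 ≤ p) : eLpNorm f (ENNReal.ofReal p) μ ^ 2 ≤
      ENNReal.ofReal ((p - 1) ^ n * n.factorial) * ∑' j, tensorNorm n (B j) := by
  have hm : ∀ j, Measurable (wickPoly R n (B j)) := fun j => measurable_wickPoly R n (B j)
  have hmZ := h.measurePreserving.measurable
  have h1 := eLpNorm_sq_le_tsum (μ := μ) (f := f) (g := fun j w => wickPoly R n (B j) (Z w))
    (fun j => ((hm j).comp hmZ).aemeasurable) (fun w => by rw [h.norm_sq]; simp only [hf]) hp
  refine h1.trans ?_
  rw [← ENNReal.tsum_mul_left]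
  refine ENNReal.tsum_le_tsum fun j => ?_
  have h2 := eLpNorm_comp_measurePreserving (p := ENNReal.ofReal p)
    (hm j).aestronglyMeasurable h.measurePreserving
  have hp1 : 0 ≤ (p - 1) ^ n * (n.factorial : ℝ) :=
    mul_nonneg (pow_nonneg (by linarith) _) (Nat.cast_nonneg _)
  rw [Function.comp_def] at h2
  rw [h2]
  refine (eLpNorm_wickPoly_sq_le R n (B j) hp).trans ?_
  rw [ENNReal.ofReal_mul hp1]
  exact mul_le_mul_right (ofReal_wickNorm_le R n (B j)) _

lemma eLpNorm_sq_le (h : IsWickFamily μ L Z n T S u) (x : X) {p : ℝ} (hp : 2 ≤ p) :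
    eLpNorm (u x) (ENNReal.ofReal p) μ ^ 2 ≤
      ENNReal.ofReal ((p - 1) ^ n * n.factorial) * ∑' j, tensorNorm n (T j) :=
  h.eLpNorm_sq_le_of_apply_eq (h.apply_eq x) hp

lemma memLp (h : IsWickFamily μ L Z n T S u) [IsProbabilityMeasure μ] (x : X) (q : ℝ) :
    MemLp (u x) (ENNReal.ofReal q) μ := by
  have h1 : MemLp (u x) (ENNReal.ofReal (max q 2)) μ := by
    refine ⟨h.aestronglyMeasurable x, ?_⟩
    have h2 := (h.eLpNorm_sq_le x (le_max_right q 2)).trans_lt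
      (ENNReal.mul_lt_top ENNReal.ofReal_lt_top h.tsum_ne_top.lt_top)
    by_contra! h3
    rw [top_le_iff.1 h3] at h2
    simp at h2
  exact h1.mono_exponent (ENNReal.ofReal_le_ofReal (le_max_left q 2))

/-- For each fixed multiset both indicators are eventually 1, so the multiplier vanishes eventually
and dominated convergence applies. Allowing two sequences gives the Cauchy property and the
independence of the region together. -/
lemma tendsto_eLpNorm_sub [Countable ι] (h : IsWickFamily μ L Z n T S u) {x y : ℕ → X}
    (hx : ∀ i, ∀ᶠ N in atTop, i ∈ S (x N)) (hy : ∀ i, ∀ᶠ N in atTop, i ∈ S (y N)) {p : ℝ}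
    (hp : 2 ≤ p) : Tendsto (fun a : ℕ × ℕ => eLpNorm (u (x a.1) - u (y a.2)) (ENNReal.ofReal p) μ)
      atTop (𝓝 0) := by
  classical
  let v : ℕ × ℕ → Multiset ι → ℝ := fun a m =>
    (if ∀ i ∈ m, i ∈ S (x a.1) then 1 else 0) - (if ∀ i ∈ m, i ∈ S (y a.2) then 1 else 0)
  have hv1 : ∀ a m, ‖v a m‖ₑ ≤ 1 := fun a m => by
    simp only [v]; split_ifs <;> simp
  have hv2 : ∀ m, Tendsto (fun a => v a m) atTop (𝓝 0) := fun m => by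
    refine tendsto_const_nhds.congr' ?_
    have h1 : ∀ {z : ℕ → X}, (∀ i, ∀ᶠ N in atTop, i ∈ S (z N)) →
        ∀ᶠ N in atTop, ∀ i ∈ m, i ∈ S (z N) := fun {z} hz => by
      have := (Filter.eventually_all_finset (l := atTop) m.toFinset
        (p := fun i N => i ∈ S (z N))).2 fun i _ => hz i
      simpa using this
    rw [← prod_atTop_atTop_eq]
    filter_upwards [(h1 hx).prod_mk (h1 hy)] with a ha
    simp only [v]
    rw [if_pos ha.1, if_pos ha.2, sub_self]
  have hlim : Tendsto (fun a => ∑' j, tensorNorm n (fun m => v a m * T j m)) atTop (𝓝 0) := by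
    refine tendsto_tsum_zero_of_dominated h.tsum_ne_top (fun a j => ?_) fun j => ?_
    · refine tensorNorm_mono n fun m => ?_
      rw [enorm_mul]
      exact mul_le_of_le_one_left zero_le (hv1 a m)
    · exact tendsto_tensorNorm_mul n (ENNReal.ne_top_of_tsum_ne_top h.tsum_ne_top j) hv1 hv2
  have hlim2 := ENNReal.Tendsto.const_mul (a := ENNReal.ofReal ((p - 1) ^ n * n.factorial)) hlim
    (Or.inr ENNReal.ofReal_ne_top)
  rw [mul_zero] at hlim2
  have h3 : Tendsto (fun a : ℕ × ℕ =>
      eLpNorm (u (x a.1) - u (y a.2)) (ENNReal.ofReal p) μ ^ 2) atTop (𝓝 0) :=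
    tendsto_of_tendsto_of_tendsto_of_le_of_le tendsto_const_nhds hlim2 (fun _ => zero_le)
      fun a => h.eLpNorm_sq_le_of_apply_eq (h.apply_sub_eq (x a.1) (y a.2)) hp
  have h4 := ENNReal.continuous_rpow_const (y := 1 / 2) |>.tendsto 0 |>.comp h3
  rw [ENNReal.zero_rpow_of_pos (by norm_num)] at h4
  refine h4.congr fun a => ?_
  rw [Function.comp_apply, ← ENNReal.rpow_natCast, ← ENNReal.rpow_mul]
  norm_num

/-- Existence of the limit along all exhausting sequences. -/
theorem exists_tendstoLp [Countable ι] [CompleteSpace F] [IsProbabilityMeasure μ]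
    (h : IsWickFamily μ L Z n T S u) {y : ℕ → X} (hy : ∀ i, ∀ᶠ N in atTop, i ∈ S (y N)) :
    ∃ Φ : Ω → F, ∀ x : ℕ → X, (∀ i, ∀ᶠ N in atTop, i ∈ S (x N)) → ∀ q : ℝ, 1 ≤ q →
      TendstoLp q μ (fun N => u (x N)) Φ := by
  have h2 : ∀ N, MemLp (u (y N)) 2 μ := fun N => by simpa using h.memLp (y N) 2
  have hC : CauchySeq fun N => (h2 N).toLp (u (y N)) := by
    rw [Lp.cauchySeq_Lp_iff_cauchySeq_eLpNorm]
    have := h.tendsto_eLpNorm_sub hy hy (p := 2) le_rfl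
    simp only [ENNReal.ofReal_ofNat] at this
    refine this.congr fun a => eLpNorm_congr_ae ?_
    exact ((h2 a.1).coeFn_toLp.sub (h2 a.2).coeFn_toLp).symm
  obtain ⟨Φ', hΦ⟩ := cauchySeq_tendsto_of_complete hC
  have hm := tendstoInMeasure_of_tendsto_Lp hΦ
  have hΦm := Lp.aestronglyMeasurable Φ'
  generalize (Φ' : Ω → F) = Φ at hm hΦm
  obtain ⟨ns, hns, hae⟩ := hm.exists_seq_tendsto_ae
  have hae' : ∀ᵐ w ∂μ, Tendsto (fun i => u (y (ns i)) w) atTop (𝓝 (Φ w)) := by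
    filter_upwards [hae, ae_all_iff.2 fun i => (h2 (ns i)).coeFn_toLp] with w h3 h4
    exact h3.congr h4
  refine ⟨Φ, fun x hx q hq => ?_⟩
  have key : Tendsto (fun N => eLpNorm (u (x N) - Φ) (ENNReal.ofReal (max q 2)) μ) atTop (𝓝 0) := by
    have h5 := h.tendsto_eLpNorm_sub hx hy (le_max_right q 2)
    rw [ENNReal.tendsto_nhds_zero] at h5 ⊢
    intro ε hε
    obtain ⟨⟨N₀, M₀⟩, h6⟩ := eventually_atTop.1 (h5 ε hε)
    filter_upwards [eventually_ge_atTop N₀] with N hN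
    -- Φ was built in L² along y only. Fatou's lemma along an almost surely convergent subsequence
    -- moves the two-sequence estimate to u(x N) - Φ in every higher exponent, for the same function
    -- Φ.
    refine Lp.eLpNorm_le_of_ae_tendsto (u := atTop) (f := fun i => u (x N) - u (y (ns i))) ?_
      (fun i => (h.aestronglyMeasurable _).sub (h.aestronglyMeasurable _)) ?_
    · filter_upwards [hns.tendsto_atTop.eventually_ge_atTop M₀] with i hi
      exact h6 (N, ns i) ⟨hN, hi⟩
    · filter_upwards [hae'] with w hw
      exact hw.const_sub _
  have key' : Tendsto (fun N => eLpNorm (u (x N) - Φ) (ENNReal.ofReal q) μ) atTop (𝓝 0) :=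
    tendsto_of_tendsto_of_tendsto_of_le_of_le tendsto_const_nhds key (fun _ => zero_le) fun N =>
      eLpNorm_le_eLpNorm_of_exponent_le (ENNReal.ofReal_le_ofReal (le_max_left q 2))
        ((h.aestronglyMeasurable _).sub hΦm)
  refine ⟨fun N => h.memLp _ q, ?_, key'⟩
  obtain ⟨N, hN⟩ := (key'.eventually (gt_mem_nhds one_pos)).exists
  have h7 := (h.memLp (x N) q).sub (⟨(h.aestronglyMeasurable _).sub hΦm, hN.trans (by simp)⟩ :
    MemLp (u (x N) - Φ) (ENNReal.ofReal q) μ)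
  rwa [sub_sub_cancel] at h7

/-- The bound on u(x N) is uniform in N, and the L^p norm is lower semicontinuous under convergence
in measure. -/
lemma eLpNorm_lim_sq_le (h : IsWickFamily μ L Z n T S u) {x : ℕ → X} {Φ : Ω → F} {p : ℝ}
    (hp : 2 ≤ p) (hΦ : TendstoLp p μ (fun N => u (x N)) Φ) :
    eLpNorm Φ (ENNReal.ofReal p) μ ^ 2 ≤
      ENNReal.ofReal ((p - 1) ^ n * n.factorial) * ∑' j, tensorNorm n (T j) := by
  have h1 : Tendsto (fun N => eLpNorm (u (x N) - Φ) (ENNReal.ofReal p) μ) atTop (𝓝 0) := hΦ.tendsto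
  have h2 := tendstoInMeasure_of_tendsto_eLpNorm (by simpa using by linarith)
    (fun N => h.aestronglyMeasurable (x N)) hΦ.memLp_lim.1 h1
  have h3 := eLpNorm_le_of_tendstoInMeasure (p := ENNReal.ofReal p)
    (C := (ENNReal.ofReal ((p - 1) ^ n * n.factorial) * ∑' j, tensorNorm n (T j)) ^ (1 / 2 : ℝ))
    (Eventually.of_forall fun N => ?_) h2 fun N => h.aestronglyMeasurable (x N)
  · refine (pow_le_pow_left' h3 2).trans_eq ?_
    rw [← ENNReal.rpow_natCast, ← ENNReal.rpow_mul]
    norm_num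
  · have h4 := ENNReal.rpow_le_rpow (h.eLpNorm_sq_le (x N) hp) (show (0 : ℝ) ≤ 1 / 2 by norm_num)
    rw [← ENNReal.rpow_natCast, ← ENNReal.rpow_mul] at h4
    norm_num at h4 ⊢
    exact h4

end IsWickFamily

/-! ### Convergence of the exponential series -/

section Series

variable {Ω F : Type*} [MeasurableSpace Ω] [NormedAddCommGroup F] [CompleteSpace F]
  {μ : Measure Ω}

lemma exists_tendstoLp_sum {p : ℝ} (hp : 1 ≤ p) {f : ℕ → Ω → F}
    (hf : ∀ n, MemLp (f n) (ENNReal.ofReal p) μ) {b : ℕ → ℝ} (hb : Summable b)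
    (hle : ∀ n, eLpNorm (f n) (ENNReal.ofReal p) μ ≤ ENNReal.ofReal (b n)) (hb0 : ∀ n, 0 ≤ b n) :
    ∃ G : Ω → F, TendstoLp p μ (fun N w => ∑ n ∈ Finset.range N, f n w) G := by
  have : Fact (1 ≤ ENNReal.ofReal p) := ⟨by simpa using hp⟩
  have hs : Summable fun n => (hf n).toLp (f n) := by
    refine Summable.of_norm_bounded hb fun n => ?_
    rw [Lp.norm_toLp]
    exact ENNReal.toReal_le_of_le_ofReal (hb0 n) (hle n)
  obtain ⟨G, hG⟩ := hs
  have hmem : ∀ N, MemLp (fun w => ∑ n ∈ Finset.range N, f n w) (ENNReal.ofReal p) μ := fun N =>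
    memLp_finsetSum _ fun n _ => hf n
  refine ⟨G, hmem, Lp.memLp G, ?_⟩
  have h1 := (Lp.tendsto_Lp_iff_tendsto_eLpNorm' _ _).1 hG.tendsto_sum_nat
  refine h1.congr fun N => eLpNorm_congr_ae ?_
  have h2 : ∀ N, (∑ n ∈ Finset.range N, (hf n).toLp (f n) : Lp F (ENNReal.ofReal p) μ) =ᵐ[μ]
      fun w => ∑ n ∈ Finset.range N, f n w := fun N => by
    induction N with
    | zero => exact Lp.coeFn_zero F (ENNReal.ofReal p) μ
    | succ N ih =>
      simp only [Finset.sum_range_succ]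
      exact (Lp.coeFn_add _ _).trans (ih.add (hf N).coeFn_toLp)
  exact (h2 N).sub EventuallyEq.rfl

/-- The exponential series converges when the `n`-th squared norm grows at most like
`(p - 1)ⁿ n! · n! ρⁿ` for some `ρ` with `a² (p - 1) ρ < 1`. -/
theorem exists_tendstoLp_exp_series [NormedSpace ℝ F] {p a C ρ : ℝ} (hp : 2 ≤ p) (hC : 0 ≤ C)
    (hρ : 0 ≤ ρ)
    (ha : a ^ 2 * ((p - 1) * ρ) < 1) {Φ : ℕ → Ω → F} (hΦ : ∀ n, MemLp (Φ n) (ENNReal.ofReal p) μ)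
    (hle : ∀ n, eLpNorm (Φ n) (ENNReal.ofReal p) μ ^ 2 ≤
      ENNReal.ofReal ((p - 1) ^ n * n.factorial) * ENNReal.ofReal (C * (n.factorial * ρ ^ n))) :
    ∃ G : Ω → F, TendstoLp p μ
      (fun N w => ∑ n ∈ Finset.range N, (a ^ n / (n.factorial : ℝ)) • Φ n w) G := by
  have hp1 : 0 ≤ p - 1 := by linarith
  -- In (aⁿ/n!)² (p-1)ⁿ n! · n! ρⁿ the factorials cancel and r^(2n) remains: one n! comes from the
  -- chaos norm, the other from the growth of the tensors.
  set r : ℝ := √(a ^ 2 * ((p - 1) * ρ)) with hr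
  have hr2 : r ^ 2 = a ^ 2 * ((p - 1) * ρ) := Real.sq_sqrt (by positivity)
  have hr1 : r < 1 := by rw [hr, Real.sqrt_lt' one_pos]; simpa using ha
  refine exists_tendstoLp_sum (f := fun n w => (a ^ n / (n.factorial : ℝ)) • Φ n w)
    (b := fun n => √C * r ^ n) (by linarith) (fun n => (hΦ n).const_smul _)
    ((summable_geometric_of_lt_one (Real.sqrt_nonneg _) hr1).mul_left _) (fun n => ?_)
    fun n => by positivity
  have hn : (n.factorial : ℝ) ≠ 0 := by positivity
  rw [show (fun w => (a ^ n / (n.factorial : ℝ)) • Φ n w) = (a ^ n / (n.factorial : ℝ)) • Φ n from rfl,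
    eLpNorm_const_smul]
  rw [← ENNReal.pow_le_pow_left_iff two_ne_zero, mul_pow]
  refine (mul_le_mul_right (hle n) _).trans ?_
  rw [Real.enorm_eq_ofReal_abs, ← ENNReal.ofReal_pow (abs_nonneg _), sq_abs,
    ← ENNReal.ofReal_pow (by positivity), ← ENNReal.ofReal_mul (by positivity),
    ← ENNReal.ofReal_mul (by positivity)]
  refine ENNReal.ofReal_le_ofReal (le_of_eq ?_)
  rw [mul_pow, Real.sq_sqrt hC, ← pow_mul, mul_comm n 2, pow_mul, hr2, mul_pow, mul_pow,
    ← pow_mul, div_pow, ← pow_mul, mul_comm n 2]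
  field_simp

end Series

/-- The hypothesis says a²(p-1)y < 1 strictly, which leaves room above y. With x = a²(p-1), the
increment (1 - xy)/(2(x+1)) uses up less than the gap 1 - xy after multiplication by x. -/
lemma exists_rate {a p y : ℝ} (hp : 2 ≤ p) (hy : 0 < y) (ha : |a| < √(y⁻¹ / (p - 1))) :
    ∃ ρ : ℝ, y < ρ ∧ a ^ 2 * ((p - 1) * ρ) < 1 := by
  have hp1 : 0 < p - 1 := by linarith
  rw [Real.lt_sqrt (abs_nonneg _), sq_abs, lt_div_iff₀ hp1, ← mul_lt_mul_iff_left₀ hy,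
    inv_mul_cancel₀ hy.ne'] at ha
  set x : ℝ := a ^ 2 * (p - 1) with hx
  have hx0 : 0 ≤ x := by positivity
  refine ⟨y + (1 - x * y) / (2 * (x + 1)), lt_add_of_pos_right _ (div_pos (by linarith)
    (by positivity)), ?_⟩
  rw [← mul_assoc, ← hx, mul_add]
  have h1 : x * ((1 - x * y) / (2 * (x + 1))) < 1 - x * y := by
    rw [mul_div_assoc', div_lt_iff₀ (by positivity)]
    nlinarith
  linarith

/-! ### The two families of regularized Wick powers -/

namespace Sobolev

variable {s : ℝ}

/-- `Sobolev.coord` as an additive map. -/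
def coordHom (s : ℝ) (j : ℤ × ℤ) : Sobolev s →+ ℝ where
  toFun u := u.coord j
  map_zero' := by rw [← basis_repr, map_zero]; rfl
  map_add' u v := by simp only [← basis_repr, map_add]; rfl

lemma enorm_sq_eq_tsum (v : Sobolev s) : ‖v‖ₑ ^ 2 = ∑' j, ‖coordHom s j v‖ₑ ^ 2 := by
  have h1 : Summable fun j => v.coord j ^ 2 := by
    simpa using v.memℓp_coord.summable (by norm_num)
  have h2 : ‖v‖ ^ 2 = ∑' j, v.coord j ^ 2 := by
    rw [← real_inner_self_eq_norm_sq, ← (basis s).repr.inner_map_map, lp.inner_eq_tsum]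
    refine tsum_congr fun j => ?_
    rw [basis_repr]
    simp [sq]
  rw [← ofReal_norm, ← ENNReal.ofReal_pow (norm_nonneg _), h2,
    ENNReal.ofReal_tsum_of_nonneg (fun j => sq_nonneg _) h1]
  refine tsum_congr fun j => ?_
  rw [Real.enorm_eq_ofReal_abs, ← ENNReal.ofReal_pow (abs_nonneg _), sq_abs]
  rfl

lemma measurable_of_coord {Ω : Type*} [MeasurableSpace Ω] {f : Ω → Sobolev s}
    (hf : ∀ j, Measurable fun w => (f w).coord j) : Measurable f := by
  refine measurable_of_tendsto_metrizable' (u := atTop)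
    (f := fun (t : Finset (ℤ × ℤ)) w => ∑ j ∈ t, (f w).coord j • basis s j) (fun t => ?_) ?_
  · exact Finset.measurable_fun_sum t fun j _ => (hf j).smul_const _
  · exact tendsto_pi_nhds.2 fun w => (basis s).hasSum_repr (f w)

end Sobolev

/-- For real f, adding the real and imaginary parts of the integral of f against the conjugate of
e_j gives the weight Re e_j - Im e_j; hence the minus sign in `realMode`. -/
lemma coord_ofContinuous {α : ℝ} (hα : -α ≤ 0) (f : C(Torus, ℝ)) (j : ℤ × ℤ) :
    (ofContinuous hα f).coord j = ∫ x, f x * sobolevMode α j x := by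
  have hi : Integrable fun x => (f x : ℂ) * (starRingEnd ℂ) (expo j x) := by
    have := continuous_expo j
    exact integrable_of_continuous (by fun_prop)
  have h1 : (ofContinuous hα f).coeff j = ∫ x, (f x : ℂ) * (starRingEnd ℂ) (expo j x) :=
    fcoeff_regular f j
  have h2 : (ofContinuous hα f).hartley j = ∫ x, f x * realMode j x := by
    rw [Sobolev.hartley, h1]
    have hre := integral_re hi
    have him := integral_im hi
    simp only [RCLike.re_to_complex, RCLike.im_to_complex] at hre him
    rw [← hre, ← him]
    refine (integral_add hi.re hi.im).symm.trans (integral_congr_ae (Eventually.of_forall fun x => ?_))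
    simp [realMode]
    ring
  rw [Sobolev.coord, h2, ← integral_const_mul]
  congr 1
  funext x
  rw [sobolevMode]
  ring

instance instIsProbabilityMeasureFreeField {δ : ℝ} (hδ : 0 < δ) :
    IsProbabilityMeasure (freeField hδ) :=
  (isFreeField_freeField hδ).isGaussian.toIsProbabilityMeasure

/-- A reference region (a square, in the sup norm of the plane) along which the limits are
constructed and their norms are estimated. -/
lemma isCutoff_closedBall : IsCutoff (Metric.closedBall 0 1) where
  isCompact := isCompact_closedBall 0 1
  neg_eq := by ext; simp
  zero_mem := mem_interior_iff_mem_nhds.2 (Metric.closedBall_mem_nhds 0 one_pos)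

/-- The lattice points of the dilated cut-off regions. -/
def cutoffPoints (x : {Λ : Set (ℝ × ℝ) // IsCutoff Λ} × ℕ) : Finset (ℤ × ℤ) :=
  latticePoints ((x.2 : ℝ) • x.1.1)

lemma integral_wick_mul_eq_wickPoly {s : ℝ} (x : {Λ : Set (ℝ × ℝ) // IsCutoff Λ} × ℕ) (n : ℕ)
    {g : Torus → ℝ} (hg : Integrable g) (z : Sobolev s) :
    ∫ y, wick n ((x.2 : ℝ) • x.1.1) z y * g y =
      wickPoly (cutoffPoints x) n (testTensor g) (modes z) :=
  integral_wick_mul (x.1.2.zero_mem_latticePoints _)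
    (fun _ hk => x.1.2.neg_mem_latticePoints _ hk) n hg z

lemma measurable_wickPoly_modes {s : ℝ} (R : Finset (ℤ × ℤ)) (n : ℕ)
    (A : Multiset (ℤ × ℤ) → ℝ) : Measurable fun z : Sobolev s => wickPoly R n A (modes z) :=
  (measurable_wickPoly R n A).comp measurable_modes

lemma isWickFamily_ofContinuous {δ α : ℝ} (hδ : 0 < δ) (hα : 0 < α) (hα1 : α ≤ 1) (n : ℕ) :
    IsWickFamily (freeField hδ) (Sobolev.coordHom (-α)) modes n
      (fun j => testTensor (sobolevMode α j)) cutoffPoints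
      (fun x z => ofContinuous (neg_nonpos.2 hα.le) (wick n ((x.2 : ℝ) • x.1.1) z)) := by
  have h1 : ∀ (x : {Λ : Set (ℝ × ℝ) // IsCutoff Λ} × ℕ) (j : ℤ × ℤ) (z : Sobolev (-δ)),
      (ofContinuous (neg_nonpos.2 hα.le) (wick n ((x.2 : ℝ) • x.1.1) z)).coord j =
        wickPoly (cutoffPoints x) n (testTensor (sobolevMode α j)) (modes z) := fun x j z => by
    rw [coord_ofContinuous, integral_wick_mul_eq_wickPoly x n (integrable_sobolevMode α j)]
  refine ⟨Sobolev.enorm_sq_eq_tsum, measurePreserving_modes hδ, fun x => ?_, h1, ?_⟩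
  · refine (Sobolev.measurable_of_coord fun j => ?_).stronglyMeasurable.aestronglyMeasurable
    simp only [h1]
    exact measurable_wickPoly_modes _ _ _
  -- Only finiteness for the given n is needed, so any admissible rate will do.
  · obtain ⟨C, hC⟩ := exists_tensorNorm_sobolevMode_le hα hα1 (lt_add_one _)
    exact ((hC n).trans_lt ENNReal.ofReal_lt_top).ne

lemma isWickFamily_wickTested {δ : ℝ} (hδ : 0 < δ) (g : Lp ℝ 2 (volume : Measure Torus)) (n : ℕ) :
    IsWickFamily (freeField hδ) (fun _ : Unit => AddMonoidHom.id ℝ) modes n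
      (fun _ => testTensor g) cutoffPoints
      (fun x z => wickTested n ((x.2 : ℝ) • x.1.1) g z) := by
  have h1 : ∀ (x : {Λ : Set (ℝ × ℝ) // IsCutoff Λ} × ℕ) (z : Sobolev (-δ)),
      wickTested n ((x.2 : ℝ) • x.1.1) g z =
        wickPoly (cutoffPoints x) n (testTensor g) (modes z) := fun x z =>
    integral_wick_mul_eq_wickPoly x n (integrable_Lp g) z
  refine ⟨fun v => by simp, measurePreserving_modes hδ, fun x => ?_, fun x _ z => h1 x z, ?_⟩
  · simp only [h1]
    exact (measurable_wickPoly_modes _ _ _).aestronglyMeasurable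
  · obtain ⟨C, hC⟩ := exists_tensorNorm_Lp_le g (lt_add_one _)
    simpa using ((hC n).trans_lt ENNReal.ofReal_lt_top).ne

section Cutoff

variable {δ : ℝ} {hδ : 0 < δ} {J F : Type*} [NormedAddCommGroup F] [Countable J]
  {L : J → F →+ ℝ}

/-- All regions and dilations form one Wick family indexed by pairs, so the limit along the
reference square serves every admissible Λ. -/
theorem exists_tendstoLp_cutoff [CompleteSpace F] {T : J → Multiset (ℤ × ℤ) → ℝ} {n : ℕ}
    {u : Set (ℝ × ℝ) → Sobolev (-δ) → F}
    (h : IsWickFamily (freeField hδ) L modes n T cutoffPoints fun x => u ((x.2 : ℝ) • x.1.1)) :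
    ∃ Φ : Sobolev (-δ) → F, ∀ Λ : Set (ℝ × ℝ), IsCutoff Λ → ∀ q : ℝ, 1 ≤ q →
      TendstoLp q (freeField hδ) (fun N => u ((N : ℝ) • Λ)) Φ := by
  obtain ⟨Φ, hΦ⟩ := h.exists_tendstoLp (y := fun N => (⟨_, isCutoff_closedBall⟩, N))
    isCutoff_closedBall.eventually_mem_latticePoints
  exact ⟨Φ, fun Λ hΛ => hΦ (fun N => (⟨Λ, hΛ⟩, N)) hΛ.eventually_mem_latticePoints⟩

theorem exists_tendstoLp_exp_series_cutoff [NormedSpace ℝ F] [CompleteSpace F]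
    {T : ℕ → J → Multiset (ℤ × ℤ) → ℝ} {u : ℕ → Set (ℝ × ℝ) → Sobolev (-δ) → F}
    (h : ∀ n, IsWickFamily (freeField hδ) L modes n (T n) cutoffPoints
      fun x => u n ((x.2 : ℝ) • x.1.1)) {p a y : ℝ} (hp : 2 ≤ p) (hy : 0 < y)
    (hT : ∀ ρ, y < ρ → ∃ C : ℝ, ∀ n, ∑' j, tensorNorm n (T n j) ≤
      ENNReal.ofReal (C * (n.factorial * ρ ^ n)))
    (ha : |a| < √(y⁻¹ / (p - 1))) {Φ : ℕ → Sobolev (-δ) → F}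
    (hΦ : ∀ n, ∀ Λ : Set (ℝ × ℝ), IsCutoff Λ → ∀ q : ℝ, 1 ≤ q →
      TendstoLp q (freeField hδ) (fun N => u n ((N : ℝ) • Λ)) (Φ n)) :
    ∃ G : Sobolev (-δ) → F, TendstoLp p (freeField hδ)
      (fun N z => ∑ n ∈ Finset.range N, (a ^ n / (n.factorial : ℝ)) • Φ n z) G := by
  obtain ⟨ρ, hρ, haρ⟩ := exists_rate hp hy ha
  obtain ⟨C, hC⟩ := hT ρ hρ
  have hρ0 : 0 ≤ ρ := by linarith
  have hΦ' := fun n => hΦ n _ isCutoff_closedBall p (by linarith)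
  refine exists_tendstoLp_exp_series (C := |C|) hp (abs_nonneg C) hρ0 haρ
    (fun n => (hΦ' n).memLp_lim) fun n => ?_
  refine ((h n).eLpNorm_lim_sq_le (x := fun N => (⟨_, isCutoff_closedBall⟩, N)) hp
    (hΦ' n)).trans (mul_le_mul_right ((hC n).trans (ENNReal.ofReal_le_ofReal ?_)) _)
  exact mul_le_mul_of_nonneg_right (le_abs_self C) (by positivity)

end Cutoff

end TorusField

end

open TorusField

theorem proposition3p2 (δ : ℝ) (hδ : 0 < δ) (p : ℝ) (hp : 2 ≤ p) (a : ℝ) :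
    (∀ (α : ℝ) (hα : 0 < α), α ≤ 1 →
      (∀ n : ℕ, ∃ Φ : Sobolev (-δ) → Sobolev (-α), IsWickPower hδ hα n Φ) ∧
      ∀ Φ : ℕ → Sobolev (-δ) → Sobolev (-α), (∀ n, IsWickPower hδ hα n (Φ n)) →
        |a| < √(4 * Real.pi * α / (p - 1)) →
        ∃ S : Sobolev (-δ) → Sobolev (-α),
          TendstoLp p (freeField hδ)
            (fun N z => ∑ n ∈ Finset.range N, (a ^ n / (n.factorial : ℝ)) • Φ n z) S) ∧
    (∀ g : MeasureTheory.Lp ℝ 2 (MeasureTheory.volume : MeasureTheory.Measure Torus),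
      (∀ n : ℕ, ∃ Ψ : Sobolev (-δ) → ℝ, IsWickTested hδ n g Ψ) ∧
      ∀ Ψ : ℕ → Sobolev (-δ) → ℝ, (∀ n, IsWickTested hδ n g (Ψ n)) →
        |a| < √(4 * Real.pi / (p - 1)) →
        ∃ S : Sobolev (-δ) → ℝ,
          TendstoLp p (freeField hδ)
            (fun N z => ∑ n ∈ Finset.range N, (a ^ n / (n.factorial : ℝ)) * Ψ n z) S) := by
  have hπ := Real.pi_pos
  refine ⟨fun α hα hα1 => ⟨fun n => ?_, fun Φ hΦ ha => ?_⟩, fun g => ⟨fun n => ?_, fun Ψ hΨ ha => ?_⟩⟩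
  · exact exists_tendstoLp_cutoff
      (u := fun Λ z => ofContinuous (neg_nonpos.2 hα.le) (wick n Λ z))
      (isWickFamily_ofContinuous hδ hα hα1 n)
  -- The threshold rate y = (4πα)⁻¹ is the one whose condition |a| < √(y⁻¹/(p-1)) is that of the
  -- statement; for tested powers α is replaced by 1.
  · exact exists_tendstoLp_exp_series_cutoff
      (u := fun n Λ z => ofContinuous (neg_nonpos.2 hα.le) (wick n Λ z))
      (isWickFamily_ofContinuous hδ hα hα1) (y := (4 * Real.pi * α)⁻¹) hp (by positivity)
      (fun ρ hρ => exists_tensorNorm_sobolevMode_le hα hα1 hρ) (by rwa [inv_inv]) hΦ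
  · exact exists_tendstoLp_cutoff (u := fun Λ z => wickTested n Λ g z)
      (isWickFamily_wickTested hδ g n)
  · exact exists_tendstoLp_exp_series_cutoff (u := fun n Λ z => wickTested n Λ g z)
      (isWickFamily_wickTested hδ g) (y := (4 * Real.pi)⁻¹) hp (by positivity)
      (fun ρ hρ => by simpa using exists_tensorNorm_Lp_le g hρ) (by rwa [inv_inv]) hΨ
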